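/- Let $G=(V,E,w)$ be a finite simple undirected graph with $n=|V|$ vertices, $m=|E|\ge 1$ edges and edge weights $w:E\to\mathbb{Q}_{>0}$. For $S\subseteq V$ let $w(S)$ be the total weight of the edges with both endpoints in $S$, and for $v\in S$ let $d_S(v)$ be the total weight of the edges joining $v$ to vertices of $S$. Let $f:\mathbb{Z}_{\ge 0}\to\mathbb{R}_{\ge 0}$ be monotonically non-decreasing and convex, i.e. $f(x)-2f(x+1)+f(x+2)\ge 0$ for all $x\in\mathbb{Z}_{\ge 0}$, with $f(0)=0$ and $f(2)>0$. The $f$-density of $S$ is $w(S)/f(|S|)$ (read as $0$ if $w(S)=f(|S|)=0$), and the $f$-densest subgraph problem asks for a set $S\subseteq V$ of maximum $f$-density. Consider the algorithm that outputs whichever of the following two sets has the larger $f$-density (all ties being broken arbitrarily). (1) Brute-force search with $k=2$: a set $S$ maximizing $w(S)$ among the sets of two vertices, i.e. the two endpoints of a heaviest edge. (2) Greedy peeling: put $S_n=V$; for $i=n,\dots,2$ choose $v_i\in S_i$ minimizing $d_{S_i}(v)$ over $v\in S_i$ and put $S_{i-1}=S_i\setminus\{v_i\}$; the result is a set of maximum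 $f$-density among $S_1,\dots,S_n$. Then: (a) The algorithm can be implemented to run in $O(m+n\log n)$ time: there are one program and one absolute constant $C$ such that, for every such $G$ (given as a list of its weighted edges in any order) and every such $f$, the program halts after at most $C\,(m+n\log n)$ elementary operations and returns a set that is a possible output of the algorithm. Here programs run on a random access machine in which each of the following is one operation: memory access, addition and subtraction and comparison of integers, addition and subtraction and comparison of rationals, and comparison of $p\cdot f(i)$ with $q\cdot f(j)$ for $p,q\in\mathbb{Q}$ and $i,j\in\mathbb{Z}_{\ge 0}$, which is the only access to $f$. (b) For every possible output $S$ of the algorithm and every optimal solution $S^*$ of the $f$-densest subgraph problem, $$\frac{w(S^*)}{f(|S^*|)}\;\le\;\min\left\{\frac{f(2)/2}{f(|S^*|)/|S^*|^2},\ \frac{2f(n)/n}{f(|S^*|)-f(|S^*|-1)}\right\}\cdot\frac{w(S)}{f(|S|)}.$$ -/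

import Mathlib

namespace FDS

/-! ### Size functions -/

/-- A size function: a monotonically non-decreasing `f : ℕ → ℝ` with `f 0 = 0`
(hence with values in the nonnegative reals). -/
structure IsSizeFunction (f : ℕ → ℝ) : Prop where
  zero : f 0 = 0
  mono : Monotone f

theorem IsSizeFunction.nonneg {f : ℕ → ℝ} (hf : IsSizeFunction f) (x : ℕ) : 0 ≤ f x :=
  hf.zero ▸ hf.mono (Nat.zero_le x)

/-- Discrete convexity. -/
def IsConvex (f : ℕ → ℝ) : Prop :=
  ∀ x : ℕ, 0 ≤ f x - 2 * f (x + 1) + f (x + 2)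

/-! ### Weights, degrees, densities -/

section Graph

variable {V : Type*} [Fintype V] [DecidableEq V]

/-- `w(S)`: the total weight of the edges of `G` with both endpoints in `S`. -/
def inducedWeight (G : SimpleGraph V) [DecidableRel G.Adj] (w : Sym2 V → ℚ) (S : Finset V) : ℚ :=
  ∑ e ∈ G.edgeFinset with ∀ v ∈ e, v ∈ S, w e

/-- `d_S(v)`: the weighted degree of `v` in the subgraph of `G` induced by `S` (for `v ∈ S`). -/
def weightedDegree (G : SimpleGraph V) [DecidableRel G.Adj] (w : Sym2 V → ℚ) (S : Finset V)
    (v : V) : ℚ :=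
  ∑ u ∈ S with G.Adj v u, w s(v, u)

/-- The `f`-density `w(S) / f(|S|)`. An edgeless set of size `k` with `f k = 0` (such as the
empty set) has density `0`. -/
noncomputable def fDensity (G : SimpleGraph V) [DecidableRel G.Adj] (w : Sym2 V → ℚ) (f : ℕ → ℝ)
    (S : Finset V) : ℝ :=
  (inducedWeight G w S : ℝ) / f S.card

/-- `S` is an optimal solution to the `f`-densest subgraph problem. -/
def IsOptimal (G : SimpleGraph V) [DecidableRel G.Adj] (w : Sym2 V → ℚ) (f : ℕ → ℝ)
    (S : Finset V) : Prop :=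
  ∀ T : Finset V, fDensity G w f T ≤ fDensity G w f S

/-! ### The algorithm, with ties broken arbitrarily -/

/-- `S` is a maximum-weight vertex set of size `i`. -/
def IsMaxWeightOfSize (G : SimpleGraph V) [DecidableRel G.Adj] (w : Sym2 V → ℚ) (i : ℕ)
    (S : Finset V) : Prop :=
  S.card = i ∧ ∀ T : Finset V, T.card = i → inducedWeight G w T ≤ inducedWeight G w S

/-- `S` is a possible result of the brute-force search with parameter `k`: for `i = 2, …, k` choose
a maximum-weight set `A i` of size `i`, and return one of them with the largest `f`-density. For
`k = 2` the result is the set of the two endpoints of a heaviest edge. -/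
def IsBruteForceOutput (G : SimpleGraph V) [DecidableRel G.Adj] (w : Sym2 V → ℚ) (f : ℕ → ℝ)
    (k : ℕ) (S : Finset V) : Prop :=
  ∃ A : ℕ → Finset V,
    (∀ i ∈ Finset.Icc 2 k, IsMaxWeightOfSize G w i (A i)) ∧
    ∃ i ∈ Finset.Icc 2 k, S = A i ∧ ∀ j ∈ Finset.Icc 2 k, fDensity G w f (A j) ≤ fDensity G w f S

/-- `A n, …, A 1` is a possible sequence of the vertex sets produced by greedy peeling: start from
the whole vertex set and repeatedly delete a vertex of minimum weighted degree. -/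
def IsPeelingSequence (G : SimpleGraph V) [DecidableRel G.Adj] (w : Sym2 V → ℚ)
    (A : ℕ → Finset V) : Prop :=
  A (Fintype.card V) = Finset.univ ∧
  ∀ i ∈ Finset.Icc 2 (Fintype.card V), ∃ v ∈ A i,
    (∀ u ∈ A i, weightedDegree G w (A i) v ≤ weightedDegree G w (A i) u) ∧
    A (i - 1) = (A i).erase v

/-- `S` is a possible result of greedy peeling: a set of largest `f`-density among the sets of a
peeling sequence. -/
def IsPeelingOutput (G : SimpleGraph V) [DecidableRel G.Adj] (w : Sym2 V → ℚ) (f : ℕ → ℝ)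
    (S : Finset V) : Prop :=
  ∃ A : ℕ → Finset V, IsPeelingSequence G w A ∧
    ∃ i ∈ Finset.Icc 1 (Fintype.card V), S = A i ∧
      ∀ j ∈ Finset.Icc 1 (Fintype.card V), fDensity G w f (A j) ≤ fDensity G w f S

/-- `S` is a possible result of the combined algorithm: the better of a result of the brute-force
search with `k = 2` and a result of greedy peeling. -/
def IsAlgorithmOutput (G : SimpleGraph V) [DecidableRel G.Adj] (w : Sym2 V → ℚ) (f : ℕ → ℝ)
    (S : Finset V) : Prop :=
  ∃ B P : Finset V, IsBruteForceOutput G w f 2 B ∧ IsPeelingOutput G w f P ∧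
    ((S = B ∧ fDensity G w f P ≤ fDensity G w f B) ∨
      (S = P ∧ fDensity G w f B ≤ fDensity G w f P))

end Graph

/-! ### The machine model

A random access machine with unit-cost elementary operations, presented as a structured language.
Its memory consists of integer and rational scalars and of integer and rational arrays; rationals
can be added, subtracted and compared but neither multiplied nor converted to integers. The size
function `f` is available only through comparisons of `p * f i` and `q * f j`, each of which is one
operation. -/

/-- A memory state. Scalars and arrays are named by natural numbers. -/
structure Store where
  nat : ℕ → ℕ
  rat : ℕ → ℚ
  natArr : ℕ → ℕ → ℕ
  ratArr : ℕ → ℕ → ℚ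

/-- Integer expressions; `sub` is truncated subtraction. -/
inductive NExp where
  | lit (c : ℕ)
  | var (x : ℕ)
  | get (a : ℕ) (i : NExp)
  | add (e₁ e₂ : NExp)
  | sub (e₁ e₂ : NExp)

/-- Rational expressions. -/
inductive QExp where
  | lit (c : ℚ)
  | var (x : ℕ)
  | get (a : ℕ) (i : NExp)
  | add (e₁ e₂ : QExp)
  | sub (e₁ e₂ : QExp)

/-- Tests; `sizeLe p i q j` is the comparison `p * f i ≤ q * f j`. -/
inductive Test where
  | natLe (e₁ e₂ : NExp)
  | ratLe (e₁ e₂ : QExp)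
  | sizeLe (p : QExp) (i : NExp) (q : QExp) (j : NExp)
  | not (b : Test)
  | and (b₁ b₂ : Test)

/-- Programs. -/
inductive Prog where
  | skip
  | setNat (x : ℕ) (e : NExp)
  | setRat (x : ℕ) (e : QExp)
  | putNat (a : ℕ) (i e : NExp)
  | putRat (a : ℕ) (i : NExp) (e : QExp)
  | seq (p q : Prog)
  | cond (b : Test) (p q : Prog)
  | loop (b : Test) (p : Prog)

def NExp.eval (σ : Store) : NExp → ℕ
  | lit c => c
  | var x => σ.nat x
  | get a i => σ.natArr a (i.eval σ)
  | add e₁ e₂ => e₁.eval σ + e₂.eval σ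
  | sub e₁ e₂ => e₁.eval σ - e₂.eval σ

/-- The number of elementary operations in the evaluation of an expression. -/
def NExp.cost : NExp → ℕ
  | lit _ => 1
  | var _ => 1
  | get _ i => i.cost + 1
  | add e₁ e₂ => e₁.cost + e₂.cost + 1
  | sub e₁ e₂ => e₁.cost + e₂.cost + 1

def QExp.eval (σ : Store) : QExp → ℚ
  | lit c => c
  | var x => σ.rat x
  | get a i => σ.ratArr a (i.eval σ)
  | add e₁ e₂ => e₁.eval σ + e₂.eval σ
  | sub e₁ e₂ => e₁.eval σ - e₂.eval σ

def QExp.cost : QExp → ℕ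
  | lit _ => 1
  | var _ => 1
  | get _ i => i.cost + 1
  | add e₁ e₂ => e₁.cost + e₂.cost + 1
  | sub e₁ e₂ => e₁.cost + e₂.cost + 1

/-- The truth of a test in a memory state, for the size function `f`. -/
def Test.Holds (f : ℕ → ℝ) (σ : Store) : Test → Prop
  | natLe e₁ e₂ => e₁.eval σ ≤ e₂.eval σ
  | ratLe e₁ e₂ => e₁.eval σ ≤ e₂.eval σ
  | sizeLe p i q j => (p.eval σ : ℝ) * f (i.eval σ) ≤ (q.eval σ : ℝ) * f (j.eval σ)
  | not b => ¬ b.Holds f σ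
  | and b₁ b₂ => b₁.Holds f σ ∧ b₂.Holds f σ

def Test.cost : Test → ℕ
  | natLe e₁ e₂ => e₁.cost + e₂.cost + 1
  | ratLe e₁ e₂ => e₁.cost + e₂.cost + 1
  | sizeLe p i q j => p.cost + i.cost + q.cost + j.cost + 1
  | not b => b.cost + 1
  | and b₁ b₂ => b₁.cost + b₂.cost + 1

def Store.setNat (σ : Store) (x c : ℕ) : Store :=
  { σ with nat := Function.update σ.nat x c }

def Store.setRat (σ : Store) (x : ℕ) (c : ℚ) : Store :=
  { σ with rat := Function.update σ.rat x c }

def Store.putNat (σ : Store) (a i c : ℕ) : Store :=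
  { σ with natArr := Function.update σ.natArr a (Function.update (σ.natArr a) i c) }

def Store.putRat (σ : Store) (a i : ℕ) (c : ℚ) : Store :=
  { σ with ratArr := Function.update σ.ratArr a (Function.update (σ.ratArr a) i c) }

/-- `Run f p σ t τ`: for the size function `f`, the program `p` started in the memory state `σ`
halts in the memory state `τ` after exactly `t` elementary operations. -/
inductive Run (f : ℕ → ℝ) : Prog → Store → ℕ → Store → Prop where
  | skip (σ : Store) : Run f .skip σ 1 σ
  | setNat (σ : Store) (x : ℕ) (e : NExp) :
      Run f (.setNat x e) σ (e.cost + 1) (σ.setNat x (e.eval σ))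
  | setRat (σ : Store) (x : ℕ) (e : QExp) :
      Run f (.setRat x e) σ (e.cost + 1) (σ.setRat x (e.eval σ))
  | putNat (σ : Store) (a : ℕ) (i e : NExp) :
      Run f (.putNat a i e) σ (i.cost + e.cost + 1) (σ.putNat a (i.eval σ) (e.eval σ))
  | putRat (σ : Store) (a : ℕ) (i : NExp) (e : QExp) :
      Run f (.putRat a i e) σ (i.cost + e.cost + 1) (σ.putRat a (i.eval σ) (e.eval σ))
  | seq {p q : Prog} {σ ρ τ : Store} {s t : ℕ} (hp : Run f p σ s ρ) (hq : Run f q ρ t τ) :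
      Run f (.seq p q) σ (s + t) τ
  | condTrue {b : Test} {p q : Prog} {σ τ : Store} {t : ℕ} (hb : b.Holds f σ)
      (hp : Run f p σ t τ) : Run f (.cond b p q) σ (b.cost + t) τ
  | condFalse {b : Test} {p q : Prog} {σ τ : Store} {t : ℕ} (hb : ¬ b.Holds f σ)
      (hq : Run f q σ t τ) : Run f (.cond b p q) σ (b.cost + t) τ
  | loopDone {b : Test} {p : Prog} {σ : Store} (hb : ¬ b.Holds f σ) :
      Run f (.loop b p) σ b.cost σ
  | loopStep {b : Test} {p : Prog} {σ ρ τ : Store} {s t : ℕ} (hb : b.Holds f σ)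
      (hp : Run f p σ s ρ) (hl : Run f (.loop b p) ρ t τ) :
      Run f (.loop b p) σ (b.cost + s + t) τ

/-- Programs are deterministic, so that the existence of a halting run describes the behaviour of
the program completely. -/
theorem Run.deterministic {f : ℕ → ℝ} {p : Prog} {σ τ τ' : Store} {t t' : ℕ}
    (h : Run f p σ t τ) (h' : Run f p σ t' τ') : t = t' ∧ τ = τ' := by
  induction h generalizing t' τ' with
  | skip => cases h'; exact ⟨rfl, rfl⟩
  | setNat => cases h'; exact ⟨rfl, rfl⟩
  | setRat => cases h'; exact ⟨rfl, rfl⟩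
  | putNat => cases h'; exact ⟨rfl, rfl⟩
  | putRat => cases h'; exact ⟨rfl, rfl⟩
  | seq _ _ ih₁ ih₂ =>
    cases h' with
    | seq h₁ h₂ =>
      obtain ⟨rfl, rfl⟩ := ih₁ h₁
      obtain ⟨rfl, rfl⟩ := ih₂ h₂
      exact ⟨rfl, rfl⟩
  | condTrue hb _ ih =>
    cases h' with
    | condTrue _ h₁ => obtain ⟨rfl, rfl⟩ := ih h₁; exact ⟨rfl, rfl⟩
    | condFalse hb' _ => exact absurd hb hb'
  | condFalse hb _ ih =>
    cases h' with
    | condTrue hb' _ => exact absurd hb' hb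
    | condFalse _ h₁ => obtain ⟨rfl, rfl⟩ := ih h₁; exact ⟨rfl, rfl⟩
  | loopDone hb =>
    cases h' with
    | loopDone => exact ⟨rfl, rfl⟩
    | loopStep hb' _ _ => exact absurd hb' hb
  | loopStep hb _ _ ih₁ ih₂ =>
    cases h' with
    | loopDone hb' => exact absurd hb hb'
    | loopStep _ h₁ h₂ =>
      obtain ⟨rfl, rfl⟩ := ih₁ h₁
      obtain ⟨rfl, rfl⟩ := ih₂ h₂
      exact ⟨rfl, rfl⟩

/-! ### Input and output conventions -/

/-- `edge` lists every edge of `G` exactly once, in some order and with some orientation. -/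
def IsEdgeList {V : Type*} (G : SimpleGraph V) {m : ℕ} (edge : Fin m → V × V) : Prop :=
  Function.Injective (fun k => s((edge k).1, (edge k).2)) ∧
    Set.range (fun k => s((edge k).1, (edge k).2)) = G.edgeSet

/-- The memory state that holds a weighted graph as an edge list: the scalars `0` and `1` hold the
number `n` of vertices and the number `m` of edges, the integer arrays `0` and `1` hold the numbers
(from `0` to `n - 1`) of the endpoints of the edges, and the rational array `0` holds the weights of
the edges. The rest of the memory is zero. -/
def inputStore {V : Type*} {n m : ℕ} (ι : V ≃ Fin n) (w : Sym2 V → ℚ) (edge : Fin m → V × V) :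
    Store where
  nat x := if x = 0 then n else if x = 1 then m else 0
  rat _ := 0
  natArr a k :=
    if h : k < m then
      if a = 0 then (ι (edge ⟨k, h⟩).1 : ℕ)
      else if a = 1 then (ι (edge ⟨k, h⟩).2 : ℕ)
      else 0
    else 0
  ratArr a k :=
    if h : k < m then
      if a = 0 then w s((edge ⟨k, h⟩).1, (edge ⟨k, h⟩).2) else 0
    else 0

/-- The vertex set returned in a memory state: its indicator is stored in the integer array `2`. -/
def outputSet {V : Type*} [Fintype V] {n : ℕ} (ι : V ≃ Fin n) (σ : Store) : Finset V :=
  {v : V | σ.natArr 2 (ι v : ℕ) = 1}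

end FDS

namespace FDS

/-! ### A persistent hollow heap -/

/-- The memory of a heap. Cells are numbered by `1, …, cnt` and are never modified; `0` is the null
cell. A cell of positive rank records that the cell `prev` has beaten the cell `kid`; the item `own`
of a cell is current there if `cur` points back to the cell. -/
structure Heap where
  own : ℕ → ℕ
  prev : ℕ → ℕ
  kid : ℕ → ℕ
  rank : ℕ → ℕ
  cur : ℕ → ℕ
  key : ℕ → ℚ
  cnt : ℕ

namespace Heap

/-- A cell is full if its item is current there; otherwise it is hollow. -/
def Full (H : Heap) (x : ℕ) : Prop := H.cur (H.own x) = x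

instance (H : Heap) : DecidablePred H.Full := fun x => inferInstanceAs (Decidable (_ = x))

mutual
/-- The cells in the tree rooted at a cell. A hollow cell has kept its last two victims only. -/
def tree (H : Heap) : ℕ → Multiset ℕ
  | 0 => 0
  | x + 1 => (x + 1) ::ₘ (H.tree (min (H.kid (x + 1)) x) +
      if H.Full (x + 1) then H.chain (min (H.prev (x + 1)) x)
      else H.tree (min (H.kid (min (H.prev (x + 1)) x)) x))
termination_by x => x
/-- The cells in the trees of all victims of a cell. -/
def chain (H : Heap) : ℕ → Multiset ℕ
  | 0 => 0
  | x + 1 => H.tree (min (H.kid (x + 1)) x) + H.chain (min (H.prev (x + 1)) x)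
termination_by x => x
end

/-- The shape of a cell. -/
def CellOK (H : Heap) (x : ℕ) : Prop :=
  (H.prev x = 0 ∧ H.kid x = 0 ∧ H.rank x = 0) ∨
  (H.prev x ≠ 0 ∧ H.prev x < x ∧ H.kid x ≠ 0 ∧ H.kid x < x ∧
    H.rank (H.prev x) + 1 = H.rank x ∧ H.rank (H.kid x) + 1 = H.rank x ∧
    H.key x ≤ H.key (H.prev x) ∧ H.key x ≤ H.key (H.kid x))

theorem CellOK.prev_le {H : Heap} {x : ℕ} (h : H.CellOK x) : H.prev x ≤ x := by
  rcases h with h | h <;> omega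

theorem CellOK.kid_le {H : Heap} {x : ℕ} (h : H.CellOK x) : H.kid x ≤ x := by
  rcases h with h | h <;> omega

theorem CellOK.prev_lt {H : Heap} {x : ℕ} (h : H.CellOK x) (hx : x ≠ 0) : H.prev x < x := by
  rcases h with h | h <;> omega

theorem CellOK.kid_lt {H : Heap} {x : ℕ} (h : H.CellOK x) (hx : x ≠ 0) : H.kid x < x := by
  rcases h with h | h <;> omega

theorem CellOK.prev_zero {H : Heap} (h : H.CellOK 0) : H.prev 0 = 0 := by
  rcases h with h | h <;> omega

theorem CellOK.kid_zero {H : Heap} (h : H.CellOK 0) : H.kid 0 = 0 := by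
  rcases h with h | h <;> omega

@[simp] theorem tree_zero (H : Heap) : H.tree 0 = 0 := by rw [tree]

@[simp] theorem chain_zero (H : Heap) : H.chain 0 = 0 := by rw [chain]

/-- The truncations by `min` in `tree` and `chain` only secure termination. In well-shaped cells
both pointers decrease, so the truncations disappear and the intended recursion remains. -/
theorem tree_of_full {H : Heap} {x : ℕ} (hc : H.CellOK x) (hx : x ≠ 0) (hf : H.Full x) :
    H.tree x = x ::ₘ (H.tree (H.kid x) + H.chain (H.prev x)) := by
  obtain ⟨x, rfl⟩ := Nat.exists_eq_succ_of_ne_zero hx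
  have h1 := hc.prev_lt hx
  have h2 := hc.kid_lt hx
  simp only [Nat.succ_eq_add_one] at *
  rw [tree, if_pos hf, min_eq_left (by omega), min_eq_left (by omega)]

theorem tree_of_hollow {H : Heap} {x : ℕ} (hc : ∀ y ≤ x, H.CellOK y) (hx : x ≠ 0)
    (hf : ¬ H.Full x) :
    H.tree x = x ::ₘ (H.tree (H.kid x) + H.tree (H.kid (H.prev x))) := by
  obtain ⟨x, rfl⟩ := Nat.exists_eq_succ_of_ne_zero hx
  have h1 := (hc _ le_rfl).prev_lt hx
  have h2 := (hc _ le_rfl).kid_lt hx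
  simp only [Nat.succ_eq_add_one] at *
  have h3 := (hc _ h1.le).kid_le
  rw [tree, if_neg hf, min_eq_left (by omega : H.prev (x + 1) ≤ x), min_eq_left (by omega),
    min_eq_left (by omega)]

theorem chain_eq {H : Heap} {x : ℕ} (hc : H.CellOK x) :
    H.chain x = H.tree (H.kid x) + H.chain (H.prev x) := by
  rcases Nat.eq_zero_or_pos x with rfl | hx
  · simp [hc.prev_zero, hc.kid_zero]
  · obtain ⟨x, rfl⟩ := Nat.exists_eq_succ_of_ne_zero hx.ne'
    have h1 := hc.prev_lt hx.ne'
    have h2 := hc.kid_lt hx.ne'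
    simp only [Nat.succ_eq_add_one] at *
    rw [chain, min_eq_left (by omega), min_eq_left (by omega)]

/-- Pointers lead to smaller numbers, by truncation even without any invariant. Hence a cell never
occurs strictly below itself, which yields the vanishing counts used in `tree_hollow`. -/
theorem mem_bounds (H : Heap) (x : ℕ) :
    (∀ c ∈ H.tree x, 1 ≤ c ∧ c ≤ x) ∧ ∀ c ∈ H.chain x, 1 ≤ c ∧ c < x := by
  induction x using Nat.strong_induction_on with
  | _ x ih =>
    rcases x with _ | x
    · simp
    · have key : ∀ y, (∀ c ∈ H.tree (min y x), 1 ≤ c ∧ c < x + 1) ∧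
          ∀ c ∈ H.chain (min y x), 1 ≤ c ∧ c < x + 1 := by
        intro y
        have hy : min y x < x + 1 := by omega
        refine ⟨fun c hc => ?_, fun c hc => ?_⟩
        · have := (ih _ hy).1 c hc; omega
        · have := (ih _ hy).2 c hc; omega
      refine ⟨fun c hc => ?_, fun c hc => ?_⟩
      · rw [tree, Multiset.mem_cons, Multiset.mem_add] at hc
        rcases hc with rfl | hc | hc
        · omega
        · have := (key _).1 c hc; omega
        · split_ifs at hc
          · have := (key _).2 c hc; omega
          · have := (key _).1 c hc; omega
      · rw [chain, Multiset.mem_add] at hc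
        rcases hc with hc | hc
        · exact (key _).1 c hc
        · exact (key _).2 c hc

theorem mem_tree_self {H : Heap} {x : ℕ} (hx : x ≠ 0) : x ∈ H.tree x := by
  obtain ⟨x, rfl⟩ := Nat.exists_eq_succ_of_ne_zero hx
  rw [Nat.succ_eq_add_one, tree]; exact Multiset.mem_cons_self _ _

theorem count_tree_of_lt {H : Heap} {x z : ℕ} (h : z < x) : (H.tree z).count x = 0 :=
  Multiset.count_eq_zero_of_notMem fun hm => by have := (H.mem_bounds z).1 x hm; omega

theorem count_chain_of_le {H : Heap} {x z : ℕ} (h : z ≤ x) : (H.chain z).count x = 0 :=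
  Multiset.count_eq_zero_of_notMem fun hm => by have := (H.mem_bounds z).2 x hm; omega

/-- Making the cell `x` hollow removes all but its last two victims from the trees with `x`. -/
theorem tree_hollow {H H' : Heap} {b x : ℕ} (hc : ∀ z ≤ b, H.CellOK z) (hc' : ∀ z ≤ b, H'.CellOK z)
    (hp : ∀ z ≤ b, H'.prev z = H.prev z) (hk : ∀ z ≤ b, H'.kid z = H.kid z)
    (hfull : ∀ z ≤ b, z ≠ 0 → z ≠ x → (H'.Full z ↔ H.Full z)) (hx : x ≠ 0 → H.Full x ∧ ¬ H'.Full x)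
    (z : ℕ) (hz : z ≤ b) :
    H.tree z = H'.tree z + (H.tree z).count x • H.chain (H.prev (H.prev x)) ∧
      H.chain z = H'.chain z + (H.chain z).count x • H.chain (H.prev (H.prev x)) := by
  induction z using Nat.strong_induction_on with
  | _ z ih =>
    rcases Nat.eq_zero_or_pos z with rfl | hz0
    · simp
    have p1 := (hc z hz).prev_lt hz0.ne'
    have k1 := (hc z hz).kid_lt hz0.ne'
    have k2 := (hc _ (p1.le.trans hz)).kid_le
    have ik := ih _ k1 (by omega)
    have ip := ih _ p1 (by omega)
    have ikp := ih _ (k2.trans_lt p1) (by omega)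
    set D := H.chain (H.prev (H.prev x))
    constructor
    · by_cases hzx : z = x
      · subst hzx
        -- At the cell x itself, one unfolding of the chain of `prev x` splits the victims into the
        -- two that are kept and the remaining chain `D`; x is counted exactly once, since
        -- everything below it has a smaller number.
        obtain ⟨f1, f2⟩ := hx hz0.ne'
        rw [tree_of_hollow (fun y hy => hc' y (hy.trans hz)) hz0.ne' f2,
          tree_of_full (hc z hz) hz0.ne' f1, hp z hz, hk z hz, hk _ (p1.le.trans hz),
          chain_eq (hc _ (p1.le.trans hz))]
        have e1 := ik.1
        have e2 := ikp.1
        rw [count_tree_of_lt k1, zero_nsmul, add_zero] at e1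
        rw [count_tree_of_lt (k2.trans_lt p1), zero_nsmul, add_zero] at e2
        have p2 := (hc _ (p1.le.trans hz)).prev_le
        rw [Multiset.count_cons, Multiset.count_add, Multiset.count_add, count_tree_of_lt k1,
          count_tree_of_lt (k2.trans_lt p1), count_chain_of_le (by omega), ← e1, ← e2]
        simp [D, add_assoc]
      · by_cases hf : H.Full z
        · rw [tree_of_full (hc' z hz) hz0.ne' ((hfull z hz hz0.ne' hzx).2 hf),
            tree_of_full (hc z hz) hz0.ne' hf, hp z hz, hk z hz, Multiset.count_cons,
            if_neg (Ne.symm hzx), Multiset.count_add, add_zero, add_nsmul]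
          nth_rw 1 [ik.1, ip.2]
          simp only [Multiset.cons_add]
          congr 1
          abel
        · rw [tree_of_hollow (fun y hy => hc' y (hy.trans hz)) hz0.ne'
              (fun h => hf ((hfull z hz hz0.ne' hzx).1 h)),
            tree_of_hollow (fun y hy => hc y (hy.trans hz)) hz0.ne' hf, hp z hz, hk z hz,
            hk _ (p1.le.trans hz), Multiset.count_cons,
            if_neg (Ne.symm hzx), Multiset.count_add, add_zero, add_nsmul]
          nth_rw 1 [ik.1, ikp.1]
          simp only [Multiset.cons_add]
          congr 1
          abel
    · rw [chain_eq (hc' z hz), chain_eq (hc z hz), hp z hz, hk z hz, Multiset.count_add, add_nsmul]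
      nth_rw 1 [ik.1, ip.2]
      abel

/-- The cells in the trees with the given roots. -/
def total (H : Heap) (R : Multiset ℕ) : Multiset ℕ := (R.map H.tree).sum

@[simp] theorem total_zero (H : Heap) : H.total 0 = 0 := rfl

@[simp] theorem total_cons (H : Heap) (x : ℕ) (R : Multiset ℕ) :
    H.total (x ::ₘ R) = H.tree x + H.total R := by simp [total]

@[simp] theorem total_add (H : Heap) (R S : Multiset ℕ) :
    H.total (R + S) = H.total R + H.total S := by simp [total]

theorem mem_total {H : Heap} {R : Multiset ℕ} {c : ℕ} :
    c ∈ H.total R ↔ ∃ x ∈ R, c ∈ H.tree x := by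
  induction R using Multiset.induction with
  | empty => simp
  | cons a R ih => simp [ih]

/-- The invariant of a heap with the given roots and keys of the items. -/
structure Inv (H : Heap) (deg : ℕ → ℚ) (R : Multiset ℕ) : Prop where
  cell : ∀ x ≤ H.cnt, H.CellOK x
  root_le : ∀ x ∈ R, x ≤ H.cnt
  nodup : (H.total R).Nodup
  cur : ∀ i, H.cur i ≠ 0 → H.own (H.cur i) = i ∧ H.cur i ∈ H.total R ∧ H.key (H.cur i) = deg i

theorem total_le_cnt {H : Heap} {R : Multiset ℕ} (h : ∀ x ∈ R, x ≤ H.cnt) {c : ℕ}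
    (hc : c ∈ H.total R) : 1 ≤ c ∧ c ≤ H.cnt := by
  obtain ⟨x, hx, hcx⟩ := mem_total.1 hc
  have := (H.mem_bounds x).1 c hcx
  have := h x hx
  omega

theorem total_hollow {H H' : Heap} {b x : ℕ} (hc : ∀ z ≤ b, H.CellOK z)
    (hc' : ∀ z ≤ b, H'.CellOK z)
    (hp : ∀ z ≤ b, H'.prev z = H.prev z) (hk : ∀ z ≤ b, H'.kid z = H.kid z)
    (hfull : ∀ z ≤ b, z ≠ 0 → z ≠ x → (H'.Full z ↔ H.Full z)) (hx : x ≠ 0 → H.Full x ∧ ¬ H'.Full x)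
    {R : Multiset ℕ} (hR : ∀ x ∈ R, x ≤ b) :
    H.total R = H'.total R + (H.total R).count x • H.chain (H.prev (H.prev x)) := by
  induction R using Multiset.induction with
  | empty => simp
  | cons a R ih =>
    have h1 := (tree_hollow hc hc' hp hk hfull hx a (hR a (by simp))).1
    have h2 := ih fun x hx => hR x (by simp [hx])
    rw [total_cons, total_cons, Multiset.count_add, add_nsmul]
    nth_rw 1 [h1, h2]
    abel

/-- The keys in a tree are at least the key of its root. -/
theorem key_le {H : Heap} {b : ℕ} (hc : ∀ z ≤ b, H.CellOK z) (x : ℕ) (hx : x ≤ b) :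
    (∀ c ∈ H.tree x, H.key x ≤ H.key c) ∧ ∀ c ∈ H.chain x, H.key x ≤ H.key c := by
  induction x using Nat.strong_induction_on with
  | _ x ih =>
    rcases Nat.eq_zero_or_pos x with rfl | hx0
    · simp
    have hcx := hc x hx
    have p1 := hcx.prev_lt hx0.ne'
    have k1 := hcx.kid_lt hx0.ne'
    have k2 := (hc _ (p1.le.trans hx)).kid_le
    have K : ∀ c ∈ H.tree (H.kid x), H.key x ≤ H.key c := by
      intro c h
      rcases hcx with h' | h'
      · simp [h'.2.1] at h
      · exact h'.2.2.2.2.2.2.2.trans ((ih _ k1 (by omega)).1 c h)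
    have P : ∀ c ∈ H.chain (H.prev x), H.key x ≤ H.key c := by
      intro c h
      rcases hcx with h' | h'
      · simp [h'.1] at h
      · exact h'.2.2.2.2.2.2.1.trans ((ih _ p1 (by omega)).2 c h)
    refine ⟨fun c h => ?_, fun c h => ?_⟩
    · by_cases hf : H.Full x
      · rw [tree_of_full hcx hx0.ne' hf, Multiset.mem_cons, Multiset.mem_add] at h
        rcases h with rfl | h | h
        exacts [le_rfl, K c h, P c h]
      · rw [tree_of_hollow (fun y hy => hc y (hy.trans hx)) hx0.ne' hf, Multiset.mem_cons,
          Multiset.mem_add] at h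
        rcases h with rfl | h | h
        · exact le_rfl
        · exact K c h
        · refine P c ?_
          rw [chain_eq (hc _ (p1.le.trans hx)), Multiset.mem_add]
          exact Or.inl h
    · rw [chain_eq hcx, Multiset.mem_add] at h
      rcases h with h | h
      exacts [K c h, P c h]

/-- Trees are exponentially large in the rank of the root. -/
theorem two_pow_rank_le {H : Heap} {b : ℕ} (hc : ∀ z ≤ b, H.CellOK z) (x : ℕ) (hx : x ≤ b)
    (hx0 : x ≠ 0) : 2 ^ (H.rank x / 2) ≤ (H.tree x).card := by
  induction x using Nat.strong_induction_on with
  | _ x ih =>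
    have hcx := hc x hx
    have hpos : 1 ≤ (H.tree x).card := Multiset.card_pos_iff_exists_mem.2 ⟨x, mem_tree_self hx0⟩
    rcases Nat.lt_or_ge (H.rank x) 2 with hr | hr
    · rw [Nat.div_eq_of_lt hr]; simpa using hpos
    have p1 := hcx.prev_lt hx0
    have k1 := hcx.kid_lt hx0
    have hcp := hc _ (p1.le.trans hx)
    have k2 := hcp.kid_le
    rcases id hcx with h | h
    · omega
    rcases id hcp with h' | h'
    · omega
    -- The two victims kept by every cell, full or hollow, have ranks r − 1 and r − 2. Both trees
    -- satisfy the bound for r − 2, so their sizes add up to twice that bound.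
    have e : H.rank x / 2 = (H.rank (H.kid (H.prev x)) / 2) + 1 := by omega
    have i1 := ih _ k1 (by omega) h.2.2.1
    have i2 := ih _ (k2.trans_lt p1) (by omega) h'.2.2.1
    have i3 : 2 ^ (H.rank (H.kid (H.prev x)) / 2) ≤ 2 ^ (H.rank (H.kid x) / 2) :=
      Nat.pow_le_pow_right (by norm_num) (by omega)
    rw [e, pow_succ]
    suffices (H.tree (H.kid x)).card + (H.tree (H.kid (H.prev x))).card ≤ (H.tree x).card by omega
    by_cases hf : H.Full x
    · rw [tree_of_full hcx hx0 hf, chain_eq hcp]; simp; omega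
    · rw [tree_of_hollow (fun y hy => hc y (hy.trans hx)) hx0 hf]; simp

/-- This bound determines how many rank slots are needed: the number of live cells bounds the size
of each single tree, and the tree size is exponential in half the rank, rounded down. -/
theorem Inv.rank_le {H : Heap} {deg : ℕ → ℚ} {R : Multiset ℕ} (h : H.Inv deg R) {x N : ℕ}
    (hx : x ∈ R) (hx0 : x ≠ 0) (hN : (H.total R).card ≤ N) : H.rank x ≤ 2 * Nat.log 2 N + 1 := by
  have h1 := two_pow_rank_le h.cell x (h.root_le x hx) hx0
  have h2 : (H.tree x).card ≤ (H.total R).card := by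
    obtain ⟨R, rfl⟩ := Multiset.exists_cons_of_mem hx
    simp
  have h3 := Nat.le_log_of_pow_le (by norm_num) (h1.trans (h2.trans hN))
  omega

/-! ### Operations on heaps -/

/-- Appends a cell for the item `v` and makes `v` current there. -/
def push (H : Heap) (v p k r : ℕ) (d : ℚ) : Heap where
  own := Function.update H.own (H.cnt + 1) v
  prev := Function.update H.prev (H.cnt + 1) p
  kid := Function.update H.kid (H.cnt + 1) k
  rank := Function.update H.rank (H.cnt + 1) r
  cur := Function.update H.cur v (H.cnt + 1)
  key := Function.update H.key (H.cnt + 1) d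
  cnt := H.cnt + 1

/-- Gives the key `d` to the item `v`, in a new tree. -/
def decrease (H : Heap) (v : ℕ) (d : ℚ) : Heap :=
  let z := H.prev (H.prev (H.cur v))
  H.push v (H.prev z) (H.kid z) (H.rank z) d

/-- Makes `y` a victim of `x`. -/
def link (H : Heap) (x y : ℕ) : Heap :=
  H.push (H.own x) x y (H.rank x + 1) (H.key x)

/-- Removes an item. -/
def remove (H : Heap) (v : ℕ) : Heap :=
  { H with cur := Function.update H.cur v 0 }

section push
variable {H : Heap} {v p k r : ℕ} {d : ℚ}

theorem push_cnt : (H.push v p k r d).cnt = H.cnt + 1 := rfl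

theorem push_cell_new (h : (p = 0 ∧ k = 0 ∧ r = 0) ∨
    (p ≠ 0 ∧ p ≤ H.cnt ∧ k ≠ 0 ∧ k ≤ H.cnt ∧ H.rank p + 1 = r ∧ H.rank k + 1 = r ∧
      d ≤ H.key p ∧ d ≤ H.key k)) : (H.push v p k r d).CellOK (H.cnt + 1) := by
  rcases h with ⟨rfl, rfl, rfl⟩ | h
  · left; simp [push]
  · right
    have h1 : p ≠ H.cnt + 1 := by omega
    have h2 : k ≠ H.cnt + 1 := by omega
    simp only [push, Function.update_self, Function.update_of_ne h1, Function.update_of_ne h2]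
    refine ⟨h.1, by omega, h.2.2.1, by omega, h.2.2.2.2⟩

theorem push_cell_old {x : ℕ} (hx : x ≤ H.cnt) (h : H.CellOK x) :
    (H.push v p k r d).CellOK x := by
  have h0 : x ≠ H.cnt + 1 := by omega
  rcases h with h | h
  · left; simpa [push, Function.update_of_ne h0] using h
  · right
    have h1 : H.prev x ≠ H.cnt + 1 := by omega
    have h2 : H.kid x ≠ H.cnt + 1 := by omega
    simpa only [push, Function.update_of_ne h0, Function.update_of_ne h1,
      Function.update_of_ne h2] using h

theorem push_prev {x : ℕ} (hx : x ≤ H.cnt) : (H.push v p k r d).prev x = H.prev x :=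
  Function.update_of_ne (by omega) _ _

theorem push_kid {x : ℕ} (hx : x ≤ H.cnt) : (H.push v p k r d).kid x = H.kid x :=
  Function.update_of_ne (by omega) _ _

theorem push_own {x : ℕ} (hx : x ≤ H.cnt) : (H.push v p k r d).own x = H.own x :=
  Function.update_of_ne (by omega) _ _

theorem push_key {x : ℕ} (hx : x ≤ H.cnt) : (H.push v p k r d).key x = H.key x :=
  Function.update_of_ne (by omega) _ _

theorem push_cur {i : ℕ} (hi : i ≠ v) : (H.push v p k r d).cur i = H.cur i :=
  Function.update_of_ne hi _ _

theorem push_cur_self : (H.push v p k r d).cur v = H.cnt + 1 :=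
  Function.update_self _ _ _

theorem push_full_new : (H.push v p k r d).Full (H.cnt + 1) := by
  simp [Full, push]

/-- The only full cell which becomes hollow is the former current cell of `v`. -/
theorem push_full_old {x : ℕ} (hx : x ≤ H.cnt)
    (hxv : x ≠ H.cur v) :
    (H.push v p k r d).Full x ↔ H.Full x := by
  unfold Full
  rw [push_own hx]
  by_cases h : H.own x = v
  · rw [h, push_cur_self]
    exact ⟨fun h' => by omega, fun h' => absurd h'.symm hxv⟩
  · rw [push_cur h]

theorem push_not_full (hv : H.cur v ≠ 0 → H.own (H.cur v) = v) (hx : H.cur v ≤ H.cnt)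
    (hx0 : H.cur v ≠ 0) : ¬ (H.push v p k r d).Full (H.cur v) := by
  unfold Full
  rw [push_own hx, hv hx0, push_cur_self]
  omega

end push

variable {H : Heap} {deg : ℕ → ℚ} {R : Multiset ℕ}

theorem Inv.cur_le (h : H.Inv deg R) (i : ℕ) : H.cur i ≤ H.cnt := by
  by_cases h0 : H.cur i = 0
  · omega
  · exact (total_le_cnt h.root_le (h.cur i h0).2.1).2

theorem Inv.cur_full (h : H.Inv deg R) {i : ℕ} (hi : H.cur i ≠ 0) : H.Full (H.cur i) := by
  unfold Full; rw [(h.cur i hi).1]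

theorem Inv.cell_zero (h : H.Inv deg R) : H.CellOK 0 := h.cell 0 (Nat.zero_le _)

theorem Inv.cur_ne {x i : ℕ} (h : H.Inv deg R) (hi : H.cur i ≠ 0) (hx : i ≠ H.own x) :
    H.cur i ≠ x := by
  rintro rfl; exact hx (h.cur i hi).1.symm

theorem push_total (h : H.Inv deg R) {v p k r : ℕ} {d : ℚ} (z : ℕ) (hz : z ≤ H.cnt) :
    H.tree z = (H.push v p k r d).tree z +
        (H.tree z).count (H.cur v) • H.chain (H.prev (H.prev (H.cur v))) ∧
      H.chain z = (H.push v p k r d).chain z +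
        (H.chain z).count (H.cur v) • H.chain (H.prev (H.prev (H.cur v))) :=
  tree_hollow h.cell (fun z hz => push_cell_old hz (h.cell z hz)) (fun _ => push_prev)
    (fun _ => push_kid) (fun _ hz _ => push_full_old hz)
    (fun hx => ⟨h.cur_full hx, push_not_full (fun h0 => (h.cur v h0).1) (h.cur_le v) hx⟩) z hz

theorem push_cells (h : H.Inv deg R) {v p k r : ℕ} {d : ℚ}
    (hp : (p = 0 ∧ k = 0 ∧ r = 0) ∨
    (p ≠ 0 ∧ p ≤ H.cnt ∧ k ≠ 0 ∧ k ≤ H.cnt ∧ H.rank p + 1 = r ∧ H.rank k + 1 = r ∧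
      d ≤ H.key p ∧ d ≤ H.key k)) (x : ℕ) (hx : x ≤ (H.push v p k r d).cnt) :
    (H.push v p k r d).CellOK x := by
  rcases Nat.lt_or_ge H.cnt x with h1 | h1
  · have : x = H.cnt + 1 := by rw [push_cnt] at hx; omega
    subst this; exact push_cell_new hp
  · exact push_cell_old h1 (h.cell x h1)

theorem push_tree_new {v p k r : ℕ} {d : ℚ}
    (hp : (p = 0 ∧ k = 0 ∧ r = 0) ∨
    (p ≠ 0 ∧ p ≤ H.cnt ∧ k ≠ 0 ∧ k ≤ H.cnt ∧ H.rank p + 1 = r ∧ H.rank k + 1 = r ∧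
      d ≤ H.key p ∧ d ≤ H.key k)) :
    (H.push v p k r d).tree (H.cnt + 1) =
      (H.cnt + 1) ::ₘ ((H.push v p k r d).tree k + (H.push v p k r d).chain p) := by
  rw [tree_of_full (push_cell_new hp) (by omega) push_full_new]
  simp [push]

/-- Two steps back along `prev` lie all victims but the last two, and keys do not decrease along
`prev`, so the shape can be copied with a smaller key. Ranks below 2 and absent items lead to the
null cell, whose fields are all zero; thus the same operation inserts a new item. -/
theorem decrease_cell (h : H.Inv deg R) {v : ℕ} {d : ℚ} (hd : H.cur v ≠ 0 → d ≤ deg v) :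
    let z := H.prev (H.prev (H.cur v))
    z ≤ H.cur v ∧ z ≤ H.cnt ∧ ((H.prev z = 0 ∧ H.kid z = 0 ∧ H.rank z = 0) ∨
    (H.prev z ≠ 0 ∧ H.prev z ≤ H.cnt ∧ H.kid z ≠ 0 ∧ H.kid z ≤ H.cnt ∧
      H.rank (H.prev z) + 1 = H.rank z ∧ H.rank (H.kid z) + 1 = H.rank z ∧
      d ≤ H.key (H.prev z) ∧ d ≤ H.key (H.kid z))) := by
  intro z
  have c0 := h.cell _ (h.cur_le v)
  have c1 := h.cell _ (c0.prev_le.trans (h.cur_le v))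
  have hz : z ≤ H.cur v := c1.prev_le.trans c0.prev_le
  have c2 := h.cell _ (hz.trans (h.cur_le v))
  refine ⟨hz, hz.trans (h.cur_le v), ?_⟩
  rcases id c2 with h2 | h2
  · exact Or.inl h2
  right
  have hz0 : z ≠ 0 := by omega
  have hp0 : H.prev (H.cur v) ≠ 0 := fun h0 => hz0 (by simp only [z, h0, h.cell_zero.prev_zero])
  have hx0 : H.cur v ≠ 0 := fun h0 => hp0 (by rw [h0, h.cell_zero.prev_zero])
  have := h.cur_le v
  have e : d ≤ H.key z := by
    have k0 := (h.cur v hx0).2.2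
    rcases c0 with c0 | c0
    · omega
    rcases c1 with c1 | c1
    · exact absurd c1.1 hz0
    calc d ≤ H.key (H.cur v) := k0 ▸ hd hx0
      _ ≤ _ := c0.2.2.2.2.2.2.1
      _ ≤ _ := c1.2.2.2.2.2.2.1
  exact ⟨h2.1, by omega, h2.2.2.1, by omega, h2.2.2.2.2.1, h2.2.2.2.2.2.1,
    e.trans h2.2.2.2.2.2.2.1, e.trans h2.2.2.2.2.2.2.2⟩

/-- The chain that the old cell loses on becoming hollow is exactly the one that the new cell takes
over. The only change in the reachable cells is the new cell itself. -/
theorem decrease_total (h : H.Inv deg R) {v : ℕ} {d : ℚ} (hd : H.cur v ≠ 0 → d ≤ deg v) :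
    (H.decrease v d).total ((H.cnt + 1) ::ₘ R) = (H.cnt + 1) ::ₘ H.total R := by
  obtain ⟨hz, hzc, hcell⟩ := decrease_cell h hd
  have hR := total_hollow h.cell (H' := H.decrease v d)
    (fun z hz => push_cell_old hz (h.cell z hz)) (fun _ => push_prev)
    (fun _ => push_kid) (fun _ hz _ => push_full_old hz)
    (fun hx => ⟨h.cur_full hx, push_not_full (fun h0 => (h.cur v h0).1) (h.cur_le v) hx⟩) h.root_le
  have hch : H.chain (H.prev (H.prev (H.cur v))) = (H.decrease v d).chain _ + _ :=
    (push_total h (v := v) _ hzc).2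
  rw [count_chain_of_le hz, zero_nsmul, add_zero,
    chain_eq (H := H.decrease v d) (push_cell_old hzc (h.cell _ hzc)),
    show (H.decrease v d).prev _ = _ from push_prev hzc,
    show (H.decrease v d).kid _ = _ from push_kid hzc]
    at hch
  have hnew : (H.decrease v d).tree (H.cnt + 1) = _ := push_tree_new hcell
  rw [total_cons, hnew, Multiset.cons_add]
  congr 1
  refine Eq.trans ?_ hR.symm
  rw [add_comm]
  congr 1
  refine hch.symm.trans ?_
  -- For an absent item the transferred chain is that of the null cell, hence empty. Otherwise the
  -- old cell occurs exactly once, because the multiset has no duplicates.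
  by_cases hx : H.cur v = 0
  · simp [hx, h.cell_zero.prev_zero]
  · rw [Multiset.count_eq_one_of_mem h.nodup (h.cur v hx).2.1, one_nsmul]

theorem Inv.decrease (h : H.Inv deg R) {v : ℕ} {d : ℚ} (hd : H.cur v ≠ 0 → d ≤ deg v) :
    (H.decrease v d).Inv (Function.update deg v d) ((H.cnt + 1) ::ₘ R) where
  cell := push_cells h (decrease_cell h hd).2.2
  root_le := by
    intro x hx
    show x ≤ H.cnt + 1
    rcases Multiset.mem_cons.1 hx with rfl | hx
    · exact le_rfl
    · exact (h.root_le x hx).trans (Nat.le_succ _)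
  nodup := by
    rw [decrease_total h hd]
    refine Multiset.nodup_cons.2 ⟨fun hm => ?_, h.nodup⟩
    have := total_le_cnt h.root_le hm
    omega
  cur := by
    intro i hi
    rw [decrease_total h hd]
    by_cases hiv : i = v
    · subst hiv
      rw [FDS.Heap.decrease, push_cur_self]
      simp [push]
    · rw [FDS.Heap.decrease, push_cur hiv] at hi ⊢
      rw [push_own (h.cur_le i), push_key (h.cur_le i), Function.update_of_ne hiv]
      obtain ⟨h1, h2, h3⟩ := h.cur i hi
      exact ⟨h1, Multiset.mem_cons_of_mem h2, h3⟩

section link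
variable {x y : ℕ}

theorem link_cell (h : H.Inv deg (x ::ₘ y ::ₘ R)) (hx0 : x ≠ 0) (hy0 : y ≠ 0)
    (hr : H.rank x = H.rank y) (hk : H.key x ≤ H.key y) :
    (x = 0 ∧ y = 0 ∧ H.rank x + 1 = 0) ∨ (x ≠ 0 ∧ x ≤ H.cnt ∧ y ≠ 0 ∧ y ≤ H.cnt ∧
      H.rank x + 1 = H.rank x + 1 ∧ H.rank y + 1 = H.rank x + 1 ∧
      H.key x ≤ H.key x ∧ H.key x ≤ H.key y) :=
  Or.inr ⟨hx0, h.root_le x (by simp), hy0, h.root_le y (by simp), rfl, by rw [hr], le_rfl, hk⟩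

/-- The new cell takes the place of the winner x, whose victims are reached through the chain of x
rather than through x as a member of the tree. The winner becomes hollow, but as it occurs nowhere
else, no other tree loses anything. The number of cells is unchanged. -/
theorem link_total (h : H.Inv deg (x ::ₘ y ::ₘ R)) (hx0 : x ≠ 0) (hy0 : y ≠ 0) (hf : H.Full x)
    (hr : H.rank x = H.rank y) (hk : H.key x ≤ H.key y) :
    H.total (x ::ₘ y ::ₘ R) = x ::ₘ (H.tree y + H.chain x + H.total R) ∧
    (H.link x y).total ((H.cnt + 1) ::ₘ R) =
      (H.cnt + 1) ::ₘ (H.tree y + H.chain x + H.total R) := by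
  have hcell := link_cell h hx0 hy0 hr hk
  have hxc : x ≤ H.cnt := h.root_le x (by simp)
  have hyc : y ≤ H.cnt := h.root_le y (by simp)
  have h1 : H.total (x ::ₘ y ::ₘ R) = x ::ₘ (H.tree y + H.chain x + H.total R) := by
    rw [total_cons, total_cons, tree_of_full (h.cell x hxc) hx0 hf, ← chain_eq (h.cell x hxc),
      Multiset.cons_add, ← add_assoc, add_comm (H.chain x)]
  refine ⟨h1, ?_⟩
  have hn := h.nodup
  rw [h1, Multiset.nodup_cons, Multiset.mem_add, Multiset.mem_add, not_or, not_or] at hn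
  have hR := total_hollow (b := H.cnt) h.cell (H' := H.link x y)
    (fun z hz => push_cell_old hz (h.cell z hz)) (fun _ => push_prev)
    (fun _ => push_kid) (fun _ hz _ => push_full_old hz)
    (fun hx => ⟨h.cur_full hx, push_not_full (fun h0 => (h.cur _ h0).1) (h.cur_le _) hx⟩)
    (R := R) (fun z hz => h.root_le z (by simp [hz]))
  have hY : H.tree y = (H.link x y).tree y + _ := (push_total h (v := H.own x) y hyc).1
  have hX : H.chain x = (H.link x y).chain x + _ := (push_total h (v := H.own x) x hxc).2
  have hfx : H.cur (H.own x) = x := hf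
  rw [hfx, Multiset.count_eq_zero_of_notMem hn.1.2, zero_nsmul, add_zero] at hR
  rw [hfx, Multiset.count_eq_zero_of_notMem hn.1.1.1, zero_nsmul, add_zero] at hY
  rw [hfx, Multiset.count_eq_zero_of_notMem hn.1.1.2, zero_nsmul, add_zero] at hX
  have hnew : (H.link x y).tree (H.cnt + 1) = _ := push_tree_new hcell
  rw [total_cons, hnew, Multiset.cons_add, hR, hY, hX]; rfl

theorem Inv.link (h : H.Inv deg (x ::ₘ y ::ₘ R)) (hx0 : x ≠ 0) (hy0 : y ≠ 0) (hf : H.Full x)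
    (hr : H.rank x = H.rank y) (hk : H.key x ≤ H.key y) :
    (H.link x y).Inv deg ((H.cnt + 1) ::ₘ R) where
  cell := push_cells h (link_cell h hx0 hy0 hr hk)
  root_le := by
    intro z hz
    show z ≤ H.cnt + 1
    rcases Multiset.mem_cons.1 hz with rfl | hz
    · exact le_rfl
    · exact (h.root_le z (by simp [hz])).trans (Nat.le_succ _)
  nodup := by
    obtain ⟨h1, h2⟩ := link_total h hx0 hy0 hf hr hk
    rw [h2]
    have hn := h.nodup
    have hb := fun c => total_le_cnt (c := c) h.root_le
    rw [h1] at hn hb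
    refine Multiset.nodup_cons.2 ⟨fun hm => ?_, (Multiset.nodup_cons.1 hn).2⟩
    have := hb _ (Multiset.mem_cons_of_mem hm)
    omega
  cur := by
    obtain ⟨h1, h2⟩ := link_total h hx0 hy0 hf hr hk
    intro i hi
    rw [h2]
    have hfx : H.cur (H.own x) = x := hf
    by_cases hiv : i = H.own x
    · subst hiv
      have := (h.cur (H.own x) (by rw [hfx]; exact hx0)).2.2
      rw [hfx] at this
      rw [FDS.Heap.link, push_cur_self]
      simp [push, this]
    · rw [FDS.Heap.link, push_cur hiv] at hi ⊢
      rw [push_own (h.cur_le i), push_key (h.cur_le i)]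
      obtain ⟨h3, h4, h5⟩ := h.cur i hi
      rw [h1] at h4
      exact ⟨h3, Multiset.mem_cons_of_mem
        ((Multiset.mem_cons.1 h4).resolve_left (h.cur_ne hi hiv)), h5⟩

end link

/-- Empty slots and null pointers pushed on the stack are treated as roots with empty trees, so that
no case distinction is needed when roots are moved. -/
theorem inv_null : H.Inv deg (0 ::ₘ R) ↔ H.Inv deg R := by
  constructor
  · intro h
    exact ⟨h.cell, fun x hx => h.root_le x (by simp [hx]), by simpa using h.nodup,
      by simpa using h.cur⟩
  · intro h
    exact ⟨h.cell, fun x hx => (Multiset.mem_cons.1 hx).elim (fun h => by omega) (h.root_le x),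
      by simpa using h.nodup, by simpa using h.cur⟩

section hollow
variable {x : ℕ}

theorem hollow_total (h : H.Inv deg (x ::ₘ R)) (hx0 : x ≠ 0) (hf : ¬ H.Full x) :
    H.total (x ::ₘ R) = x ::ₘ H.total (H.kid x ::ₘ H.kid (H.prev x) ::ₘ R) := by
  have hxc : x ≤ H.cnt := h.root_le x (by simp)
  rw [total_cons, tree_of_hollow (fun y hy => h.cell y (hy.trans hxc)) hx0 hf]
  simp [add_assoc]

theorem Inv.hollow (h : H.Inv deg (x ::ₘ R)) (hx0 : x ≠ 0) (hf : ¬ H.Full x) :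
    H.Inv deg (H.kid x ::ₘ H.kid (H.prev x) ::ₘ R) where
  cell := h.cell
  root_le := by
    have hxc : x ≤ H.cnt := h.root_le x (by simp)
    have c := h.cell x hxc
    have hp := c.prev_le.trans hxc
    intro z hz
    simp only [Multiset.mem_cons] at hz
    rcases hz with rfl | rfl | hz
    · exact c.kid_le.trans hxc
    · exact (h.cell _ hp).kid_le.trans hp
    · exact h.root_le z (by simp [hz])
  nodup := by
    have := h.nodup
    rw [hollow_total h hx0 hf] at this
    exact (Multiset.nodup_cons.1 this).2
  cur := by
    intro i hi
    obtain ⟨h1, h2, h3⟩ := h.cur i hi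
    rw [hollow_total h hx0 hf] at h2
    refine ⟨h1, (Multiset.mem_cons.1 h2).resolve_left ?_, h3⟩
    rintro rfl
    exact hf (h.cur_full hi)

end hollow

/-- The victims of a cell. -/
def victims (H : Heap) : ℕ → Multiset ℕ
  | 0 => 0
  | x + 1 => H.kid (x + 1) ::ₘ H.victims (min (H.prev (x + 1)) x)
termination_by x => x

@[simp] theorem victims_zero : H.victims 0 = 0 := by rw [victims]

theorem victims_eq {x : ℕ} (hc : H.CellOK x) (hx : x ≠ 0) :
    H.victims x = H.kid x ::ₘ H.victims (H.prev x) := by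
  obtain ⟨x, rfl⟩ := Nat.exists_eq_succ_of_ne_zero hx
  have h1 := hc.prev_lt hx
  rw [Nat.succ_eq_add_one] at *
  rw [victims, min_eq_left (by omega)]

theorem victims_spec {b : ℕ} (hc : ∀ z ≤ b, H.CellOK z) (x : ℕ) (hx : x ≤ b) :
    H.total (H.victims x) = H.chain x ∧ ∀ c ∈ H.victims x, c ≤ b := by
  induction x using Nat.strong_induction_on with
  | _ x ih =>
    rcases Nat.eq_zero_or_pos x with rfl | hx0
    · simp
    have hp := (hc x hx).prev_lt hx0.ne'
    obtain ⟨h1, h2⟩ := ih _ hp (by omega)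
    rw [victims_eq (hc x hx) hx0.ne']
    refine ⟨by rw [total_cons, h1, ← chain_eq (hc x hx)], fun c h => ?_⟩
    rcases Multiset.mem_cons.1 h with rfl | h
    · exact (hc x hx).kid_le.trans hx
    · exact h2 c h

section remove
variable {x : ℕ}

theorem remove_victims (v : ℕ) : (H.remove v).victims x = H.victims x := by
  induction x using Nat.strong_induction_on with
  | _ x ih =>
    rcases x with _ | x
    · simp
    · rw [victims, victims, ih _ (by omega)]; rfl

/-- Clearing the item would hollow x in any other tree containing it, but there is none by the
absence of duplicates. So all victims of x become roots with their trees intact. -/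
theorem remove_total (h : H.Inv deg (x ::ₘ R)) (hx0 : x ≠ 0) (hf : H.Full x) :
    H.total (x ::ₘ R) = x ::ₘ (H.remove (H.own x)).total (H.victims x + R) := by
  have hxc : x ≤ H.cnt := h.root_le x (by simp)
  have e : H.total (x ::ₘ R) = x ::ₘ H.total (H.victims x + R) := by
    rw [total_cons, total_add, (victims_spec h.cell x hxc).1, tree_of_full (h.cell x hxc) hx0 hf,
      ← chain_eq (h.cell x hxc), Multiset.cons_add]
  have hn := h.nodup
  have hfx : H.cur (H.own x) = x := hf
  rw [e] at hn ⊢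
  congr 1
  have := total_hollow (H' := H.remove (H.own x)) (b := H.cnt) (x := x) h.cell h.cell
    (fun _ _ => rfl) (fun _ _ => rfl) ?_ ?_ (R := H.victims x + R) ?_
  · rw [Multiset.count_eq_zero_of_notMem (Multiset.nodup_cons.1 hn).1] at this
    simpa using this
  · intro z hz hz0 hzx
    unfold Full
    by_cases ho : H.own z = H.own x
    · simp [remove, ho, hfx, Ne.symm hz0, Ne.symm hzx]
    · simp [remove, Function.update_of_ne ho]
  · intro _
    refine ⟨hf, ?_⟩
    simp [Full, remove, Ne.symm hx0]
  · intro z hz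
    rcases Multiset.mem_add.1 hz with hz | hz
    · exact (victims_spec h.cell x hxc).2 z hz
    · exact h.root_le z (by simp [hz])

theorem Inv.remove (h : H.Inv deg (x ::ₘ R)) (hx0 : x ≠ 0) (hf : H.Full x) :
    (H.remove (H.own x)).Inv deg (H.victims x + R) where
  cell := h.cell
  root_le := by
    intro z hz
    rcases Multiset.mem_add.1 hz with hz | hz
    · exact (victims_spec h.cell x (h.root_le x (by simp))).2 z hz
    · exact h.root_le z (by simp [hz])
  nodup := by
    have := h.nodup
    rw [remove_total h hx0 hf] at this
    exact (Multiset.nodup_cons.1 this).2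
  cur := by
    intro i hi
    have hix : i ≠ H.own x := by
      rintro rfl; simp [FDS.Heap.remove] at hi
    have e : (H.remove (H.own x)).cur i = H.cur i := Function.update_of_ne hix _ _
    rw [e] at hi ⊢
    obtain ⟨h1, h2, h3⟩ := h.cur i hi
    rw [remove_total h hx0 hf] at h2
    exact ⟨h1, (Multiset.mem_cons.1 h2).resolve_left (h.cur_ne hi hix), h3⟩

end remove

end Heap
/-! ### Reasoning about programs -/

@[simp] theorem Store.setNat_nat (σ : Store) (x c y : ℕ) :
    (σ.setNat x c).nat y = if y = x then c else σ.nat y := by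
  simp [Store.setNat, Function.update_apply]
@[simp] theorem Store.setNat_rat (σ : Store) (x c : ℕ) : (σ.setNat x c).rat = σ.rat := rfl
@[simp] theorem Store.setNat_natArr (σ : Store) (x c : ℕ) : (σ.setNat x c).natArr = σ.natArr := rfl
@[simp] theorem Store.setNat_ratArr (σ : Store) (x c : ℕ) : (σ.setNat x c).ratArr = σ.ratArr := rfl
@[simp] theorem Store.setRat_rat (σ : Store) (x : ℕ) (c : ℚ) (y : ℕ) :
    (σ.setRat x c).rat y = if y = x then c else σ.rat y := by
  simp [Store.setRat, Function.update_apply]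
@[simp] theorem Store.setRat_nat (σ : Store) (x : ℕ) (c : ℚ) : (σ.setRat x c).nat = σ.nat := rfl
@[simp] theorem Store.setRat_natArr (σ : Store) (x : ℕ) (c : ℚ) :
    (σ.setRat x c).natArr = σ.natArr := rfl
@[simp] theorem Store.setRat_ratArr (σ : Store) (x : ℕ) (c : ℚ) :
    (σ.setRat x c).ratArr = σ.ratArr := rfl
@[simp] theorem Store.putNat_natArr (σ : Store) (a i c b : ℕ) :
    (σ.putNat a i c).natArr b = if b = a then Function.update (σ.natArr a) i c else σ.natArr b := by
  simp only [Store.putNat]; rw [Function.update_apply]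
@[simp] theorem Store.putNat_nat (σ : Store) (a i c : ℕ) : (σ.putNat a i c).nat = σ.nat := rfl
@[simp] theorem Store.putNat_rat (σ : Store) (a i c : ℕ) : (σ.putNat a i c).rat = σ.rat := rfl
@[simp] theorem Store.putNat_ratArr (σ : Store) (a i c : ℕ) :
    (σ.putNat a i c).ratArr = σ.ratArr := rfl
@[simp] theorem Store.putRat_ratArr (σ : Store) (a i : ℕ) (c : ℚ) (b : ℕ) :
    (σ.putRat a i c).ratArr b = if b = a then Function.update (σ.ratArr a) i c else σ.ratArr b := by
  simp only [Store.putRat]; rw [Function.update_apply]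
@[simp] theorem Store.putRat_nat (σ : Store) (a i : ℕ) (c : ℚ) : (σ.putRat a i c).nat = σ.nat := rfl
@[simp] theorem Store.putRat_rat (σ : Store) (a i : ℕ) (c : ℚ) : (σ.putRat a i c).rat = σ.rat := rfl
@[simp] theorem Store.putRat_natArr (σ : Store) (a i : ℕ) (c : ℚ) :
    (σ.putRat a i c).natArr = σ.natArr := rfl

theorem Test.cost_pos (b : Test) : 1 ≤ b.cost := by cases b <;> simp [Test.cost]

namespace Prog

/-- A sequence of programs. -/
def block : List Prog → Prog
  | [] => .skip
  | p :: l => .seq p (block l)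

/-- The absence of loops. -/
def LoopFree : Prog → Prop
  | seq p q => p.LoopFree ∧ q.LoopFree
  | cond _ p q => p.LoopFree ∧ q.LoopFree
  | loop _ _ => False
  | _ => True

open Classical in
/-- The effect of a loop-free program. -/
noncomputable def exec (f : ℕ → ℝ) : Prog → Store → Store
  | skip, σ => σ
  | setNat x e, σ => σ.setNat x (e.eval σ)
  | setRat x e, σ => σ.setRat x (e.eval σ)
  | putNat a i e, σ => σ.putNat a (i.eval σ) (e.eval σ)
  | putRat a i e, σ => σ.putRat a (i.eval σ) (e.eval σ)
  | seq p q, σ => q.exec f (p.exec f σ)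
  | cond b p q, σ => if b.Holds f σ then p.exec f σ else q.exec f σ
  | loop _ _, σ => σ

/-- A bound for the number of operations of a loop-free program. -/
def maxCost : Prog → ℕ
  | skip => 1
  | setNat _ e => e.cost + 1
  | setRat _ e => e.cost + 1
  | putNat _ i e => i.cost + e.cost + 1
  | putRat _ i e => i.cost + e.cost + 1
  | seq p q => p.maxCost + q.maxCost
  | cond b p q => b.cost + (p.maxCost + q.maxCost)
  | loop _ _ => 0

/-- Straight-line code is evaluated by simplification and its cost by `decide`; only loops need
invariants. `maxCost` charges both branches of a conditional, which is crude but computable. -/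
theorem run_exec (f : ℕ → ℝ) {p : Prog} (h : p.LoopFree) (σ : Store) :
    ∃ t, Run f p σ t (p.exec f σ) ∧ t ≤ p.maxCost := by
  induction p generalizing σ with
  | skip => exact ⟨_, .skip σ, le_rfl⟩
  | setNat => exact ⟨_, .setNat _ _ _, le_rfl⟩
  | setRat => exact ⟨_, .setRat _ _ _, le_rfl⟩
  | putNat => exact ⟨_, .putNat _ _ _ _, le_rfl⟩
  | putRat => exact ⟨_, .putRat _ _ _ _, le_rfl⟩
  | seq p q ihp ihq =>
    obtain ⟨s, hs, hs'⟩ := ihp h.1 σ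
    obtain ⟨t, ht, ht'⟩ := ihq h.2 (p.exec f σ)
    exact ⟨_, .seq hs ht, Nat.add_le_add hs' ht'⟩
  | cond b p q ihp ihq =>
    by_cases hb : b.Holds f σ
    · obtain ⟨t, ht, ht'⟩ := ihp h.1 σ
      refine ⟨_, .condTrue hb (by simpa [exec, hb] using ht), ?_⟩
      simp only [maxCost]; omega
    · obtain ⟨t, ht, ht'⟩ := ihq h.2 σ
      refine ⟨_, .condFalse hb (by simpa [exec, hb] using ht), ?_⟩
      simp only [maxCost]; omega
  | loop => exact h.elim

/-- The variables (tags `0` and `1`) and arrays (tags `2` and `3`) which a program may modify. -/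
def writes : Prog → List (ℕ × ℕ)
  | skip => []
  | setNat x _ => [(0, x)]
  | setRat x _ => [(1, x)]
  | putNat a _ _ => [(2, a)]
  | putRat a _ _ => [(3, a)]
  | seq p q => p.writes ++ q.writes
  | cond _ p q => p.writes ++ q.writes
  | loop _ p => p.writes

end Prog

/-- The memory states agree outside of the listed variables and arrays. -/
structure Store.AgreeOff (l : List (ℕ × ℕ)) (σ τ : Store) : Prop where
  nat : ∀ x, (0, x) ∉ l → τ.nat x = σ.nat x
  rat : ∀ x, (1, x) ∉ l → τ.rat x = σ.rat x
  natArr : ∀ a, (2, a) ∉ l → τ.natArr a = σ.natArr a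
  ratArr : ∀ a, (3, a) ∉ l → τ.ratArr a = σ.ratArr a

theorem Store.AgreeOff.refl (l : List (ℕ × ℕ)) (σ : Store) : Store.AgreeOff l σ σ :=
  ⟨fun _ _ => rfl, fun _ _ => rfl, fun _ _ => rfl, fun _ _ => rfl⟩

theorem Store.AgreeOff.trans {l : List (ℕ × ℕ)} {σ ρ τ : Store} (h : Store.AgreeOff l σ ρ)
    (h' : Store.AgreeOff l ρ τ) : Store.AgreeOff l σ τ :=
  ⟨fun x hx => (h'.nat x hx).trans (h.nat x hx), fun x hx => (h'.rat x hx).trans (h.rat x hx),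
    fun x hx => (h'.natArr x hx).trans (h.natArr x hx),
    fun x hx => (h'.ratArr x hx).trans (h.ratArr x hx)⟩

theorem Store.AgreeOff.mono {l l' : List (ℕ × ℕ)} {σ τ : Store} (h : Store.AgreeOff l σ τ)
    (hl : ∀ x ∈ l, x ∈ l') : Store.AgreeOff l' σ τ :=
  ⟨fun x hx => h.nat x fun hm => hx (hl _ hm), fun x hx => h.rat x fun hm => hx (hl _ hm),
    fun x hx => h.natArr x fun hm => hx (hl _ hm), fun x hx => h.ratArr x fun hm => hx (hl _ hm)⟩

/-- The frame rule. The list of written locations is syntactic, so later every "unchanged" claim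
reduces to a decidable non-membership. -/
theorem Run.agreeOff {f : ℕ → ℝ} {p : Prog} {σ τ : Store} {t : ℕ} (h : Run f p σ t τ) :
    Store.AgreeOff p.writes σ τ := by
  induction h with
  | skip => exact .refl _ _
  | setNat =>
    refine ⟨fun x hx => ?_, fun _ _ => rfl, fun _ _ => rfl, fun _ _ => rfl⟩
    simp [Prog.writes] at hx; simp [hx]
  | setRat =>
    refine ⟨fun _ _ => rfl, fun x hx => ?_, fun _ _ => rfl, fun _ _ => rfl⟩
    simp [Prog.writes] at hx; simp [hx]
  | putNat =>
    refine ⟨fun _ _ => rfl, fun _ _ => rfl, fun x hx => ?_, fun _ _ => rfl⟩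
    simp [Prog.writes] at hx; simp [hx]
  | putRat =>
    refine ⟨fun _ _ => rfl, fun _ _ => rfl, fun _ _ => rfl, fun x hx => ?_⟩
    simp [Prog.writes] at hx; simp [hx]
  | seq _ _ ih₁ ih₂ =>
    exact (ih₁.mono fun _ h => List.mem_append_left _ h).trans
      (ih₂.mono fun _ h => List.mem_append_right _ h)
  | condTrue _ _ ih => exact ih.mono fun _ h => List.mem_append_left _ h
  | condFalse _ _ ih => exact ih.mono fun _ h => List.mem_append_right _ h
  | loopDone => exact .refl _ _
  | loopStep _ _ _ ih₁ ih₂ => exact ih₁.trans ih₂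

/-- A loop with an invariant that bounds the elapsed time. -/
theorem Run.of_invariant {f : ℕ → ℝ} {b : Test} {p : Prog} (I : ℕ → Store → Prop) (B : ℕ)
    (hB : ∀ t σ, I t σ → t ≤ B)
    (step : ∀ t σ, I t σ → b.Holds f σ → ∃ s ρ, Run f p σ s ρ ∧ I (t + (b.cost + s)) ρ)
    {t₀ : ℕ} {σ : Store} (h₀ : I t₀ σ) :
    ∃ t τ, Run f (.loop b p) σ (t + b.cost) τ ∧ I (t₀ + t) τ ∧ ¬ b.Holds f τ := by
  -- The elapsed time serves as the termination measure: each test costs at least one operation, and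
  -- the invariant keeps the time below `B`.
  generalize hn : B - t₀ = n
  induction n using Nat.strong_induction_on generalizing t₀ σ with
  | _ n ih =>
    by_cases hb : b.Holds f σ
    · obtain ⟨s, ρ, hr, hI⟩ := step _ _ h₀ hb
      have h1 := hB _ _ hI
      have h2 := b.cost_pos
      obtain ⟨t, τ, hr', hI', hb'⟩ := ih _ (by omega) hI rfl
      refine ⟨b.cost + s + t, τ, ?_, ?_, hb'⟩
      · have := Run.loopStep hb hr hr'
        rwa [← add_assoc] at this
      · simpa only [add_assoc] using hI'
    · exact ⟨0, σ, by simpa using Run.loopDone hb, h₀, hb⟩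

/-! ### The heap in memory -/

/-- The heap in a memory state. -/
def Store.heap (σ : Store) : Heap where
  own := σ.natArr 7
  prev := σ.natArr 8
  kid := σ.natArr 9
  rank := σ.natArr 10
  cur := σ.natArr 6
  key := σ.ratArr 3
  cnt := σ.nat 3

/-- The stack of pending roots. -/
def Store.stack (σ : Store) : Multiset ℕ := (Multiset.range (σ.nat 4)).map (σ.natArr 12)

/-- The contents of the first `k` slots. -/
def Store.slots (σ : Store) (k : ℕ) : Multiset ℕ := (Multiset.range k).map (σ.natArr 11)

/-- Gives the item in variable `8` its key in a new tree. -/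
def decreaseProg : Prog := .block [
  .setNat 6 (.get 8 (.get 8 (.get 6 (.var 8)))),
  .setNat 3 (.add (.var 3) (.lit 1)),
  .putNat 7 (.var 3) (.var 8),
  .putNat 8 (.var 3) (.get 8 (.var 6)),
  .putNat 9 (.var 3) (.get 9 (.var 6)),
  .putNat 10 (.var 3) (.get 10 (.var 6)),
  .putRat 3 (.var 3) (.get 2 (.var 8)),
  .putNat 6 (.var 8) (.var 3),
  .putNat 12 (.var 4) (.var 3),
  .setNat 4 (.add (.var 4) (.lit 1))]

/-- Equality of integers. -/
def Test.natEq (a b : NExp) : Test := .and (.natLe a b) (.natLe b a)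

@[simp] theorem Test.holds_natEq (f : ℕ → ℝ) (σ : Store) (a b : NExp) :
    (Test.natEq a b).Holds f σ ↔ a.eval σ = b.eval σ :=
  ⟨fun h => le_antisymm h.1 h.2, fun h => ⟨le_of_eq h, le_of_eq h.symm⟩⟩

/-- Links the full roots in variables `6` and `7`. -/
def linkProg : Prog := .block [
  .putNat 11 (.get 10 (.var 6)) (.lit 0),
  .cond (.ratLe (.get 3 (.var 6)) (.get 3 (.var 7))) .skip
    (.block [.setNat 12 (.var 6), .setNat 6 (.var 7), .setNat 7 (.var 12)]),
  .setNat 3 (.add (.var 3) (.lit 1)),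
  .putNat 6 (.get 7 (.var 6)) (.var 3),
  .putNat 7 (.var 3) (.get 7 (.var 6)),
  .putNat 8 (.var 3) (.var 6),
  .putNat 9 (.var 3) (.var 7),
  .putNat 10 (.var 3) (.add (.get 10 (.var 6)) (.lit 1)),
  .putRat 3 (.var 3) (.get 3 (.var 6)),
  .putNat 12 (.var 4) (.var 3),
  .setNat 4 (.add (.var 4) (.lit 1))]

/-- Places the full root in variable `6` in its slot. -/
def placeProg : Prog := .block [
  .putNat 11 (.get 10 (.var 6)) (.var 6),
  .cond (.natLe (.var 5) (.get 10 (.var 6))) (.setNat 5 (.get 10 (.var 6))) .skip]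

/-- Replaces the hollow root in variable `6` by its victims. -/
def hollowProg : Prog := .block [
  .putNat 12 (.var 4) (.get 9 (.var 6)),
  .putNat 12 (.add (.var 4) (.lit 1)) (.get 9 (.get 8 (.var 6))),
  .setNat 4 (.add (.var 4) (.lit 2))]

/-- Processes one root from the stack. -/
def processBody : Prog := .block [
  .setNat 4 (.sub (.var 4) (.lit 1)),
  .setNat 6 (.get 12 (.var 4)),
  .cond (.natLe (.lit 1) (.var 6))
    (.cond (.natEq (.get 6 (.get 7 (.var 6))) (.var 6))
      (.block [.setNat 7 (.get 11 (.get 10 (.var 6))),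
        .cond (.natLe (.lit 1) (.var 7)) linkProg placeProg])
      hollowProg)
    .skip]

section cases
variable (f : ℕ → ℝ) (σ : Store) {k x : ℕ}

/-- The four `exec_process` lemmas are the cases of one round, in which scalar 6 holds the root
popped from the stack (array 12, height in scalar 4) and array 11 holds the slots, with scalar 5 an
upper bound for the occupied ranks. A null root is simply dropped. -/
theorem exec_process_null (hk : σ.nat 4 = k + 1) (hx : σ.natArr 12 k = 0) :
    (processBody.exec f σ).heap = σ.heap ∧ (processBody.exec f σ).natArr 12 = σ.natArr 12 ∧
    (processBody.exec f σ).nat 4 = k ∧ (processBody.exec f σ).natArr 11 = σ.natArr 11 ∧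
    (processBody.exec f σ).nat 5 = σ.nat 5 := by
  simp [processBody, Prog.block, Prog.exec, NExp.eval, Store.heap, hk, hx, Test.Holds]

theorem exec_process_hollow (hk : σ.nat 4 = k + 1) (hx : σ.natArr 12 k = x) (hx0 : x ≠ 0)
    (hf : ¬ σ.heap.Full x) :
    (processBody.exec f σ).heap = σ.heap ∧
    (processBody.exec f σ).natArr 12 = Function.update
      (Function.update (σ.natArr 12) k (σ.heap.kid x)) (k + 1) (σ.heap.kid (σ.heap.prev x)) ∧
    (processBody.exec f σ).nat 4 = k + 2 ∧ (processBody.exec f σ).natArr 11 = σ.natArr 11 ∧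
    (processBody.exec f σ).nat 5 = σ.nat 5 := by
  have h1 : 1 ≤ x := by omega
  have h2 : ¬ (σ.natArr 6 (σ.natArr 7 x) = x) := hf
  simp [processBody, hollowProg, Prog.block, Prog.exec, NExp.eval, Store.heap, hk, hx, Test.Holds,
    h1, h2]

theorem exec_process_place (hk : σ.nat 4 = k + 1) (hx : σ.natArr 12 k = x) (hx0 : x ≠ 0)
    (hf : σ.heap.Full x) (hs : σ.natArr 11 (σ.heap.rank x) = 0) :
    (processBody.exec f σ).heap = σ.heap ∧ (processBody.exec f σ).natArr 12 = σ.natArr 12 ∧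
    (processBody.exec f σ).nat 4 = k ∧
    (processBody.exec f σ).natArr 11 = Function.update (σ.natArr 11) (σ.heap.rank x) x ∧
    (processBody.exec f σ).nat 5 = max (σ.nat 5) (σ.heap.rank x) := by
  have h1 : 1 ≤ x := by omega
  have h2 : σ.natArr 6 (σ.natArr 7 x) = x := hf
  have h3 : σ.natArr 11 (σ.natArr 10 x) = 0 := hs
  by_cases h4 : σ.nat 5 ≤ σ.natArr 10 x
  · simp [processBody, placeProg, Prog.block, Prog.exec, NExp.eval, Store.heap, hk, hx, Test.Holds,
      h1, h2, h3, h4]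
  · simp [processBody, placeProg, Prog.block, Prog.exec, NExp.eval, Store.heap, hk, hx, Test.Holds,
      h1, h2, h3, h4]
    omega

theorem exec_process_link {y : ℕ} (hk : σ.nat 4 = k + 1) (hx : σ.natArr 12 k = x) (hx0 : x ≠ 0)
    (hf : σ.heap.Full x) (hs : σ.natArr 11 (σ.heap.rank x) = y) (hy0 : y ≠ 0) :
    (processBody.exec f σ).heap =
      (if σ.heap.key x ≤ σ.heap.key y then σ.heap.link x y else σ.heap.link y x) ∧
    (processBody.exec f σ).natArr 12 = Function.update (σ.natArr 12) k (σ.nat 3 + 1) ∧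
    (processBody.exec f σ).nat 4 = k + 1 ∧
    (processBody.exec f σ).natArr 11 = Function.update (σ.natArr 11) (σ.heap.rank x) 0 ∧
    (processBody.exec f σ).nat 5 = σ.nat 5 := by
  have h1 : 1 ≤ x := by omega
  have h1' : 1 ≤ y := by omega
  have h2 : σ.natArr 6 (σ.natArr 7 x) = x := hf
  have h3 : σ.natArr 11 (σ.natArr 10 x) = y := hs
  by_cases h4 : σ.ratArr 3 x ≤ σ.ratArr 3 y
  · simp [processBody, linkProg, Prog.block, Prog.exec, NExp.eval, QExp.eval, Store.heap, hk, hx,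
      Test.Holds, h1, h1', h2, h3, h4, Heap.link, Heap.push]
  · simp [processBody, linkProg, Prog.block, Prog.exec, NExp.eval, QExp.eval, Store.heap, hk, hx,
      Test.Holds, h1, h1', h2, h3, h4, Heap.link, Heap.push]

end cases

theorem map_range_update {α : Type*} (g : ℕ → α) {k i : ℕ} (h : k ≤ i) (c : α) :
    (Multiset.range k).map (Function.update g i c) = (Multiset.range k).map g :=
  Multiset.map_congr rfl fun j hj => Function.update_of_ne
    (by have := Multiset.mem_range.1 hj; omega) _ _

theorem map_range_eq_cons {α : Type*} (g : ℕ → α) {k i : ℕ} (h : i < k) :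
    (Multiset.range k).map g = g i ::ₘ ((Multiset.range k).erase i).map g := by
  rw [← Multiset.map_cons, Multiset.cons_erase (Multiset.mem_range.2 h)]

theorem map_range_update_eq_cons {α : Type*} (g : ℕ → α) {k i : ℕ} (h : i < k) (c : α) :
    (Multiset.range k).map (Function.update g i c) =
      c ::ₘ ((Multiset.range k).erase i).map g := by
  rw [map_range_eq_cons _ h, Function.update_self]
  congr 1
  refine Multiset.map_congr rfl fun j hj => Function.update_of_ne ?_ _ _
  exact ((Multiset.nodup_range k).mem_erase_iff.1 hj).1

theorem Store.stack_succ {σ : Store} {k : ℕ} (h : σ.nat 4 = k + 1) :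
    σ.stack = σ.natArr 12 k ::ₘ (Multiset.range k).map (σ.natArr 12) := by
  rw [Store.stack, h, Multiset.range_succ, Multiset.map_cons]

theorem Prog.agreeOff_exec (f : ℕ → ℝ) {p : Prog} (h : p.LoopFree) (σ : Store) :
    Store.AgreeOff p.writes σ (p.exec f σ) := by
  obtain ⟨t, ht, -⟩ := Prog.run_exec f h σ
  exact ht.agreeOff

theorem processBody_loopFree : processBody.LoopFree := by
  simp [processBody, linkProg, placeProg, hollowProg, Prog.block, Prog.LoopFree]

-- Amortized analysis of the consolidation of roots

/-- The roots on the stack and in the slots up to `L`. -/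
def Store.roots (σ : Store) (L : ℕ) : Multiset ℕ := σ.stack + σ.slots (L + 1)

/-- The number of cells in the trees. -/
def Store.size (σ : Store) (L : ℕ) : ℕ := (σ.heap.total (σ.roots L)).card

/-- The potential. -/
def Store.potential (σ : Store) (L : ℕ) : ℕ :=
  2 * σ.nat 4 + (σ.slots (L + 1)).countP (· ≠ 0) + 3 * σ.size L

/-- The invariant of the heap in memory. -/
structure Store.Ready (σ : Store) (L : ℕ) : Prop where
  inv : σ.heap.Inv (σ.ratArr 2) (σ.roots L)
  slot : ∀ r, σ.natArr 11 r ≠ 0 → r ≤ σ.nat 5 ∧ σ.heap.Full (σ.natArr 11 r) ∧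
    σ.heap.rank (σ.natArr 11 r) = r
  maxr : σ.nat 5 ≤ L

namespace Heap

theorem link_cur {H : Heap} {x y : ℕ} (hx0 : x ≠ 0) (hf : H.Full x) (i : ℕ) :
    (H.link x y).cur i = 0 ↔ H.cur i = 0 := by
  by_cases hi : i = H.own x
  · subst hi
    rw [link, push_cur_self]
    have : H.cur (H.own x) = x := hf
    omega
  · rw [link, push_cur hi]

theorem link_full_old {H : Heap} {x y z : ℕ} (hf : H.Full x) (hz : z ≤ H.cnt)
    (hzx : z ≠ x) : (H.link x y).Full z ↔ H.Full z :=
  push_full_old hz (by have : H.cur (H.own x) = x := hf; rwa [this])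

theorem link_rank {H : Heap} {x y z : ℕ} (hz : z ≤ H.cnt) : (H.link x y).rank z = H.rank z :=
  Function.update_of_ne (by omega) _ _

end Heap

/-- The weights 2, 1, 3 of the potential make every case lose at least 1. A null root leaves the
stack (−2). A hollow root is replaced by two roots and its cell disappears (+2 − 3). Placing a root
moves it from the stack to a slot (−2 + 1). A link puts one root back on the stack and empties a
slot (−1). -/
theorem process_step (f : ℕ → ℝ) {σ : Store} {L N : ℕ} (h : σ.Ready L)
    (hL : 2 * Nat.log 2 N + 1 ≤ L)
    (hN : σ.size L ≤ N) (hsp : 1 ≤ σ.nat 4) :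
    (processBody.exec f σ).Ready L ∧ (processBody.exec f σ).size L ≤ σ.size L ∧
    (processBody.exec f σ).potential L + 1 ≤ σ.potential L ∧
    ∀ i, (processBody.exec f σ).heap.cur i = 0 ↔ σ.heap.cur i = 0 := by
  obtain ⟨k, hk⟩ : ∃ k, σ.nat 4 = k + 1 := ⟨σ.nat 4 - 1, by omega⟩
  have hdeg : (processBody.exec f σ).ratArr 2 = σ.ratArr 2 :=
    (Prog.agreeOff_exec f processBody_loopFree σ).ratArr 2 (by decide)
  obtain ⟨x, hx⟩ : ∃ x, σ.natArr 12 k = x := ⟨_, rfl⟩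
  have hstack := Store.stack_succ hk
  rw [hx] at hstack
  set S := (Multiset.range k).map (σ.natArr 12) with hS
  have hroots : σ.roots L = x ::ₘ (S + σ.slots (L + 1)) := by
    rw [Store.roots, hstack, Multiset.cons_add]
  have hinv := h.inv
  rw [hroots] at hinv
  have hsize : σ.size L = (σ.heap.total (x ::ₘ (S + σ.slots (L + 1)))).card := by
    rw [Store.size, hroots]
  have hcell := hinv.cell
  by_cases hx0 : x = 0
  · subst hx0
    obtain ⟨e1, e2, e3, e4, e5⟩ := exec_process_null f σ hk hx
    set τ := processBody.exec f σ
    have hslots' : τ.slots (L + 1) = σ.slots (L + 1) := by rw [Store.slots, e4]; rfl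
    have hroots' : τ.roots L = S + σ.slots (L + 1) := by
      rw [Store.roots, hslots', Store.stack, e2, e3]
    have hsize' : τ.size L = σ.size L := by
      rw [hsize, Store.size, hroots', e1]; simp
    refine ⟨⟨?_, ?_, ?_⟩, hsize'.le, ?_, ?_⟩
    · rw [hroots', e1, hdeg]; exact Heap.inv_null.1 hinv
    · rw [e1, e4, e5]; exact h.slot
    · rw [e5]; exact h.maxr
    · simp only [Store.potential, hsize', e3, hslots', hk]; omega
    · rw [e1]; exact fun _ => Iff.rfl
  have hxc : x ≤ σ.heap.cnt := hinv.root_le x (by simp)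
  by_cases hf : σ.heap.Full x
  swap
  · obtain ⟨e1, e2, e3, e4, e5⟩ := exec_process_hollow f σ hk hx hx0 hf
    set τ := processBody.exec f σ
    have hslots' : τ.slots (L + 1) = σ.slots (L + 1) := by rw [Store.slots, e4]; rfl
    have hroots' : τ.roots L = σ.heap.kid x ::ₘ σ.heap.kid (σ.heap.prev x) ::ₘ
        (S + σ.slots (L + 1)) := by
      rw [Store.roots, hslots', Store.stack, e2, e3]
      rw [Multiset.range_succ, Multiset.range_succ, Multiset.map_cons, Multiset.map_cons,
        Function.update_self, Function.update_of_ne (by omega), Function.update_self,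
        map_range_update _ (by omega), map_range_update _ le_rfl, Multiset.cons_swap]
      simp [hS]
    have hsize' : τ.size L + 1 = σ.size L := by
      rw [hsize, Store.size, hroots', e1, Heap.hollow_total hinv hx0 hf, Multiset.card_cons]
    refine ⟨⟨?_, ?_, ?_⟩, by omega, ?_, ?_⟩
    · rw [hroots', e1, hdeg]; exact hinv.hollow hx0 hf
    · rw [e1, e4, e5]; exact h.slot
    · rw [e5]; exact h.maxr
    · simp only [Store.potential, ← hsize', e3, hslots', hk]; omega
    · rw [e1]; exact fun _ => Iff.rfl
  -- This keeps the slot of x within the L + 1 slots that are counted as roots.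
  have hrL : σ.heap.rank x ≤ L := by
    refine (hinv.rank_le (by simp) hx0 (N := N) ?_).trans hL
    rw [← hsize]; exact hN
  have hslots := map_range_eq_cons (σ.natArr 11) (Nat.lt_succ_of_le hrL)
  set T := ((Multiset.range (L + 1)).erase (σ.heap.rank x)).map (σ.natArr 11) with hT
  have hslots0 : σ.slots (L + 1) = σ.natArr 11 (σ.heap.rank x) ::ₘ T := hslots
  rw [hslots0] at hinv hsize
  obtain ⟨y, hy⟩ : ∃ y, σ.natArr 11 (σ.heap.rank x) = y := ⟨_, rfl⟩
  rw [hy] at hinv hsize hslots0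
  by_cases hy0 : y = 0
  · subst hy0
    obtain ⟨e1, e2, e3, e4, e5⟩ := exec_process_place f σ hk hx hx0 hf hy
    set τ := processBody.exec f σ
    have hslots' : τ.slots (L + 1) = x ::ₘ T := by
      rw [Store.slots, e4, map_range_update_eq_cons _ (Nat.lt_succ_of_le hrL)]
    have hroots' : τ.roots L = S + (x ::ₘ T) := by
      rw [Store.roots, hslots', Store.stack, e2, e3]
    have hsize' : τ.size L = σ.size L := by
      rw [hsize, Store.size, hroots', e1]; simp
    refine ⟨⟨?_, ?_, ?_⟩, hsize'.le, ?_, ?_⟩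
    · rw [hroots', e1, hdeg]
      rw [Multiset.add_cons, Multiset.cons_swap] at hinv
      rw [Multiset.add_cons]
      exact Heap.inv_null.1 hinv
    · intro r hr
      rw [e1, e5]
      rw [e4] at hr ⊢
      by_cases hrx : r = σ.heap.rank x
      · subst hrx
        simp [hf]
      · rw [Function.update_of_ne hrx] at hr ⊢
        have := h.slot r hr
        exact ⟨this.1.trans (le_max_left _ _), this.2⟩
    · rw [e5]; exact max_le h.maxr hrL
    · simp only [Store.potential, hsize', e3, hslots', hslots0, hk]
      rw [Multiset.countP_cons_of_pos (p := (· ≠ 0)) _ hx0,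
        Multiset.countP_cons_of_neg (p := (· ≠ 0)) _ (by simp)]
      omega
    · rw [e1]; exact fun _ => Iff.rfl
  · obtain ⟨e1, e2, e3, e4, e5⟩ := exec_process_link f σ hk hx hx0 hf hy hy0
    set τ := processBody.exec f σ
    obtain ⟨-, hfy, hry⟩ := h.slot (σ.heap.rank x) (by rwa [hy])
    rw [hy] at hfy hry
    -- From here on a is the winner and b the loser, so that both outcomes of the key comparison are
    -- treated at once.
    obtain ⟨a, b, hab, ha0, hb0, hfa, hfb, hra, hrb, hkey, e1', hinv', hsz⟩ : ∃ a b,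
        (a = x ∨ a = y) ∧ a ≠ 0 ∧ b ≠ 0 ∧
        σ.heap.Full a ∧ σ.heap.Full b ∧ σ.heap.rank a = σ.heap.rank x ∧
        σ.heap.rank b = σ.heap.rank x ∧
        σ.heap.key a ≤ σ.heap.key b ∧ τ.heap = σ.heap.link a b ∧
        σ.heap.Inv (σ.ratArr 2) (a ::ₘ b ::ₘ (S + T)) ∧
        σ.size L = (σ.heap.total (a ::ₘ b ::ₘ (S + T))).card := by
      rw [Multiset.add_cons] at hinv hsize
      by_cases hxy : σ.heap.key x ≤ σ.heap.key y
      · exact ⟨x, y, Or.inl rfl, hx0, hy0, hf, hfy, rfl, hry, hxy, by rw [e1, if_pos hxy], hinv,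
          hsize⟩
      · rw [Multiset.cons_swap] at hinv hsize
        exact ⟨y, x, Or.inr rfl, hy0, hx0, hfy, hf, hry, rfl, (not_le.1 hxy).le,
          by rw [e1, if_neg hxy], hinv, hsize⟩
    have hr : σ.heap.rank a = σ.heap.rank b := hra.trans hrb.symm
    have hslots' : τ.slots (L + 1) = 0 ::ₘ T := by
      rw [Store.slots, e4, map_range_update_eq_cons _ (Nat.lt_succ_of_le hrL)]
    have hroots' : τ.roots L = 0 ::ₘ (σ.heap.cnt + 1) ::ₘ (S + T) := by
      rw [Store.roots, hslots', Store.stack, e2, e3, Multiset.range_succ, Multiset.map_cons,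
        Function.update_self, map_range_update _ le_rfl, Multiset.add_cons, Multiset.cons_add]
      rfl
    have hsize' : τ.size L = σ.size L := by
      obtain ⟨t1, t2⟩ := Heap.link_total hinv' ha0 hb0 hfa hr hkey
      rw [hsz, Store.size, hroots', e1', Heap.total_cons, t1, t2]; simp
    refine ⟨⟨?_, ?_, ?_⟩, hsize'.le, ?_, ?_⟩
    · rw [hroots', e1', hdeg, Heap.inv_null]
      exact hinv'.link ha0 hb0 hfa hr hkey
    · intro r hr
      rw [e1', e5]
      rw [e4] at hr ⊢
      by_cases hrx : r = σ.heap.rank x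
      · subst hrx
        simp at hr
      · rw [Function.update_of_ne hrx] at hr ⊢
        obtain ⟨s1, s2, s3⟩ := h.slot r hr
        have hle : σ.natArr 11 r ≤ σ.heap.cnt := by
          have := h.inv.cur_le (σ.heap.own (σ.natArr 11 r))
          have e : σ.heap.cur (σ.heap.own (σ.natArr 11 r)) = σ.natArr 11 r := s2
          rwa [e] at this
        -- The winner is the only cell that becomes hollow. A root in another slot has another rank,
        -- hence is not the winner and stays full.
        refine ⟨s1, (Heap.link_full_old hfa hle ?_).2 s2, (Heap.link_rank hle).trans s3⟩
        intro e
        rw [e, hra] at s3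
        exact hrx s3.symm
    · rw [e5]; exact h.maxr
    · simp only [Store.potential, hsize', e3, hslots', hslots0, hk]
      rw [Multiset.countP_cons_of_pos (p := (· ≠ 0)) _ hy0,
        Multiset.countP_cons_of_neg (p := (· ≠ 0)) _ (by simp)]
      omega
    · intro i
      rw [e1']
      exact Heap.link_cur ha0 hfa i

/-- Processes all roots from the stack. -/
def processProg : Prog := .loop (.natLe (.lit 1) (.var 4)) processBody

theorem processBody_maxCost : processBody.maxCost ≤ 150 := by decide

/-- One round costs at most 153 operations, test included, so 200 operations per unit of potential
suffice. The final test accounts for the additive 3. -/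
theorem run_processProg (f : ℕ → ℝ) {σ : Store} {L N : ℕ} (h : σ.Ready L)
    (hL : 2 * Nat.log 2 N + 1 ≤ L) (hN : σ.size L ≤ N) :
    ∃ t τ, Run f processProg σ t τ ∧ τ.Ready L ∧ τ.nat 4 = 0 ∧ τ.size L ≤ σ.size L ∧
      t + 200 * τ.potential L ≤ 200 * σ.potential L + 3 ∧
      (∀ i, τ.heap.cur i = 0 ↔ σ.heap.cur i = 0) := by
  obtain ⟨t, τ, hrun, hI, hb⟩ := Run.of_invariant (f := f) (b := .natLe (.lit 1) (.var 4))
    (p := processBody)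
    (I := fun t τ => τ.Ready L ∧ τ.size L ≤ σ.size L ∧
      t + 200 * τ.potential L ≤ 200 * σ.potential L ∧
      (∀ i, τ.heap.cur i = 0 ↔ σ.heap.cur i = 0)) (200 * σ.potential L)
    (fun t τ hI => by have := hI.2.2.1; omega)
    (fun t ρ hI hb => by
      obtain ⟨s, hs, hs'⟩ := Prog.run_exec f processBody_loopFree ρ
      obtain ⟨r1, r2, r3, r4⟩ := process_step f hI.1 hL (hI.2.1.trans hN) hb
      refine ⟨s, _, hs, r1, r2.trans hI.2.1, ?_, fun i => (r4 i).trans (hI.2.2.2 i)⟩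
      have := processBody_maxCost
      have := hI.2.2.1
      simp only [Test.cost, NExp.cost]
      omega) (t₀ := 0) (σ := σ) ⟨h, le_rfl, by omega, fun _ => Iff.rfl⟩
  refine ⟨_, τ, hrun, hI.1, ?_, hI.2.1, ?_, hI.2.2.2⟩
  · simp [Test.Holds, NExp.eval] at hb; exact hb
  · have := hI.2.2.1
    simp only [Test.cost, NExp.cost]; omega

-- Extraction and removal of a minimum

/-- Removes one slot; the best root is in variable `7`, the other ones go to the stack. -/
def extractBody : Prog := .block [
  .setNat 6 (.get 11 (.var 12)),
  .putNat 11 (.var 12) (.lit 0),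
  .setNat 12 (.add (.var 12) (.lit 1)),
  .cond (.natLe (.lit 1) (.var 6))
    (.block [
      .cond (.and (.natLe (.lit 1) (.var 7)) (.ratLe (.get 3 (.var 7)) (.get 3 (.var 6))))
        (.putNat 12 (.var 4) (.var 6))
        (.block [.putNat 12 (.var 4) (.var 7), .setNat 7 (.var 6)]),
      .setNat 4 (.add (.var 4) (.lit 1))])
    .skip]

theorem extractBody_loopFree : extractBody.LoopFree := by
  simp [extractBody, Prog.block, Prog.LoopFree]

theorem extractBody_maxCost : extractBody.maxCost ≤ 50 := by decide

section cases
variable (f : ℕ → ℝ) (σ : Store) {x y : ℕ}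

theorem exec_extract_null (hx : σ.natArr 11 (σ.nat 12) = 0) :
    (extractBody.exec f σ).natArr 11 = Function.update (σ.natArr 11) (σ.nat 12) 0 ∧
    (extractBody.exec f σ).nat 12 = σ.nat 12 + 1 ∧
    (extractBody.exec f σ).natArr 12 = σ.natArr 12 ∧ (extractBody.exec f σ).nat 4 = σ.nat 4 ∧
    (extractBody.exec f σ).nat 7 = σ.nat 7 := by
  simp [extractBody, Prog.block, Prog.exec, NExp.eval, hx, Test.Holds]

/-- Here b is the better and a the worse of the slot root and the best root so far; a is pushed on
the stack even if it is the null cell, which happens at the first occupied slot. -/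
theorem exec_extract (hx : σ.natArr 11 (σ.nat 12) = x) (hx0 : x ≠ 0) (hy : σ.nat 7 = y) :
    ∃ a b, ((a = x ∧ b = y) ∨ (a = y ∧ b = x)) ∧ b ≠ 0 ∧ (a ≠ 0 → σ.heap.key b ≤ σ.heap.key a) ∧
    (y ≠ 0 → σ.heap.key b ≤ σ.heap.key y) ∧
    (extractBody.exec f σ).natArr 11 = Function.update (σ.natArr 11) (σ.nat 12) 0 ∧
    (extractBody.exec f σ).nat 12 = σ.nat 12 + 1 ∧
    (extractBody.exec f σ).natArr 12 = Function.update (σ.natArr 12) (σ.nat 4) a ∧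
    (extractBody.exec f σ).nat 4 = σ.nat 4 + 1 ∧
    (extractBody.exec f σ).nat 7 = b := by
  have h1 : 1 ≤ x := by omega
  by_cases h2 : 1 ≤ y ∧ σ.ratArr 3 y ≤ σ.ratArr 3 x
  · refine ⟨x, y, Or.inl ⟨rfl, rfl⟩, by omega, fun _ => h2.2, fun _ => le_rfl, ?_⟩
    simp [extractBody, Prog.block, Prog.exec, NExp.eval, QExp.eval, hx, hy, Test.Holds, h1, h2]
  · have h3 : y ≠ 0 → σ.heap.key x ≤ σ.heap.key y := fun hy0 =>
      (not_le.1 fun h => h2 ⟨by omega, h⟩).le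
    refine ⟨y, x, Or.inr ⟨rfl, rfl⟩, hx0, h3, h3, ?_⟩
    simp [extractBody, Prog.block, Prog.exec, NExp.eval, QExp.eval, hx, hy, Test.Holds, h1, h2]

end cases

/-- The invariant of the extraction: the roots in variable `7`, on the stack and in the slots from
`r` on are those of `σ`. -/
structure Extracting (L : ℕ) (σ τ : Store) : Prop where
  heap : τ.heap = σ.heap
  deg : τ.ratArr 2 = σ.ratArr 2
  maxr : τ.nat 5 = σ.nat 5
  inv : σ.heap.Inv (σ.ratArr 2) (τ.nat 7 ::ₘ τ.roots L)
  size : (σ.heap.total (τ.nat 7 ::ₘ τ.roots L)).card = σ.size L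
  slot : ∀ r, τ.natArr 11 r ≠ 0 → τ.nat 12 ≤ r ∧ r ≤ σ.nat 5 ∧ σ.heap.Full (τ.natArr 11 r)
  full : τ.nat 7 ≠ 0 → σ.heap.Full (τ.nat 7)
  best : ∀ x ∈ τ.stack, x ≠ 0 → τ.nat 7 ≠ 0 ∧ σ.heap.key (τ.nat 7) ≤ σ.heap.key x
  stack : τ.nat 4 ≤ τ.nat 12
  idx : τ.nat 12 ≤ σ.nat 5 + 1

theorem extracting_step (f : ℕ → ℝ) {L : ℕ} {σ τ : Store} (hL : σ.nat 5 ≤ L)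
    (h : Extracting L σ τ) (hb : τ.nat 12 ≤ τ.nat 5) :
    Extracting L σ (extractBody.exec f τ) ∧
      (extractBody.exec f τ).nat 12 = τ.nat 12 + 1 := by
  have hag := Prog.agreeOff_exec f extractBody_loopFree τ
  have hheap : (extractBody.exec f τ).heap = σ.heap := by
    rw [← h.heap]
    simp only [Store.heap, hag.natArr 7 (by decide), hag.natArr 8 (by decide),
      hag.natArr 9 (by decide), hag.natArr 10 (by decide), hag.natArr 6 (by decide),
      hag.ratArr 3 (by decide), hag.nat 3 (by decide)]
  have hdeg := (hag.ratArr 2 (by decide)).trans h.deg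
  have hmaxr := (hag.nat 5 (by decide)).trans h.maxr
  have hidx : τ.nat 12 < L + 1 := by have := h.maxr; omega
  obtain ⟨x, hx⟩ : ∃ x, τ.natArr 11 (τ.nat 12) = x := ⟨_, rfl⟩
  have hsl : τ.slots (L + 1) = _ := map_range_eq_cons (τ.natArr 11) hidx
  rw [hx] at hsl
  set T := ((Multiset.range (L + 1)).erase (τ.nat 12)).map (τ.natArr 11)
  have hslot' : (extractBody.exec f τ).natArr 11 = Function.update (τ.natArr 11) (τ.nat 12) 0 →
      (extractBody.exec f τ).nat 12 = τ.nat 12 + 1 →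
      (extractBody.exec f τ).slots (L + 1) = 0 ::ₘ T ∧
      ∀ r, (extractBody.exec f τ).natArr 11 r ≠ 0 → (extractBody.exec f τ).nat 12 ≤ r ∧
        r ≤ σ.nat 5 ∧ σ.heap.Full ((extractBody.exec f τ).natArr 11 r) := by
    intro e1 e2
    refine ⟨by rw [Store.slots, e1, map_range_update_eq_cons _ hidx], fun r hr => ?_⟩
    rw [e1] at hr ⊢
    by_cases hrt : r = τ.nat 12
    · subst hrt; simp at hr
    · rw [Function.update_of_ne hrt] at hr ⊢
      have := h.slot r hr
      rw [e2]
      exact ⟨by omega, this.2⟩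
  have hmx := h.maxr
  by_cases hx0 : x = 0
  · subst hx0
    obtain ⟨e1, e2, e3, e4, e5⟩ := exec_extract_null f τ hx
    obtain ⟨s1, s2⟩ := hslot' e1 e2
    have hst : (extractBody.exec f τ).stack = τ.stack := by rw [Store.stack, e3, e4]; rfl
    have hroots : (extractBody.exec f τ).roots L = τ.roots L := by
      rw [Store.roots, hst, s1, Store.roots, hsl]
    refine ⟨⟨hheap, hdeg, hmaxr, ?_, ?_, s2, ?_, ?_, ?_, ?_⟩, e2⟩
    · rw [e5, hroots]; exact h.inv
    · rw [e5, hroots]; exact h.size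
    · rw [e5]; exact h.full
    · rw [e5, hst]; exact h.best
    · rw [e4, e2]; exact h.stack.trans (Nat.le_succ _)
    · rw [e2]; omega
  · obtain ⟨y, hy⟩ : ∃ y, τ.nat 7 = y := ⟨_, rfl⟩
    obtain ⟨a, b, hab, hb0, hk1, hk2, e1, e2, e3, e4, e5⟩ := exec_extract f τ hx hx0 hy
    obtain ⟨s1, s2⟩ := hslot' e1 e2
    rw [h.heap] at hk1 hk2
    have hst : (extractBody.exec f τ).stack = a ::ₘ τ.stack := by
      rw [Store.stack, e3, e4, Multiset.range_succ, Multiset.map_cons, Function.update_self,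
        map_range_update _ le_rfl]; rfl
    have hfx : σ.heap.Full x := by
      have := (h.slot (τ.nat 12) (by rwa [hx])).2.2
      rwa [hx] at this
    have hroots : b ::ₘ (extractBody.exec f τ).roots L = 0 ::ₘ y ::ₘ τ.roots L := by
      rw [Store.roots, hst, s1, Store.roots, hsl]
      rcases hab with ⟨rfl, rfl⟩ | ⟨rfl, rfl⟩
      · simp only [Multiset.add_cons, Multiset.cons_add]
        rw [Multiset.cons_swap]
      · simp only [Multiset.add_cons, Multiset.cons_add]
        rw [Multiset.cons_swap, Multiset.cons_swap b]
    have h7 := h.full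
    rw [hy] at h7
    refine ⟨⟨hheap, hdeg, hmaxr, ?_, ?_, s2, ?_, ?_, ?_, ?_⟩, e2⟩
    · rw [e5, hroots, Heap.inv_null, ← hy]; exact h.inv
    · rw [e5, hroots, Heap.total_cons, Heap.tree_zero, zero_add, ← hy]; exact h.size
    · rw [e5]
      intro _
      rcases hab with ⟨rfl, rfl⟩ | ⟨rfl, rfl⟩
      · exact h7 hb0
      · exact hfx
    · rw [e5, hst]
      intro z hz hz0
      refine ⟨hb0, ?_⟩
      rcases Multiset.mem_cons.1 hz with rfl | hz
      · exact hk1 hz0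
      · have := h.best z hz hz0
        rw [hy] at this
        exact (hk2 this.1).trans this.2
    · rw [e4, e2]; have := h.stack; omega
    · rw [e2]; omega

/-- Moves all roots from the slots to the stack, except for a best one in variable `7`. -/
def extractProg : Prog := .seq (.setNat 12 (.lit 0)) (.seq (.setNat 7 (.lit 0))
  (.loop (.natLe (.var 12) (.var 5)) extractBody))

theorem run_extractProg (f : ℕ → ℝ) {σ : Store} {L : ℕ} (h : σ.Ready L) (hsp : σ.nat 4 = 0) :
    ∃ t τ, Run f extractProg σ t τ ∧ Extracting L σ τ ∧ (∀ r, τ.natArr 11 r = 0) ∧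
      τ.nat 4 ≤ L + 1 ∧ t ≤ 60 * (L + 1) + 10 := by
  have h0 : Extracting L σ ((σ.setNat 12 0).setNat 7 0) := by
    refine ⟨rfl, rfl, rfl, ?_, ?_, ?_, ?_, ?_, ?_, ?_⟩
    · exact Heap.inv_null.2 h.inv
    · simp [Store.size]; rfl
    · intro r hr
      have := h.slot r hr
      exact ⟨by simp, this.1, this.2.1⟩
    · simp
    · simp [Store.stack, hsp]
    · simp [hsp]
    · simp
  obtain ⟨t, τ, hrun, hI, hb⟩ := Run.of_invariant (f := f) (b := .natLe (.var 12) (.var 5))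
    (p := extractBody)
    (I := fun t τ => Extracting L σ τ ∧ t ≤ 60 * τ.nat 12) (60 * (σ.nat 5 + 1))
    (fun t τ hI => by have := hI.1.idx; have := hI.2; omega)
    (fun t ρ hI hb => by
      obtain ⟨s, hs, hs'⟩ := Prog.run_exec f extractBody_loopFree ρ
      obtain ⟨r1, r2⟩ := extracting_step f h.maxr hI.1 hb
      refine ⟨s, _, hs, r1, ?_⟩
      have := extractBody_maxCost
      have := hI.2
      simp only [Test.cost, NExp.cost]
      omega) (t₀ := 0) (σ := (σ.setNat 12 0).setNat 7 0)
      ⟨h0, by simp⟩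
  have hb' : ¬ (τ.nat 12 ≤ τ.nat 5) := hb
  have h1 := hI.1.maxr
  have h2 := hI.1.idx
  have h3 := h.maxr
  have h4 := hI.1.stack
  refine ⟨_, τ, .seq (.setNat _ _ _) (.seq (.setNat _ _ _) hrun), hI.1, fun r => ?_, by omega, ?_⟩
  · by_contra hr
    have := hI.1.slot r hr
    omega
  · have := hI.2
    simp only [Test.cost, NExp.cost]
    omega

/-- The extracted root has the smallest key. -/
theorem Extracting.min {L : ℕ} {σ τ : Store} (h : Extracting L σ τ) (hs : ∀ r, τ.natArr 11 r = 0)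
    {i : ℕ} (hi : σ.heap.cur i ≠ 0) :
    τ.nat 7 ≠ 0 ∧ σ.heap.key (τ.nat 7) ≤ σ.ratArr 2 i := by
  obtain ⟨-, h2, h3⟩ := h.inv.cur i hi
  obtain ⟨z, hz, hiz⟩ := Heap.mem_total.1 h2
  have hz0 : z ≠ 0 := by have := (σ.heap.mem_bounds z).1 _ hiz; omega
  have hkey := (Heap.key_le h.inv.cell z (h.inv.root_le z hz)).1 _ hiz
  rw [h3] at hkey
  rcases Multiset.mem_cons.1 hz with rfl | hz
  · exact ⟨hz0, hkey⟩
  · rcases Multiset.mem_add.1 hz with hz | hz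
    · have := h.best z hz hz0
      exact ⟨this.1, this.2.trans hkey⟩
    · obtain ⟨r, -, hr⟩ := Multiset.mem_map.1 hz
      exact absurd (hr ▸ hs r) hz0

/-- Pushes one victim of the cell in variable `7`. -/
def victimBody : Prog := .block [
  .putNat 12 (.var 4) (.get 9 (.var 7)),
  .setNat 4 (.add (.var 4) (.lit 1)),
  .setNat 7 (.get 8 (.var 7))]

theorem victimBody_loopFree : victimBody.LoopFree := by
  simp [victimBody, Prog.block, Prog.LoopFree]

theorem victimBody_maxCost : victimBody.maxCost ≤ 20 := by decide

theorem exec_victimBody (f : ℕ → ℝ) (σ : Store) :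
    (victimBody.exec f σ).natArr 12 =
      Function.update (σ.natArr 12) (σ.nat 4) (σ.heap.kid (σ.nat 7)) ∧
    (victimBody.exec f σ).nat 4 = σ.nat 4 + 1 ∧
    (victimBody.exec f σ).nat 7 = σ.heap.prev (σ.nat 7) := by
  simp [victimBody, Prog.block, Prog.exec, NExp.eval, Store.heap]

theorem exec_victimBody_heap (f : ℕ → ℝ) (σ : Store) : (victimBody.exec f σ).heap = σ.heap := by
  simp [victimBody, Prog.block, Prog.exec, NExp.eval, Store.heap]

/-- Removes the item of the root in variable `7`, which is left in variable `8`. -/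
def removeProg : Prog := .seq (.setNat 8 (.get 7 (.var 7))) (.seq (.putNat 6 (.var 8) (.lit 0))
  (.loop (.natLe (.lit 1) (.var 7)) victimBody))

theorem run_removeProg (f : ℕ → ℝ) {σ : Store} {L : ℕ} (hs : ∀ r, σ.natArr 11 r = 0)
    (hinv : σ.heap.Inv (σ.ratArr 2) (σ.nat 7 ::ₘ σ.roots L)) (hy0 : σ.nat 7 ≠ 0)
    (hf : σ.heap.Full (σ.nat 7)) (hr : σ.heap.rank (σ.nat 7) ≤ L) (hL : σ.nat 5 ≤ L) :
    ∃ t τ, Run f removeProg σ t τ ∧ τ.Ready L ∧ (∀ r, τ.natArr 11 r = 0) ∧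
      τ.nat 8 = σ.heap.own (σ.nat 7) ∧ τ.heap.cur = Function.update σ.heap.cur (τ.nat 8) 0 ∧
      τ.size L + 1 = (σ.heap.total (σ.nat 7 ::ₘ σ.roots L)).card ∧
      τ.nat 4 ≤ σ.nat 4 + L + 1 ∧ t ≤ 30 * (L + 1) + 10 := by
  set y := σ.nat 7
  set H := σ.heap.remove (σ.heap.own y) with hH
  set σ₁ := (σ.setNat 8 (σ.heap.own y)).putNat 6 (σ.heap.own y) 0 with hσ₁
  have hσ₁H : σ₁.heap = H := by simp [hσ₁, hH, Store.heap, Heap.remove]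
  have hinvH := hinv.remove hy0 hf
  have htot := Heap.remove_total hinv hy0 hf
  rw [← hH, ← Heap.remove_victims (σ.heap.own y), ← hH] at hinvH htot
  have hroots₁ : σ₁.roots L = σ.roots L := rfl
  have h7 : σ₁.nat 7 = y := rfl
  -- The victims not yet visited together with the roots already present stay constant. The rank
  -- plus one of the current cell counts the remaining pushes; it exceeds the rank by one since the
  -- rank-0 cell at the end pushes its null kid.
  obtain ⟨t, τ, hrun, ⟨i1, i2, i3, i4, i5⟩, hb⟩ := Run.of_invariant (f := f)
    (b := .natLe (.lit 1) (.var 7)) (p := victimBody)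
    (I := fun t τ => τ.heap = H ∧ Store.AgreeOff victimBody.writes σ₁ τ ∧
      H.victims (τ.nat 7) + τ.roots L = H.victims y + σ.roots L ∧ τ.nat 7 ≤ H.cnt ∧
      t + 30 * (if τ.nat 7 = 0 then 0 else H.rank (τ.nat 7) + 1) ≤ 30 * (H.rank y + 1) ∧
      τ.nat 4 + (if τ.nat 7 = 0 then 0 else H.rank (τ.nat 7) + 1) ≤ σ.nat 4 + (H.rank y + 1))
    (30 * (H.rank y + 1))
    (fun t τ hI => by have := hI.2.2.2.2.1; omega)
    (fun t ρ hI hb => by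
      obtain ⟨i1, i2, i3, i4, i5, i6⟩ := hI
      obtain ⟨s, hs, hs'⟩ := Prog.run_exec f victimBody_loopFree ρ
      obtain ⟨e1, e2, e3⟩ := exec_victimBody f ρ
      have hb' : 1 ≤ ρ.nat 7 := hb
      rw [if_neg (by omega)] at i5 i6
      have hcell := hinvH.cell _ i4
      have hslots : (victimBody.exec f ρ).slots (L + 1) = ρ.slots (L + 1) := by
        rw [Store.slots, (Prog.agreeOff_exec f victimBody_loopFree ρ).natArr 11 (by decide)]; rfl
      refine ⟨s, _, hs, (exec_victimBody_heap f ρ).trans i1, i2.trans hs.agreeOff, ?_, ?_, ?_, ?_⟩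
      · rw [← i3, Heap.victims_eq hcell (by omega), Store.roots, hslots, Store.stack, e1, e2, e3,
          Multiset.range_succ, Multiset.map_cons, Function.update_self,
          map_range_update _ le_rfl, i1, Multiset.cons_add, Multiset.add_cons, Multiset.cons_add]
        rfl
      · rw [e3, i1]; exact hcell.prev_le.trans i4
      · have := victimBody_maxCost
        rw [e3, i1]
        simp only [Test.cost, NExp.cost]
        split_ifs with h0
        · omega
        · rcases hcell with h | h <;> omega
      · rw [e2, e3, i1]
        split_ifs with h0
        · omega
        · rcases hcell with h | h <;> omega) (t₀ := 0) (σ := σ₁)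
      ⟨hσ₁H, .refl _ _, by rw [h7, hroots₁], hinv.root_le y (by simp),
        by rw [h7, if_neg hy0]; omega, by rw [h7, if_neg hy0]; exact le_rfl⟩
  have h70 : τ.nat 7 = 0 := by
    have : ¬ (1 ≤ τ.nat 7) := hb
    omega
  have hrank : H.rank y = σ.heap.rank y := rfl
  rw [h70, Heap.victims_zero, zero_add] at i3
  rw [h70, if_pos rfl] at i5
  have hsl : τ.natArr 11 = σ.natArr 11 := i2.natArr 11 (by decide)
  have h8 : τ.nat 8 = σ.heap.own y := i2.nat 8 (by decide)
  have hdeg : τ.ratArr 2 = σ.ratArr 2 := i2.ratArr 2 (by decide)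
  have h5 : τ.nat 5 = σ.nat 5 := i2.nat 5 (by decide)
  refine ⟨_, τ, .seq (.setNat _ _ _) (.seq (.putNat _ _ _ _) hrun), ⟨?_, ?_, ?_⟩, ?_, h8, ?_, ?_,
    ?_, ?_⟩
  · rw [i1, i3, hdeg]; exact hinvH
  · intro r hr; rw [hsl] at hr; exact absurd (hs r) hr
  · rw [h5]; exact hL
  · rw [hsl]; exact hs
  · rw [i1, h8]; rfl
  · rw [htot, Store.size, i1, i3, Multiset.card_cons]
  · omega
  · simp only [Test.cost, NExp.cost]
    omega

/-- Removes an item with the smallest key. -/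
def deleteMinProg : Prog := .seq processProg (.seq extractProg removeProg)

/-- After consolidation each rank has at most one root. Extraction leaves at most L + 1 entries on
the stack and the removal adds at most L + 1 victims, so the final potential beyond the cells is at
most 4(L + 1). Everything else is paid for by the potential consumed during consolidation. -/
theorem run_deleteMinProg (f : ℕ → ℝ) {σ : Store} {L N : ℕ} (h : σ.Ready L)
    (hL : 2 * Nat.log 2 N + 1 ≤ L) (hN : σ.size L ≤ N) (hne : ∃ i, σ.heap.cur i ≠ 0) :
    ∃ t τ, Run f deleteMinProg σ t τ ∧ τ.Ready L ∧ (∀ r, τ.natArr 11 r = 0) ∧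
      σ.heap.cur (τ.nat 8) ≠ 0 ∧
      (∀ i, σ.heap.cur i ≠ 0 → σ.ratArr 2 (τ.nat 8) ≤ σ.ratArr 2 i) ∧
      (∀ i, τ.heap.cur i = 0 ↔ i = τ.nat 8 ∨ σ.heap.cur i = 0) ∧
      τ.size L + 1 ≤ σ.size L ∧
      t + 200 * τ.potential L ≤ 200 * σ.potential L + 1000 * (L + 1) := by
  obtain ⟨t₁, σ₁, r₁, g₁, sp₁, size₁, time₁, cur₁⟩ := run_processProg f h hL hN
  obtain ⟨t₂, σ₂, r₂, g₂, slot₂, sp₂, time₂⟩ := run_extractProg f g₁ sp₁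
  have hdeg₁ : σ₁.ratArr 2 = σ.ratArr 2 := r₁.agreeOff.ratArr 2 (by decide)
  have hmin : ∀ i, σ.heap.cur i ≠ 0 → σ₂.nat 7 ≠ 0 ∧ σ₁.heap.key (σ₂.nat 7) ≤ σ.ratArr 2 i := by
    intro i hi
    rw [← hdeg₁]
    exact g₂.min slot₂ (fun h0 => hi ((cur₁ i).1 h0))
  obtain ⟨i₀, hi₀⟩ := hne
  have h7 := (hmin i₀ hi₀).1
  have hfull := g₂.full h7
  have hinv₂ := g₂.inv
  have hsize₂ := g₂.size
  have hrank : σ₁.heap.rank (σ₂.nat 7) ≤ L := by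
    refine (hinv₂.rank_le (by simp) h7 (N := N) ?_).trans hL
    rw [hsize₂]; exact size₁.trans hN
  obtain ⟨t₃, σ₃, r₃, g₃, slot₃, e8, cur₃, size₃, sp₃, time₃⟩ := run_removeProg f slot₂
    (L := L) (by rw [g₂.heap, g₂.deg]; exact hinv₂) h7 (by rw [g₂.heap]; exact hfull)
    (by rw [g₂.heap]; exact hrank) (by rw [g₂.maxr]; exact g₁.maxr)
  rw [g₂.heap] at e8 cur₃ size₃
  rw [hsize₂] at size₃
  have hcur8 : σ₁.heap.cur (σ₃.nat 8) = σ₂.nat 7 := by rw [e8]; exact hfull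
  have hcur8' : σ.heap.cur (σ₃.nat 8) ≠ 0 := fun h0 => h7 (by rw [← hcur8, cur₁, h0])
  have hkey : σ₁.heap.key (σ₂.nat 7) = σ.ratArr 2 (σ₃.nat 8) := by
    have := (hinv₂.cur (σ₃.nat 8) (by rw [hcur8]; exact h7)).2.2
    rwa [hcur8, hdeg₁] at this
  refine ⟨_, σ₃, .seq r₁ (.seq r₂ r₃), g₃, slot₃, hcur8', fun i hi => ?_, fun i => ?_, by omega, ?_⟩
  · rw [← hkey]; exact (hmin i hi).2
  · rw [cur₃, Function.update_apply]
    split_ifs with hi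
    · simp [hi]
    · simp [hi, cur₁]
  · have e3 : σ₃.potential L = 2 * σ₃.nat 4 + 3 * σ₃.size L := by
      have : σ₃.slots (L + 1) = Multiset.replicate (L + 1) 0 := by
        rw [Store.slots, Multiset.map_congr rfl (fun r _ => slot₃ r), Multiset.map_const',
          Multiset.card_range]
      rw [Store.potential, this, Multiset.countP_eq_zero.2]
      · omega
      · intro a ha; simp [Multiset.eq_of_mem_replicate ha]
    have e1 : 3 * σ₁.size L ≤ σ₁.potential L := by rw [Store.potential]; omega
    omega

-- Key decreases along an adjacency list

/-- The linked list which starts at `h`. -/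
def Linked (nxt tgt : ℕ → ℕ) (wt : ℕ → ℚ) : ℕ → List (ℕ × ℚ) → Prop
  | h, [] => h = 0
  | h, a :: l => h ≠ 0 ∧ nxt h < h ∧ tgt h = a.1 ∧ wt h = a.2 ∧ Linked nxt tgt wt (nxt h) l

/-- The total weight of the entries for `i`. -/
def weightAt (l : List (ℕ × ℚ)) (i : ℕ) : ℚ := (l.map fun a => if a.1 = i then a.2 else 0).sum

@[simp] theorem weightAt_nil (i : ℕ) : weightAt [] i = 0 := rfl

@[simp] theorem weightAt_cons (a : ℕ × ℚ) (l : List (ℕ × ℚ)) (i : ℕ) :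
    weightAt (a :: l) i = (if a.1 = i then a.2 else 0) + weightAt l i := by
  simp [weightAt]

theorem Store.slots_of_zero {σ : Store} (h : ∀ r, σ.natArr 11 r = 0) (k : ℕ) :
    σ.slots k = Multiset.replicate k 0 := by
  rw [Store.slots, Multiset.map_congr rfl (fun r _ => h r), Multiset.map_const',
    Multiset.card_range]

/-- The invariant of the heap in memory between two removals. -/
structure Store.Idle (σ : Store) (L : ℕ) : Prop where
  ready : σ.Ready L
  slot : ∀ r, σ.natArr 11 r = 0

/-- The potential grows by 5: 2 for the stack entry and 3 for the new cell. The slots have to be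
empty, since the abandoned cell might otherwise be a root in a slot, where only full cells are
allowed. -/
theorem decrease_step {σ τ : Store} {L v : ℕ} {d : ℚ} (h : σ.Idle L)
    (hd : σ.heap.cur v ≠ 0 → d ≤ σ.ratArr 2 v) (e₁ : τ.heap = σ.heap.decrease v d)
    (e₂ : τ.ratArr 2 = Function.update (σ.ratArr 2) v d)
    (e₃ : τ.natArr 12 = Function.update (σ.natArr 12) (σ.nat 4) (σ.nat 3 + 1))
    (e₄ : τ.nat 4 = σ.nat 4 + 1) (e₅ : τ.natArr 11 = σ.natArr 11) (e₆ : τ.nat 5 = σ.nat 5) :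
    τ.Idle L ∧ τ.size L = σ.size L + 1 ∧ τ.potential L = σ.potential L + 5 ∧
      ∀ i, τ.heap.cur i = 0 ↔ i ≠ v ∧ σ.heap.cur i = 0 := by
  have hsl : τ.slots (L + 1) = σ.slots (L + 1) := by rw [Store.slots, e₅]; rfl
  have hroots : τ.roots L = (σ.heap.cnt + 1) ::ₘ σ.roots L := by
    rw [Store.roots, hsl, Store.stack, e₃, e₄, Multiset.range_succ, Multiset.map_cons,
      Function.update_self, map_range_update _ le_rfl, Multiset.cons_add]
    rfl
  have hsize : τ.size L = σ.size L + 1 := by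
    rw [Store.size, hroots, e₁, Heap.decrease_total h.ready.inv hd, Multiset.card_cons]; rfl
  refine ⟨⟨⟨?_, ?_, ?_⟩, ?_⟩, hsize, ?_, fun i => ?_⟩
  · rw [hroots, e₁, e₂]; exact h.ready.inv.decrease hd
  · intro r hr; rw [e₅] at hr; exact absurd (h.slot r) hr
  · rw [e₆]; exact h.ready.maxr
  · rw [e₅]; exact h.slot
  · rw [Store.potential, Store.potential, hsl, hsize, e₄]; omega
  · rw [e₁]
    by_cases hi : i = v
    · subst hi; simp [Heap.decrease, Heap.push_cur_self]
    · rw [Heap.decrease, Heap.push_cur hi]; simp [hi]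

/-- Passes to the next neighbor, after an update of the heap. -/
def neighborBody : Prog := .block [
  .setNat 8 (.get 5 (.var 9)),
  .cond (.natLe (.lit 1) (.get 6 (.var 8)))
    (.seq (.putRat 2 (.var 8) (.sub (.get 2 (.var 8)) (.get 1 (.var 9)))) decreaseProg) .skip,
  .setNat 9 (.get 4 (.var 9))]

theorem neighborBody_loopFree : neighborBody.LoopFree := by
  simp [neighborBody, decreaseProg, Prog.block, Prog.LoopFree]

theorem neighborBody_maxCost : neighborBody.maxCost ≤ 70 := by decide

section cases
variable (f : ℕ → ℝ) (σ : Store) {h u : ℕ}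

theorem exec_neighbor_dead (hh : σ.nat 9 = h) (hu : σ.natArr 5 h = u)
    (hc : σ.heap.cur u = 0) :
    (neighborBody.exec f σ).heap = σ.heap ∧ (neighborBody.exec f σ).ratArr = σ.ratArr ∧
    (neighborBody.exec f σ).natArr = σ.natArr ∧ (neighborBody.exec f σ).nat 4 = σ.nat 4 ∧
    (neighborBody.exec f σ).nat 9 = σ.natArr 4 h := by
  have hc' : σ.natArr 6 u = 0 := hc
  simp [neighborBody, Prog.block, Prog.exec, NExp.eval, Store.heap, Test.Holds, hh, hu, hc']

theorem exec_neighbor_live (hh : σ.nat 9 = h) (hu : σ.natArr 5 h = u)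
    (hc : σ.heap.cur u ≠ 0) :
    (neighborBody.exec f σ).heap = σ.heap.decrease u (σ.ratArr 2 u - σ.ratArr 1 h) ∧
    (neighborBody.exec f σ).ratArr 2 =
      Function.update (σ.ratArr 2) u (σ.ratArr 2 u - σ.ratArr 1 h) ∧
    (neighborBody.exec f σ).natArr 12 = Function.update (σ.natArr 12) (σ.nat 4) (σ.nat 3 + 1) ∧
    (neighborBody.exec f σ).nat 4 = σ.nat 4 + 1 ∧
    (neighborBody.exec f σ).nat 9 = σ.natArr 4 h := by
  have hc' : 1 ≤ σ.natArr 6 u := Nat.one_le_iff_ne_zero.2 hc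
  simp [neighborBody, decreaseProg, Prog.block, Prog.exec, NExp.eval, QExp.eval, Store.heap,
    Test.Holds, hh, hu, hc', Heap.decrease, Heap.push]

end cases

/-- Subtracts the weights of the edges on the list at variable `9` from the degrees of the items in
the heap. -/
def neighborProg : Prog := .loop (.natLe (.lit 1) (.var 9)) neighborBody

/-- Nonnegative weights turn every subtraction into a legal key decrease. Neighbors that are already
removed are skipped, so their stored degrees become stale and only the degrees of present items are
described. -/
theorem run_neighborProg (f : ℕ → ℝ) {σ : Store} {L : ℕ} (h : σ.Idle L) {l : List (ℕ × ℚ)}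
    (hl : Linked (σ.natArr 4) (σ.natArr 5) (σ.ratArr 1) (σ.nat 9) l) (hpos : ∀ a ∈ l, 0 ≤ a.2) :
    ∃ t τ, Run f neighborProg σ t τ ∧ τ.Idle L ∧
      (∀ i, τ.heap.cur i = 0 ↔ σ.heap.cur i = 0) ∧
      (∀ i, σ.heap.cur i ≠ 0 → τ.ratArr 2 i = σ.ratArr 2 i - weightAt l i) ∧
      τ.size L ≤ σ.size L + l.length ∧
      τ.potential L ≤ σ.potential L + 5 * l.length ∧ t ≤ 80 * l.length + 10 := by
  obtain ⟨t, τ, hrun, ⟨l', i1, i2, i3, i4, i5, i6, i7, i8, i9⟩, hb⟩ := Run.of_invariant (f := f)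
    (b := .natLe (.lit 1) (.var 9)) (p := neighborBody)
    (I := fun t τ => ∃ l', Linked (σ.natArr 4) (σ.natArr 5) (σ.ratArr 1) (τ.nat 9) l' ∧
      Store.AgreeOff neighborBody.writes σ τ ∧ τ.Idle L ∧
      (∀ i, τ.heap.cur i = 0 ↔ σ.heap.cur i = 0) ∧
      (∀ i, σ.heap.cur i ≠ 0 → τ.ratArr 2 i = σ.ratArr 2 i - weightAt l i + weightAt l' i) ∧
      (∀ a ∈ l', 0 ≤ a.2) ∧
      τ.size L + l'.length ≤ σ.size L + l.length ∧
      τ.potential L + 5 * l'.length ≤ σ.potential L + 5 * l.length ∧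
      t + 80 * l'.length ≤ 80 * l.length)
    (80 * l.length)
    (fun t τ ⟨l', hI⟩ => by have := hI.2.2.2.2.2.2.2.2; omega)
    (fun t ρ ⟨l', i1, i2, i3, i4, i5, i6, i7, i8, i9⟩ hb => by
      have hb' : 1 ≤ ρ.nat 9 := hb
      obtain ⟨s, hs, hs'⟩ := Prog.run_exec f neighborBody_loopFree ρ
      have hcost := neighborBody_maxCost
      rcases l' with _ | ⟨a, l'⟩
      · have : ρ.nat 9 = 0 := i1
        omega
      obtain ⟨-, -, k1, k2, k3⟩ := i1
      have n4 : ρ.natArr 4 = σ.natArr 4 := i2.natArr 4 (by decide)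
      have n5 : ρ.natArr 5 = σ.natArr 5 := i2.natArr 5 (by decide)
      have r1 : ρ.ratArr 1 = σ.ratArr 1 := i2.ratArr 1 (by decide)
      have hu : ρ.natArr 5 (ρ.nat 9) = a.1 := by rw [n5, k1]
      have hw : ρ.ratArr 1 (ρ.nat 9) = a.2 := by rw [r1, k2]
      have ha := i6 a (by simp)
      simp only [List.length_cons] at i7 i8 i9
      simp only [weightAt_cons] at i5
      have hag := hs.agreeOff
      have htime : t + ((Test.natLe (.lit 1) (.var 9)).cost + s) + 80 * l'.length
          ≤ 80 * l.length := by
        simp only [Test.cost, NExp.cost]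
        omega
      by_cases hc : ρ.heap.cur a.1 = 0
      · obtain ⟨e1, e2, e3, e4, e5⟩ := exec_neighbor_dead f ρ rfl hu hc
        have h5 := hag.nat 5 (by decide)
        have hroots : (neighborBody.exec f ρ).roots L = ρ.roots L := by
          simp only [Store.roots, Store.stack, Store.slots, e3, e4]
        have hsize : (neighborBody.exec f ρ).size L = ρ.size L := by
          rw [Store.size, hroots, e1]; rfl
        have hpot : (neighborBody.exec f ρ).potential L = ρ.potential L := by
          simp only [Store.potential, hsize, Store.slots, e3, e4]
        refine ⟨s, _, hs, l', by rw [e5, n4]; exact k3, i2.trans hag,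
          ⟨⟨?_, ?_, ?_⟩, ?_⟩, ?_, ?_, fun b hb => i6 b (by simp [hb]), by omega, by omega, htime⟩
        · rw [e1, e2, hroots]; exact i3.ready.inv
        · rw [e1, e3, h5]; exact i3.ready.slot
        · rw [h5]; exact i3.ready.maxr
        · rw [e3]; exact i3.slot
        · rw [e1]; exact i4
        · intro i hi
          rw [e2, i5 i hi, if_neg, zero_add]
          rintro rfl
          exact hi ((i4 _).1 hc)
      · obtain ⟨e1, e2, e3, e4, e5⟩ := exec_neighbor_live f ρ rfl hu hc
        rw [hw] at e1 e2
        obtain ⟨g1, g2, g3, g4⟩ := decrease_step i3 (fun _ => by linarith) e1 e2 e3 e4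
          (hag.natArr 11 (by decide)) (hag.nat 5 (by decide))
        refine ⟨s, _, hs, l', by rw [e5, n4]; exact k3, i2.trans hag, g1, ?_, ?_,
          fun b hb => i6 b (by simp [hb]), by omega, by omega, htime⟩
        · intro i
          rw [g4, ← i4]
          constructor
          · exact fun h => h.2
          · refine fun h => ⟨?_, h⟩
            rintro rfl
            exact hc h
        · intro i hi
          rw [e2, Function.update_apply]
          split_ifs with hia
          · subst hia
            rw [i5 _ hi, if_pos rfl]; ring
          · rw [i5 i hi, if_neg (Ne.symm hia), zero_add])
      (t₀ := 0) (σ := σ)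
      ⟨l, hl, .refl _ _, h, fun _ => Iff.rfl, fun _ _ => by ring, hpos, le_rfl, le_rfl, by omega⟩
  have h90 : τ.nat 9 = 0 := by
    have : ¬ (1 ≤ τ.nat 9) := hb
    omega
  have hl' : l' = [] := by
    rcases l' with _ | ⟨a, l'⟩
    · rfl
    · exact absurd h90 i1.1
  subst hl'
  simp only [weightAt_nil, add_zero, List.length_nil] at i5 i7 i8 i9
  refine ⟨_, τ, hrun, i3, i4, i5, i7, by omega, ?_⟩
  simp only [Test.cost, NExp.cost]
  omega

/-- Links point to smaller entry numbers, so a list with head at most `c` never meets the fresh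
entry `c + 1`. -/
theorem Linked.update {nxt tgt : ℕ → ℕ} {wt : ℕ → ℚ} {c a b : ℕ} {q : ℚ} {l : List (ℕ × ℚ)} {h : ℕ}
    (hl : Linked nxt tgt wt h l) (hh : h ≤ c) :
    Linked (Function.update nxt (c + 1) a) (Function.update tgt (c + 1) b)
      (Function.update wt (c + 1) q) h l := by
  induction l generalizing h with
  | nil => exact hl
  | cons x l ih =>
    obtain ⟨h1, h2, h3, h4, h5⟩ := hl
    have hne : h ≠ c + 1 := by omega
    simp only [Linked, Function.update_of_ne hne]
    exact ⟨h1, h2, h3, h4, ih h5 (by omega)⟩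

-- Reading the edges: adjacency lists, degrees, total weight, heaviest edge

/-- The adjacency lists in memory. -/
structure Store.Adjacency (σ : Store) (l : ℕ → List (ℕ × ℚ)) : Prop where
  linked : ∀ i, Linked (σ.natArr 4) (σ.natArr 5) (σ.ratArr 1) (σ.natArr 3 i) (l i)
  le : ∀ i, σ.natArr 3 i ≤ σ.nat 9
  deg : ∀ i, σ.ratArr 2 i = ((l i).map Prod.snd).sum

/-- Appends an entry to the adjacency list of an endpoint of the current edge. -/
def halfEdgeProg (a b : ℕ) : Prog := .block [
  .setNat 9 (.add (.var 9) (.lit 1)),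
  .putNat 5 (.var 9) (.get b (.var 2)),
  .putRat 1 (.var 9) (.get 0 (.var 2)),
  .putNat 4 (.var 9) (.get 3 (.get a (.var 2))),
  .putNat 3 (.get a (.var 2)) (.var 9),
  .putRat 2 (.get a (.var 2)) (.add (.get 2 (.get a (.var 2))) (.get 0 (.var 2)))]

theorem exec_halfEdgeProg (f : ℕ → ℝ) (σ : Store) {a b : ℕ} (ha : a ≤ 2)
    {l : ℕ → List (ℕ × ℚ)} (h : σ.Adjacency l) :
    ((halfEdgeProg a b).exec f σ).Adjacency (Function.update l (σ.natArr a (σ.nat 2))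
      ((σ.natArr b (σ.nat 2), σ.ratArr 0 (σ.nat 2)) :: l (σ.natArr a (σ.nat 2)))) := by
  have a3 : a ≠ 3 := by omega
  have a4 : a ≠ 4 := by omega
  have a5 : a ≠ 5 := by omega
  have e9 : ((halfEdgeProg a b).exec f σ).nat 9 = σ.nat 9 + 1 := by
    simp [halfEdgeProg, Prog.block, Prog.exec, NExp.eval, QExp.eval]
  have e5 : ((halfEdgeProg a b).exec f σ).natArr 5 =
      Function.update (σ.natArr 5) (σ.nat 9 + 1) (σ.natArr b (σ.nat 2)) := by
    simp [halfEdgeProg, Prog.block, Prog.exec, NExp.eval, QExp.eval]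
  have e1 : ((halfEdgeProg a b).exec f σ).ratArr 1 =
      Function.update (σ.ratArr 1) (σ.nat 9 + 1) (σ.ratArr 0 (σ.nat 2)) := by
    simp [halfEdgeProg, Prog.block, Prog.exec, NExp.eval, QExp.eval]
  have e4 : ((halfEdgeProg a b).exec f σ).natArr 4 =
      Function.update (σ.natArr 4) (σ.nat 9 + 1) (σ.natArr 3 (σ.natArr a (σ.nat 2))) := by
    simp [halfEdgeProg, Prog.block, Prog.exec, NExp.eval, QExp.eval, a5]
  have e3 : ((halfEdgeProg a b).exec f σ).natArr 3 =
      Function.update (σ.natArr 3) (σ.natArr a (σ.nat 2)) (σ.nat 9 + 1) := by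
    simp [halfEdgeProg, Prog.block, Prog.exec, NExp.eval, QExp.eval, a5, a4]
  have e2 : ((halfEdgeProg a b).exec f σ).ratArr 2 =
      Function.update (σ.ratArr 2) (σ.natArr a (σ.nat 2))
        (σ.ratArr 2 (σ.natArr a (σ.nat 2)) + σ.ratArr 0 (σ.nat 2)) := by
    simp [halfEdgeProg, Prog.block, Prog.exec, NExp.eval, QExp.eval, a5, a4, a3]
  refine ⟨fun i => ?_, fun i => ?_, fun i => ?_⟩
  · rw [e5, e1, e4, e3]
    by_cases hi : i = σ.natArr a (σ.nat 2)
    · subst hi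
      simp only [Function.update_self, Linked]
      have := h.le (σ.natArr a (σ.nat 2))
      exact ⟨by omega, by omega, trivial, trivial, (h.linked _).update this⟩
    · rw [Function.update_of_ne hi, Function.update_of_ne hi]
      exact (h.linked i).update (h.le i)
  · rw [e3, e9, Function.update_apply]
    have := h.le i
    split_ifs <;> omega
  · rw [e2]
    by_cases hi : i = σ.natArr a (σ.nat 2)
    · subst hi
      simp [h.deg, add_comm]
    · rw [Function.update_of_ne hi, Function.update_of_ne hi]
      exact h.deg i

/-- The adjacency lists after the first `k` edges. -/
def adjList (e₀ e₁ : ℕ → ℕ) (w : ℕ → ℚ) : ℕ → ℕ → List (ℕ × ℚ)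
  | 0 => fun _ => []
  | k + 1 =>
    let l := Function.update (adjList e₀ e₁ w k) (e₀ k) ((e₁ k, w k) :: adjList e₀ e₁ w k (e₀ k))
    Function.update l (e₁ k) ((e₀ k, w k) :: l (e₁ k))

/-- The function g is arbitrary so that one identity later provides the degrees, the weight between
two given vertices and the lengths of the lists. -/
theorem sum_adjList {M : Type*} [AddCommMonoid M] (e₀ e₁ : ℕ → ℕ) (w : ℕ → ℚ) (g : ℕ × ℚ → M)
    (k i : ℕ) : ((adjList e₀ e₁ w k i).map g).sum =
      ∑ j ∈ Finset.range k, ((if e₀ j = i then g (e₁ j, w j) else 0) +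
        if e₁ j = i then g (e₀ j, w j) else 0) := by
  induction k with
  | zero => simp [adjList]
  | succ k ih =>
    rw [Finset.sum_range_succ, ← ih]
    simp only [adjList]
    by_cases h0 : e₀ k = i <;> by_cases h1 : e₁ k = i
    · subst h0
      simp only [h1, Function.update_self, List.map_cons, List.sum_cons, if_true]
      abel
    · subst h0
      rw [Function.update_of_ne (Ne.symm h1), Function.update_self]
      simp only [List.map_cons, List.sum_cons, if_true, h1, if_false]
      abel
    · subst h1
      rw [Function.update_self, Function.update_of_ne (Ne.symm h0)]
      simp only [List.map_cons, List.sum_cons, if_true, h0, if_false]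
      abel
    · rw [Function.update_of_ne (Ne.symm h1), Function.update_of_ne (Ne.symm h0)]
      simp [h0, h1]

/-- Reads an edge. -/
def edgeBody : Prog := .seq (halfEdgeProg 0 1) (.seq (halfEdgeProg 1 0) (.block [
  .setRat 0 (.add (.var 0) (.get 0 (.var 2))),
  .cond (.ratLe (.get 0 (.var 2)) (.get 0 (.var 13))) .skip (.setNat 13 (.var 2)),
  .setNat 2 (.add (.var 2) (.lit 1))]))

theorem edgeBody_loopFree : edgeBody.LoopFree := by
  simp [edgeBody, halfEdgeProg, Prog.block, Prog.LoopFree]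

theorem edgeBody_maxCost : edgeBody.maxCost ≤ 100 := by decide

theorem Store.Adjacency.congr {σ τ : Store} {l : ℕ → List (ℕ × ℚ)} (h : σ.Adjacency l)
    (h₁ : τ.natArr = σ.natArr) (h₂ : τ.ratArr = σ.ratArr) (h₃ : τ.nat 9 = σ.nat 9) :
    τ.Adjacency l := by
  obtain ⟨a, b, c⟩ := h
  exact ⟨by rw [h₁, h₂]; exact a, by rw [h₁, h₃]; exact b, by rw [h₂]; exact c⟩

theorem exec_edgeBody (f : ℕ → ℝ) (σ : Store) {l : ℕ → List (ℕ × ℚ)} (h : σ.Adjacency l) :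
    (edgeBody.exec f σ).Adjacency
      (let l' := Function.update l (σ.natArr 0 (σ.nat 2))
        ((σ.natArr 1 (σ.nat 2), σ.ratArr 0 (σ.nat 2)) :: l (σ.natArr 0 (σ.nat 2)))
      Function.update l' (σ.natArr 1 (σ.nat 2))
        ((σ.natArr 0 (σ.nat 2), σ.ratArr 0 (σ.nat 2)) :: l' (σ.natArr 1 (σ.nat 2)))) ∧
    (edgeBody.exec f σ).rat 0 = σ.rat 0 + σ.ratArr 0 (σ.nat 2) ∧
    (edgeBody.exec f σ).nat 2 = σ.nat 2 + 1 ∧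
    (((edgeBody.exec f σ).nat 13 = σ.nat 13 ∧
        σ.ratArr 0 (σ.nat 2) ≤ σ.ratArr 0 (σ.nat 13)) ∨
      ((edgeBody.exec f σ).nat 13 = σ.nat 2 ∧
        σ.ratArr 0 (σ.nat 13) ≤ σ.ratArr 0 (σ.nat 2))) := by
  have h1 := exec_halfEdgeProg f σ (a := 0) (b := 1) (by omega) h
  have h2 := exec_halfEdgeProg f _ (a := 1) (b := 0) (by omega) h1
  have lf : ∀ a b, (halfEdgeProg a b).LoopFree := by
    intro a b; simp [halfEdgeProg, Prog.block, Prog.LoopFree]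
  have g1 := Prog.agreeOff_exec f (lf 0 1) σ
  set ρ := (halfEdgeProg 0 1).exec f σ
  have g2 := g1.trans (Prog.agreeOff_exec f (lf 1 0) ρ)
  set τ := (halfEdgeProg 1 0).exec f ρ with hτ
  rw [g1.natArr 0 (by decide), g1.natArr 1 (by decide), g1.ratArr 0 (by decide),
    g1.nat 2 (by decide)] at h2
  have q0 : τ.ratArr 0 = σ.ratArr 0 := g2.ratArr 0 (by decide)
  have v0 : τ.rat 0 = σ.rat 0 := g2.rat 0 (by decide)
  have n2 : τ.nat 2 = σ.nat 2 := g2.nat 2 (by decide)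
  have n13 : τ.nat 13 = σ.nat 13 := g2.nat 13 (by decide)
  have e : edgeBody.exec f σ = Prog.exec f (.block [
    .setRat 0 (.add (.var 0) (.get 0 (.var 2))),
    .cond (.ratLe (.get 0 (.var 2)) (.get 0 (.var 13))) .skip (.setNat 13 (.var 2)),
    .setNat 2 (.add (.var 2) (.lit 1))]) τ := rfl
  rw [e]
  refine ⟨?_, ?_⟩
  · by_cases hle : σ.ratArr 0 (σ.nat 2) ≤ σ.ratArr 0 (σ.nat 13) <;>
      refine h2.congr ?_ ?_ ?_ <;>
      simp [Prog.block, Prog.exec, NExp.eval, QExp.eval, Test.Holds, q0, v0, n2, n13, hle]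
  · by_cases hle : σ.ratArr 0 (σ.nat 2) ≤ σ.ratArr 0 (σ.nat 13)
    · simp [Prog.block, Prog.exec, NExp.eval, QExp.eval, Test.Holds, q0, v0, n2, n13, hle]
    · simp [Prog.block, Prog.exec, NExp.eval, QExp.eval, Test.Holds, q0, v0, n2, n13, hle,
        (not_le.1 hle).le]

/-- Reads all edges. -/
def edgesProg : Prog := .loop (.not (.natLe (.var 1) (.var 2))) edgeBody

theorem run_edgesProg (f : ℕ → ℝ) {σ : Store} (h : σ.Adjacency fun _ => []) (h2 : σ.nat 2 = 0)
    (h13 : σ.nat 13 = 0) (h0 : σ.rat 0 = 0) (hm : 1 ≤ σ.nat 1) :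
    ∃ t τ, Run f edgesProg σ t τ ∧
      τ.Adjacency (adjList (σ.natArr 0) (σ.natArr 1) (σ.ratArr 0) (σ.nat 1)) ∧
      τ.rat 0 = ∑ j ∈ Finset.range (σ.nat 1), σ.ratArr 0 j ∧
      τ.nat 13 < σ.nat 1 ∧ (∀ j < σ.nat 1, σ.ratArr 0 j ≤ σ.ratArr 0 (τ.nat 13)) ∧
      t ≤ 110 * σ.nat 1 + 10 := by
  obtain ⟨t, τ, hrun, ⟨i1, i2, i3, i4, i5, i6, i7⟩, hb⟩ := Run.of_invariant (f := f)
    (b := .not (.natLe (.var 1) (.var 2))) (p := edgeBody)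
    (I := fun t τ => Store.AgreeOff edgeBody.writes σ τ ∧
      τ.Adjacency (adjList (σ.natArr 0) (σ.natArr 1) (σ.ratArr 0) (τ.nat 2)) ∧
      τ.rat 0 = ∑ j ∈ Finset.range (τ.nat 2), σ.ratArr 0 j ∧ τ.nat 13 < σ.nat 1 ∧
      (∀ j < τ.nat 2, σ.ratArr 0 j ≤ σ.ratArr 0 (τ.nat 13)) ∧ τ.nat 2 ≤ σ.nat 1 ∧
      t ≤ 110 * τ.nat 2)
    (110 * σ.nat 1)
    (fun t τ ⟨_, _, _, _, _, i6, i7⟩ => by omega)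
    (fun t ρ ⟨i1, i2, i3, i4, i5, i6, i7⟩ hb => by
      have hb' : ¬ (ρ.nat 1 ≤ ρ.nat 2) := hb
      obtain ⟨s, hs, hs'⟩ := Prog.run_exec f edgeBody_loopFree ρ
      have hcost := edgeBody_maxCost
      obtain ⟨e1, e2, e3, e4⟩ := exec_edgeBody f ρ i2
      have n1 : ρ.nat 1 = σ.nat 1 := i1.nat 1 (by decide)
      have a0 : ρ.natArr 0 = σ.natArr 0 := i1.natArr 0 (by decide)
      have a1 : ρ.natArr 1 = σ.natArr 1 := i1.natArr 1 (by decide)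
      have r0 : ρ.ratArr 0 = σ.ratArr 0 := i1.ratArr 0 (by decide)
      rw [a0, a1, r0] at e1
      rw [r0] at e2 e4
      refine ⟨s, _, hs, i1.trans hs.agreeOff, ?_, ?_, ?_, ?_, by omega, ?_⟩
      · rw [e3]; exact e1
      · rw [e2, e3, Finset.sum_range_succ, i3]
      · rcases e4 with e4 | e4 <;> omega
      · intro j hj
        rw [e3] at hj
        rcases e4 with ⟨e4, e5⟩ | ⟨e4, e5⟩
        · rw [e4]
          rcases Nat.lt_succ_iff_lt_or_eq.1 hj with hj | rfl
          exacts [i5 j hj, e5]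
        · rw [e4]
          rcases Nat.lt_succ_iff_lt_or_eq.1 hj with hj | rfl
          exacts [(i5 j hj).trans e5, le_rfl]
      · rw [e3]
        simp only [Test.cost, NExp.cost]
        omega)
      (t₀ := 0) (σ := σ)
      ⟨.refl _ _, by rw [h2]; exact h, by simp [h2, h0], by omega, by simp [h2], by omega, by omega⟩
  have hb' : ¬ ¬ (τ.nat 1 ≤ τ.nat 2) := hb
  have n1 : τ.nat 1 = σ.nat 1 := i1.nat 1 (by decide)
  have hk : τ.nat 2 = σ.nat 1 := by omega
  rw [hk] at i2 i3 i5 i7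
  refine ⟨_, τ, hrun, i2, i3, i4, i5, ?_⟩
  simp only [Test.cost, NExp.cost]
  omega

-- Filling the heap

/-- Inserts an item. -/
def insertBody : Prog :=
  .seq (.setNat 8 (.var 2)) (.seq decreaseProg (.setNat 2 (.add (.var 2) (.lit 1))))

theorem insertBody_loopFree : insertBody.LoopFree := by
  simp [insertBody, decreaseProg, Prog.block, Prog.LoopFree]

theorem insertBody_maxCost : insertBody.maxCost ≤ 60 := by decide

theorem exec_insertBody (f : ℕ → ℝ) (σ : Store) :
    (insertBody.exec f σ).heap = σ.heap.decrease (σ.nat 2) (σ.ratArr 2 (σ.nat 2)) ∧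
    (insertBody.exec f σ).natArr 12 = Function.update (σ.natArr 12) (σ.nat 4) (σ.nat 3 + 1) ∧
    (insertBody.exec f σ).nat 4 = σ.nat 4 + 1 ∧ (insertBody.exec f σ).nat 2 = σ.nat 2 + 1 := by
  simp [insertBody, decreaseProg, Prog.block, Prog.exec, NExp.eval, QExp.eval, Store.heap,
    Heap.decrease, Heap.push]

/-- Inserts all items. -/
def insertProg : Prog := .seq (.setNat 2 (.lit 0))
  (.loop (.not (.natLe (.var 0) (.var 2))) insertBody)

theorem run_insertProg (f : ℕ → ℝ) {σ : Store} {L : ℕ} (h : σ.Idle L)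
    (hc : ∀ i, σ.heap.cur i = 0) :
    ∃ t τ, Run f insertProg σ t τ ∧ τ.Idle L ∧ (∀ i, τ.heap.cur i = 0 ↔ σ.nat 0 ≤ i) ∧
      τ.size L = σ.size L + σ.nat 0 ∧ τ.potential L = σ.potential L + 5 * σ.nat 0 ∧
      t ≤ 80 * σ.nat 0 + 10 := by
  set σ₁ := σ.setNat 2 0 with hσ₁
  have hidle : σ₁.Idle L := ⟨⟨h.ready.inv, h.ready.slot, h.ready.maxr⟩, h.slot⟩
  obtain ⟨t, τ, hrun, ⟨i1, i2, i3, i4, i5, i6, i7⟩, hb⟩ := Run.of_invariant (f := f)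
    (b := .not (.natLe (.var 0) (.var 2))) (p := insertBody)
    (I := fun t τ => Store.AgreeOff insertBody.writes σ₁ τ ∧ τ.Idle L ∧
      (∀ i, τ.heap.cur i = 0 ↔ τ.nat 2 ≤ i) ∧ τ.nat 2 ≤ σ.nat 0 ∧
      τ.size L = σ.size L + τ.nat 2 ∧ τ.potential L = σ.potential L + 5 * τ.nat 2 ∧
      t ≤ 80 * τ.nat 2)
    (80 * σ.nat 0)
    (fun t τ ⟨_, _, _, _, _, i6, i7⟩ => by omega)
    (fun t ρ ⟨i1, i2, i3, i4, i5, i6, i7⟩ hb => by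
      have hb' : ¬ (ρ.nat 0 ≤ ρ.nat 2) := hb
      obtain ⟨s, hs, hs'⟩ := Prog.run_exec f insertBody_loopFree ρ
      have hcost := insertBody_maxCost
      obtain ⟨e1, e2, e3, e4⟩ := exec_insertBody f ρ
      have n0 : ρ.nat 0 = σ.nat 0 := i1.nat 0 (by decide)
      have hag := hs.agreeOff
      obtain ⟨g1, g2, g3, g4⟩ := decrease_step i2 (fun _ => le_rfl) e1
        -- An insertion is a key decrease of an absent item whose key already stands in the degree
        -- array, so that array does not change.
        (by rw [Function.update_eq_self]; exact hag.ratArr 2 (by decide)) e2 e3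
        (hag.natArr 11 (by decide)) (hag.nat 5 (by decide))
      refine ⟨s, _, hs, i1.trans hag, g1, ?_, by omega, by omega, by omega, ?_⟩
      · intro i
        rw [g4, i3, e4]
        omega
      · rw [e4]
        simp only [Test.cost, NExp.cost]
        omega)
      (t₀ := 0) (σ := σ₁)
      ⟨.refl _ _, hidle, fun i => by
        have h2 : σ₁.nat 2 = 0 := rfl
        rw [h2]; exact iff_of_true (hc i) (Nat.zero_le _), by simp [hσ₁],
        by simp [hσ₁]; rfl, by simp [hσ₁]; rfl, by omega⟩
  have hb' : ¬ ¬ (τ.nat 0 ≤ τ.nat 2) := hb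
  have n1 : τ.nat 0 = σ.nat 0 := i1.nat 0 (by decide)
  have hk : τ.nat 2 = σ.nat 0 := by omega
  rw [hk] at i3 i5 i6 i7
  refine ⟨_, τ, .seq (.setNat _ _ _) hrun, i2, i3, i5, i6, ?_⟩
  simp only [Test.cost, NExp.cost]
  omega

-- Degrees, induced weights and sums over edge lists

theorem weightedDegree_erase {V : Type*} [DecidableEq V] {G : SimpleGraph V} [DecidableRel G.Adj]
    {w : Sym2 V → ℚ} {S : Finset V} {v : V} (hv : v ∈ S) (u : V) :
    weightedDegree G w (S.erase v) u =
      weightedDegree G w S u - if G.Adj v u then w s(v, u) else 0 := by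
  rw [eq_sub_iff_add_eq]
  unfold weightedDegree
  rw [Finset.filter_erase]
  split_ifs with h
  · rw [Sym2.eq_swap]
    exact Finset.sum_erase_add _ _ (by simp [hv, h.symm])
  · rw [add_zero, Finset.erase_eq_of_notMem]
    simp only [Finset.mem_filter, not_and]
    exact fun _ h' => h h'.symm

section Graph
variable {V : Type*} [Fintype V] [DecidableEq V] {G : SimpleGraph V} [DecidableRel G.Adj]
  {w : Sym2 V → ℚ}

theorem weightedDegree_eq_sum_edges {S : Finset V} {v : V} (hv : v ∈ S) :
    weightedDegree G w S v = ∑ e ∈ G.edgeFinset with (∀ u ∈ e, u ∈ S) ∧ v ∈ e, w e := by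
  unfold weightedDegree
  refine Finset.sum_bij (fun u _ => s(v, u)) ?_ ?_ ?_ ?_
  · intro u hu
    simp only [Finset.mem_filter] at hu
    simp [hu.1, hu.2, hv]
  · intro a _ b _ h
    exact (Sym2.congr_right).1 h
  · intro e he
    simp only [Finset.mem_filter, SimpleGraph.mem_edgeFinset] at he
    obtain ⟨h1, h2, h3⟩ := he
    obtain ⟨u, rfl⟩ := h3
    refine ⟨u, ?_, rfl⟩
    simp only [Finset.mem_filter]
    exact ⟨h2 u (by simp), h1⟩
  · intro _ _; rfl

theorem inducedWeight_erase {S : Finset V} {v : V} (hv : v ∈ S) :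
    inducedWeight G w (S.erase v) = inducedWeight G w S - weightedDegree G w S v := by
  rw [eq_sub_iff_add_eq, weightedDegree_eq_sum_edges hv]
  unfold inducedWeight
  rw [← Finset.sum_union]
  · refine Finset.sum_congr ?_ fun _ _ => rfl
    ext e
    simp only [Finset.mem_union, Finset.mem_filter, Finset.mem_erase]
    constructor
    · rintro (⟨h1, h2⟩ | ⟨h1, h2, h3⟩)
      · exact ⟨h1, fun u hu => (h2 u hu).2⟩
      · exact ⟨h1, h2⟩
    · rintro ⟨h1, h2⟩
      by_cases h : v ∈ e
      · exact Or.inr ⟨h1, h2, h⟩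
      · exact Or.inl ⟨h1, fun u hu => ⟨by rintro rfl; exact h hu, h2 u hu⟩⟩
  · rw [Finset.disjoint_left]
    intro e he he'
    simp only [Finset.mem_filter, Finset.mem_erase] at he he'
    exact (he.2 v he'.2.2).1 rfl

theorem sum_weightedDegree (S : Finset V) :
    ∑ v ∈ S, weightedDegree G w S v = 2 * inducedWeight G w S := by
  rw [Finset.sum_congr rfl fun v hv => weightedDegree_eq_sum_edges hv]
  simp_rw [← Finset.filter_filter, Finset.sum_filter (fun e => _ ∈ e)]
  rw [Finset.sum_comm, inducedWeight, Finset.mul_sum]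
  refine Finset.sum_congr rfl fun e he => ?_
  simp only [Finset.mem_filter, SimpleGraph.mem_edgeFinset] at he
  rw [← Finset.sum_filter, Finset.sum_const]
  have : S.filter (fun v => v ∈ e) = e.toFinset := by
    ext v
    simp only [Finset.mem_filter, Sym2.mem_toFinset]
    exact ⟨fun h => h.2, fun h => ⟨he.2 v h, h⟩⟩
  rw [this, Sym2.card_toFinset_of_not_isDiag _ (G.not_isDiag_of_mem_edgeSet he.1)]
  simp

end Graph

theorem IsEdgeList.adj {V : Type*} {G : SimpleGraph V} {m : ℕ} {edge : Fin m → V × V}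
    (h : IsEdgeList G edge) (k : Fin m) : G.Adj (edge k).1 (edge k).2 := by
  have : s((edge k).1, (edge k).2) ∈ G.edgeSet := by
    rw [← h.2]; exact ⟨k, rfl⟩
  exact this

theorem IsEdgeList.sum_edges {V : Type*} [Fintype V] {G : SimpleGraph V} [DecidableRel G.Adj]
    {m : ℕ} {edge : Fin m → V × V} {M : Type*} [AddCommMonoid M]
    (h : IsEdgeList G edge) (g : Sym2 V → M) :
    ∑ k, g s((edge k).1, (edge k).2) = ∑ e ∈ G.edgeFinset, g e := by
  refine Finset.sum_bij (fun k _ => s((edge k).1, (edge k).2)) ?_ ?_ ?_ fun _ _ => rfl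
  · intro k _
    rw [SimpleGraph.mem_edgeFinset]
    exact h.adj k
  · intro a _ b _ hab; exact h.1 hab
  · intro e he
    rw [SimpleGraph.mem_edgeFinset, ← h.2] at he
    obtain ⟨k, hk⟩ := he
    exact ⟨k, Finset.mem_univ _, hk⟩

section EdgeList
variable {V : Type*} [Fintype V] [DecidableEq V] {G : SimpleGraph V} [DecidableRel G.Adj]
  {m : ℕ} {edge : Fin m → V × V}

/-- Double counting of pairs of an edge and a neighbor of v. In a simple graph v is at most one of
the two endpoints, so each listed edge contributes at most one summand, whatever its orientation. -/
theorem IsEdgeList.sum_neighbors {M : Type*} [AddCommMonoid M] (h : IsEdgeList G edge)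
    (g : V → Sym2 V → M) (v : V) :
    ∑ k, ((if (edge k).1 = v then g (edge k).2 s((edge k).1, (edge k).2) else 0) +
      if (edge k).2 = v then g (edge k).1 s((edge k).1, (edge k).2) else 0) =
      ∑ u with G.Adj v u, g u s(v, u) := by
  have key := (h.sum_edges (fun e => ∑ u with G.Adj v u, if s(v, u) = e then g u e else 0)).symm
  rw [Finset.sum_comm] at key
  rw [Finset.sum_congr rfl (g := fun u => g u s(v, u))] at key
  · rw [key]
    refine Finset.sum_congr rfl fun k _ => ?_
    have hadj := h.adj k
    generalize (edge k).1 = a at *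
    generalize (edge k).2 = b at *
    have hab := hadj.ne
    by_cases ha : a = v
    · subst ha
      rw [if_pos rfl, if_neg hab.symm, add_zero, Finset.sum_eq_single b]
      · simp
      · intro u _ hu
        rw [if_neg]
        intro h'
        exact hu (Sym2.congr_right.1 h')
      · intro hb; simp [hadj] at hb
    · by_cases hb : b = v
      · subst hb
        rw [if_neg ha, if_pos rfl, zero_add, Finset.sum_eq_single a]
        · rw [if_pos Sym2.eq_swap]
        · intro u _ hu
          rw [if_neg]
          intro h'
          rw [Sym2.eq_swap] at h'
          exact hu (Sym2.congr_left.1 h')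
        · intro hb; simp [hadj.symm] at hb
      · rw [if_neg ha, if_neg hb, add_zero, Finset.sum_eq_zero]
        intro u _
        rw [if_neg]
        intro h'
        have : v ∈ s(a, b) := by rw [← h']; simp
        simp only [Sym2.mem_iff] at this
        rcases this with rfl | rfl
        exacts [ha rfl, hb rfl]
  · intro u hu
    rw [Finset.sum_eq_single s(v, u)]
    · simp
    · intro e _ he; rw [if_neg he.symm]
    · intro he
      simp only [Finset.mem_filter, Finset.mem_univ, true_and] at hu
      simp [hu] at he

end EdgeList

/-- The adjacency lists which are built from the input. -/
def inputAdj {V : Type*} {n m : ℕ} (ι : V ≃ Fin n) (w : Sym2 V → ℚ) (edge : Fin m → V × V) :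
    ℕ → List (ℕ × ℚ) :=
  adjList ((inputStore ι w edge).natArr 0) ((inputStore ι w edge).natArr 1)
    ((inputStore ι w edge).ratArr 0) m

/-- Needed for the updates during peeling to be key decreases. -/
theorem inputAdj_pos {V : Type*} {G : SimpleGraph V} {n m : ℕ} {ι : V ≃ Fin n} {w : Sym2 V → ℚ}
    {edge : Fin m → V × V} (h : IsEdgeList G edge) (hw : ∀ e ∈ G.edgeSet, 0 < w e) (i : ℕ) :
    ∀ a ∈ inputAdj ι w edge i, 0 ≤ a.2 := by
  have key : ∀ k ≤ m, ∀ i, ∀ a ∈ adjList ((inputStore ι w edge).natArr 0)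
      ((inputStore ι w edge).natArr 1) ((inputStore ι w edge).ratArr 0) k i, 0 ≤ a.2 := by
    intro k
    induction k with
    | zero => simp [adjList]
    | succ k ih =>
      intro hk i a ha
      have ih := ih (by omega)
      have hq : 0 ≤ (inputStore ι w edge).ratArr 0 k := by
        simp only [inputStore, dif_pos (show k < m by omega), if_true]
        exact (hw _ (h.adj ⟨k, by omega⟩)).le
      simp only [adjList, Function.update_apply] at ha
      split_ifs at ha
      all_goals try simp only [List.mem_cons] at ha
      all_goals first
        | exact ih _ a ha
        | (rcases ha with rfl | ha
           · exact hq
           · first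
             | exact ih _ a ha
             | (rcases ha with rfl | ha
                · exact hq
                · exact ih _ a ha))
  exact key m le_rfl i

section InputAdj
variable {V : Type*} [Fintype V] [DecidableEq V] {G : SimpleGraph V} [DecidableRel G.Adj]
  {n m : ℕ} {ι : V ≃ Fin n} {w : Sym2 V → ℚ} {edge : Fin m → V × V}

theorem sum_inputAdj {M : Type*} [AddCommMonoid M] (h : IsEdgeList G edge) (g : ℕ × ℚ → M) (v : V) :
    ((inputAdj ι w edge (ι v)).map g).sum = ∑ u with G.Adj v u, g (ι u, w s(v, u)) := by
  rw [inputAdj, sum_adjList, Finset.sum_range,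
    ← h.sum_neighbors (fun u e => g ((ι u : ℕ), w e))]
  refine Finset.sum_congr rfl fun k _ => ?_
  simp [inputStore, Fin.val_inj]

theorem weightAt_inputAdj (h : IsEdgeList G edge) (v u : V) :
    weightAt (inputAdj ι w edge (ι v)) (ι u) = if G.Adj v u then w s(v, u) else 0 := by
  rw [weightAt, sum_inputAdj h]
  simp only [Fin.val_inj, EmbeddingLike.apply_eq_iff_eq]
  rw [Finset.sum_ite_eq']
  simp

theorem deg_inputAdj (h : IsEdgeList G edge) (v : V) :
    ((inputAdj ι w edge (ι v)).map Prod.snd).sum = weightedDegree G w Finset.univ v := by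
  rw [sum_inputAdj h, weightedDegree]

theorem length_inputAdj (h : IsEdgeList G edge) (v : V) :
    (inputAdj ι w edge (ι v)).length = G.degree v := by
  have := sum_inputAdj (ι := ι) (w := w) h (fun _ => 1) v
  simpa [← SimpleGraph.card_neighborFinset_eq_degree, SimpleGraph.neighborFinset_eq_filter]
    using this

theorem sum_input_weights (h : IsEdgeList G edge) :
    ∑ j ∈ Finset.range m, (inputStore ι w edge).ratArr 0 j = inducedWeight G w Finset.univ := by
  rw [Finset.sum_range, inducedWeight, Finset.filter_true_of_mem (by simp), ← h.sum_edges]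
  refine Finset.sum_congr rfl fun k _ => ?_
  simp [inputStore]

end InputAdj
-- Greedy peeling on the machine
/-- Compares the density of the current set with the best density. -/
def compareProg : Prog := .cond (.sizeLe (.var 0) (.var 11) (.var 1) (.var 10)) .skip
  (.seq (.setRat 1 (.var 0)) (.setNat 11 (.var 10)))

/-- Records the removal of the item in variable `8`. -/
def recordProg : Prog := .seq (.putNat 13 (.var 8) (.var 10))
  (.seq (.setRat 0 (.sub (.var 0) (.get 2 (.var 8)))) (.setNat 9 (.get 3 (.var 8))))

/-- One round of greedy peeling. -/
def peelBody : Prog := .seq compareProg (.seq deleteMinProg (.seq recordProg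
  (.seq neighborProg (.setNat 10 (.sub (.var 10) (.lit 1))))))

/-- The vertices which are present when `i` vertices are left. -/
def level {V : Type*} [Fintype V] {n : ℕ} (ι : V ≃ Fin n) (r : ℕ → ℕ) (i : ℕ) : Finset V :=
  {v : V | r (ι v) ≤ i}

theorem mem_level {V : Type*} [Fintype V] {n : ℕ} (ι : V ≃ Fin n) {r : ℕ → ℕ} {i : ℕ} {v : V} :
    v ∈ level ι r i ↔ r (ι v) ≤ i := by simp [level]

section
variable {V : Type*} [Fintype V] [DecidableEq V] (G : SimpleGraph V) [DecidableRel G.Adj]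
  (w : Sym2 V → ℚ) (f : ℕ → ℝ) (ι : V ≃ Fin (Fintype.card V)) (adj : ℕ → List (ℕ × ℚ)) (L N : ℕ)

/-- The number of unprocessed half-edges. -/
def pending (r : ℕ → ℕ) (i : ℕ) : ℕ := ∑ v ∈ level ι r i, (adj (ι v)).length

/-- The part of the invariant of greedy peeling which concerns the heap and the graph. -/
structure PeelGraph (σ : Store) : Prop where
  idle : σ.Idle L
  linked : ∀ i, Linked (σ.natArr 4) (σ.natArr 5) (σ.ratArr 1) (σ.natArr 3 i) (adj i)
  cur : ∀ v, σ.heap.cur (ι v) = 0 ↔ v ∉ level ι (σ.natArr 13) (σ.nat 10)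
  cur_ge : ∀ i, Fintype.card V ≤ i → σ.heap.cur i = 0
  removed : ∀ v, σ.natArr 13 (ι v) = 0 ∨
    σ.nat 10 < σ.natArr 13 (ι v) ∧ σ.natArr 13 (ι v) ≤ Fintype.card V
  deg : ∀ v ∈ level ι (σ.natArr 13) (σ.nat 10),
    σ.ratArr 2 (ι v) = weightedDegree G w (level ι (σ.natArr 13) (σ.nat 10)) v
  weight : σ.rat 0 = inducedWeight G w (level ι (σ.natArr 13) (σ.nat 10))
  size_le : σ.nat 10 ≤ Fintype.card V
  card : ∀ i, σ.nat 10 ≤ i → i ≤ Fintype.card V → (level ι (σ.natArr 13) i).card = i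
  peel : ∀ i, σ.nat 10 < i → i ≤ Fintype.card V → ∃ v ∈ level ι (σ.natArr 13) i,
    (∀ u ∈ level ι (σ.natArr 13) i, weightedDegree G w (level ι (σ.natArr 13) i) v ≤
      weightedDegree G w (level ι (σ.natArr 13) i) u) ∧
    level ι (σ.natArr 13) (i - 1) = (level ι (σ.natArr 13) i).erase v
  count : σ.size L + pending ι adj (σ.natArr 13) (σ.nat 10) ≤ N

/-- The part of the invariant of greedy peeling which concerns the best set among those of
more than `s` vertices. -/
structure PeelBest (s : ℕ) (σ : Store) : Prop where
  two_le : 2 ≤ σ.nat 11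
  ge : σ.nat 10 ≤ σ.nat 11
  le : σ.nat 11 ≤ Fintype.card V
  weight : σ.rat 1 = inducedWeight G w (level ι (σ.natArr 13) (σ.nat 11))
  max : ∀ i, s < i → i ≤ Fintype.card V → fDensity G w f (level ι (σ.natArr 13) i) ≤
    fDensity G w f (level ι (σ.natArr 13) (σ.nat 11))

variable {G w f ι adj L N}

/-- The machine can only compare products p·f(i) and q·f(j), so densities are compared after
cross-multiplication. From two vertices on f is positive; smaller sets are never compared by the
program. -/
theorem fDensity_le_iff (hf : ∀ k, 2 ≤ k → 0 < f k) {S T : Finset V} (hS : 2 ≤ S.card)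
    (hT : 2 ≤ T.card) : fDensity G w f S ≤ fDensity G w f T ↔
      (inducedWeight G w S : ℝ) * f T.card ≤ (inducedWeight G w T : ℝ) * f S.card := by
  rw [fDensity, fDensity, div_le_div_iff₀ (hf _ hS) (hf _ hT)]

theorem run_compareProg (hf : ∀ k, 2 ≤ k → 0 < f k) {σ : Store}
    (h : PeelGraph G w ι adj L N σ) (hb : PeelBest G w f ι (σ.nat 10) σ) (hs : 2 ≤ σ.nat 10) :
    ∃ t τ, Run f compareProg σ t τ ∧ PeelGraph G w ι adj L N τ ∧
      PeelBest G w f ι (σ.nat 10 - 1) τ ∧ τ.potential L = σ.potential L ∧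
      τ.nat 10 = σ.nat 10 ∧ τ.natArr 13 = σ.natArr 13 ∧ t ≤ 20 := by
  have hcs := h.card _ le_rfl h.size_le
  have hcb := h.card _ hb.ge hb.le
  have hiff := fDensity_le_iff (G := G) (w := w) hf (S := level ι (σ.natArr 13) (σ.nat 10))
    (T := level ι (σ.natArr 13) (σ.nat 11)) (by omega) (by rw [hcb]; exact hb.two_le)
  rw [hcs, hcb, ← h.weight, ← hb.weight] at hiff
  by_cases hc : (σ.rat 0 : ℝ) * f (σ.nat 11) ≤ (σ.rat 1 : ℝ) * f (σ.nat 10)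
  · refine ⟨_, σ, .condTrue hc (.skip σ), h, ⟨hb.two_le, hb.ge, hb.le, hb.weight, ?_⟩, rfl, rfl,
      rfl, by simp [Test.cost, NExp.cost, QExp.cost]⟩
    intro i hi hin
    rcases Nat.lt_or_ge (σ.nat 10) i with hi' | hi'
    · exact hb.max i hi' hin
    · have : i = σ.nat 10 := by omega
      rw [this]; exact hiff.2 hc
  · refine ⟨_, _, .condFalse hc (.seq (.setRat _ _ _) (.setNat _ _ _)), ?_, ⟨?_, ?_, ?_, ?_, ?_⟩,
      rfl, rfl, rfl, by simp [Test.cost, NExp.cost, QExp.cost]⟩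
    · obtain ⟨⟨⟨a1, a2, a3⟩, a4⟩, b, c, d, e, g, k, l, m, n, o⟩ := h
      exact ⟨⟨⟨a1, a2, a3⟩, a4⟩, b, c, d, e, g, k, l, m, n, o⟩
    · simpa [NExp.eval] using hs
    · simp [NExp.eval]
    · simpa [NExp.eval] using h.size_le
    · simpa [NExp.eval, QExp.eval] using h.weight
    · have hle := (not_le.1 (fun h' => hc (hiff.1 h'))).le
      intro i hi hin
      simp only [NExp.eval, QExp.eval, Store.setNat_nat, Store.setNat_natArr, Store.setRat_natArr,
        Store.setRat_nat, if_true]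
      rcases Nat.lt_or_ge (σ.nat 10) i with hi' | hi'
      · exact (hb.max i hi' hin).trans hle
      · have : i = σ.nat 10 := by omega
        rw [this]

/-- Marking v with the number s of vertices present at its removal takes v out of the levels below s
only. The sets already recorded are untouched. -/
theorem level_update {r : ℕ → ℕ} {s : ℕ} {v : V} (hs : 1 ≤ s) (hv : r (ι v) = 0)
    (hr : ∀ u, r (ι u) = 0 ∨ s < r (ι u)) :
    (∀ i, s ≤ i → level ι (Function.update r (ι v) s) i = level ι r i) ∧
      level ι (Function.update r (ι v) s) (s - 1) = (level ι r s).erase v := by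
  have key : ∀ u, Function.update r (ι v : ℕ) s (ι u) = if u = v then s else r (ι u) := by
    intro u
    rw [Function.update_apply]
    simp only [Fin.val_inj, EmbeddingLike.apply_eq_iff_eq]
  refine ⟨fun i hi => ?_, ?_⟩
  · ext u
    rw [mem_level, mem_level, key]
    split_ifs with h
    · subst h; omega
    · rfl
  · ext u
    rw [Finset.mem_erase, mem_level, mem_level, key]
    split_ifs with h
    · subst h; simp; omega
    · have := hr u
      simp only [h, ne_eq, not_false_eq_true, true_and]
      omega

/-- A processed half-edge costs at most 80 operations and raises the potential by at most 5, worth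
1000; the 1200 per pending half-edge cover both. It also adds at most one cell, so cells plus
pending half-edges never exceed N and the rank bound L stays valid. -/
theorem peel_step (hf : ∀ k, 2 ≤ k → 0 < f k)
    (hadj : ∀ v u, weightAt (adj (ι v)) (ι u) = if G.Adj v u then w s(v, u) else 0)
    (hpos : ∀ i, ∀ a ∈ adj i, 0 ≤ a.2) (hL : 2 * Nat.log 2 N + 1 ≤ L) {σ : Store}
    (h : PeelGraph G w ι adj L N σ) (hb : PeelBest G w f ι (σ.nat 10) σ) (hs : 2 ≤ σ.nat 10) :
    ∃ t τ, Run f peelBody σ t τ ∧ PeelGraph G w ι adj L N τ ∧ PeelBest G w f ι (τ.nat 10) τ ∧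
      τ.nat 10 + 1 = σ.nat 10 ∧
      t + 200 * τ.potential L + 1200 * pending ι adj (τ.natArr 13) (τ.nat 10) ≤
        200 * σ.potential L + 1200 * pending ι adj (σ.natArr 13) (σ.nat 10) + 2000 * (L + 1) := by
  obtain ⟨t₁, σ₁, r₁, g₁, b₁, p₁, s₁, a₁, time₁⟩ := run_compareProg hf h hb hs
  rw [← s₁] at b₁ hs ⊢
  rw [← a₁]
  clear h hb
  have hcard := g₁.card (σ₁.nat 10) le_rfl g₁.size_le
  obtain ⟨v₀, hv₀⟩ : (level ι (σ₁.natArr 13) (σ₁.nat 10)).Nonempty := Finset.card_pos.1 (by omega)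
  have hN : σ₁.size L ≤ N := by have := g₁.count; omega
  obtain ⟨t₂, σ₂, r₂, ready₂, slot₂, cur8, min₂, cur₂, size₂, time₂⟩ :=
    run_deleteMinProg f g₁.idle.ready hL hN ⟨_, fun h0 => (g₁.cur v₀).1 h0 hv₀⟩
  obtain ⟨v, hv⟩ : ∃ v, (ι v : ℕ) = σ₂.nat 8 := by
    have : σ₂.nat 8 < Fintype.card V := by
      by_contra hge
      exact cur8 (g₁.cur_ge _ (not_lt.1 hge))
    exact ⟨ι.symm ⟨_, this⟩, by simp⟩
  rw [← hv] at cur8 min₂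
  have hvs : v ∈ level ι (σ₁.natArr 13) (σ₁.nat 10) := by
    by_contra hvs
    exact cur8 ((g₁.cur v).2 hvs)
  have hrv : (σ₁.natArr 13) (ι v) = 0 := by
    rcases g₁.removed v with h0 | h0
    · exact h0
    · have := (mem_level ι).1 hvs
      omega
  have ag₂ := r₂.agreeOff
  have n10 : σ₂.nat 10 = (σ₁.nat 10) := ag₂.nat 10 (by decide)
  have n13 : σ₂.natArr 13 = (σ₁.natArr 13) := ag₂.natArr 13 (by decide)
  have d2 : σ₂.ratArr 2 = σ₁.ratArr 2 := ag₂.ratArr 2 (by decide)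
  have w0 : σ₂.rat 0 = σ₁.rat 0 := ag₂.rat 0 (by decide)
  set σ₃ := recordProg.exec f σ₂ with hσ₃
  obtain ⟨t₃, r₃, time₃⟩ := Prog.run_exec f (p := recordProg)
    (by simp [recordProg, Prog.LoopFree]) σ₂
  rw [← hσ₃] at r₃
  have e13 : σ₃.natArr 13 = Function.update (σ₁.natArr 13) (ι v) (σ₁.nat 10) := by
    simp [hσ₃, recordProg, Prog.exec, NExp.eval, n13, hv, n10]
  have e0 : σ₃.rat 0 = σ₁.rat 0 - σ₁.ratArr 2 (ι v) := by
    simp [hσ₃, recordProg, Prog.exec, NExp.eval, QExp.eval, w0, d2, hv]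
  have e9 : σ₃.nat 9 = σ₁.natArr 3 (ι v) := by
    simp [hσ₃, recordProg, Prog.exec, NExp.eval, hv]
    rw [show σ₂.natArr 3 = σ₁.natArr 3 from ag₂.natArr 3 (by decide)]
  have idle₃ : σ₃.Idle L := ⟨⟨ready₂.inv, ready₂.slot, ready₂.maxr⟩, slot₂⟩
  have size₃ : σ₃.size L = σ₂.size L := rfl
  have pot₃ : σ₃.potential L = σ₂.potential L := rfl
  have cur₃ : σ₃.heap.cur = σ₂.heap.cur := rfl
  have d3 : σ₃.ratArr 2 = σ₁.ratArr 2 := d2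
  have ag₃ := ag₂.mono (l' := deleteMinProg.writes ++ recordProg.writes)
    (fun _ hx => List.mem_append_left _ hx) |>.trans
    (r₃.agreeOff.mono (fun _ hx => List.mem_append_right _ hx))
  have l4 : σ₃.natArr 4 = σ₁.natArr 4 := ag₃.natArr 4 (by decide)
  have l5 : σ₃.natArr 5 = σ₁.natArr 5 := ag₃.natArr 5 (by decide)
  have l1 : σ₃.ratArr 1 = σ₁.ratArr 1 := ag₃.ratArr 1 (by decide)
  obtain ⟨t₄, σ₄, r₄, idle₄, cur₄, deg₄, size₄, pot₄, time₄⟩ := run_neighborProg f idle₃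
    (l := adj (ι v)) (by rw [l4, l5, l1, e9]; exact g₁.linked _) (hpos _)
  have ag₄ := ag₃.mono (l' := deleteMinProg.writes ++ recordProg.writes ++ neighborProg.writes)
    (fun _ hx => List.mem_append_left _ hx) |>.trans
    (r₄.agreeOff.mono (fun _ hx => List.mem_append_right _ hx))
  have f13 : σ₄.natArr 13 = Function.update (σ₁.natArr 13) (ι v) (σ₁.nat 10) :=
    (r₄.agreeOff.natArr 13 (by decide)).trans e13
  have f0 : σ₄.rat 0 = σ₁.rat 0 - σ₁.ratArr 2 (ι v) :=
    (r₄.agreeOff.rat 0 (by decide)).trans e0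
  have f10 : σ₄.nat 10 = (σ₁.nat 10) := ag₄.nat 10 (by decide)
  have f11 : σ₄.nat 11 = σ₁.nat 11 := ag₄.nat 11 (by decide)
  have f1 : σ₄.rat 1 = σ₁.rat 1 := ag₄.rat 1 (by decide)
  have f3 : σ₄.natArr 3 = σ₁.natArr 3 := ag₄.natArr 3 (by decide)
  have f4 : σ₄.natArr 4 = σ₁.natArr 4 := ag₄.natArr 4 (by decide)
  have f5 : σ₄.natArr 5 = σ₁.natArr 5 := ag₄.natArr 5 (by decide)
  have f1' : σ₄.ratArr 1 = σ₁.ratArr 1 := ag₄.ratArr 1 (by decide)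
  have r₅ := Run.setNat (f := f) σ₄ 10 (.sub (.var 10) (.lit 1))
  set σ₅ := σ₄.setNat 10 ((NExp.sub (.var 10) (.lit 1)).eval σ₄) with hσ₅
  have h10 : σ₅.nat 10 = (σ₁.nat 10) - 1 := by simp [hσ₅, NExp.eval, f10]
  have h13 : σ₅.natArr 13 = Function.update (σ₁.natArr 13) (ι v) (σ₁.nat 10) := f13
  have h11 : σ₅.nat 11 = σ₁.nat 11 := f11
  have hcur : ∀ i, σ₅.heap.cur i = 0 ↔ i = ι v ∨ σ₁.heap.cur i = 0 := by
    intro i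
    have : σ₅.heap.cur i = 0 ↔ σ₃.heap.cur i = 0 := cur₄ i
    rw [this, cur₃, cur₂, hv]
  have hdeg : ∀ i, σ₅.heap.cur i ≠ 0 →
      σ₅.ratArr 2 i = σ₁.ratArr 2 i - weightAt (adj (ι v)) i := by
    intro i hi
    have h1 : σ₄.ratArr 2 i = _ := deg₄ i (fun h0 => hi ((cur₄ i).2 h0))
    rw [d3] at h1
    exact h1
  obtain ⟨lev₁, lev₂⟩ := level_update (ι := ι) (v := v) (by omega) hrv
    (fun u => (g₁.removed u).imp_right fun h => h.1)
  have hpend : pending ι adj (Function.update (σ₁.natArr 13) (ι v) (σ₁.nat 10))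
      ((σ₁.nat 10) - 1) + (adj (ι v)).length =
      pending ι adj (σ₁.natArr 13) (σ₁.nat 10) := by
    rw [pending, lev₂, pending, Finset.sum_erase_add _ _ hvs]
  have hcur' : ∀ u, σ₅.heap.cur (ι u) = 0 ↔ u ∉ level ι (σ₅.natArr 13) (σ₅.nat 10) := by
    intro u
    rw [hcur, h13, h10, lev₂, g₁.cur, Finset.mem_erase, not_and_or, not_not, Fin.val_inj,
      EmbeddingLike.apply_eq_iff_eq]
  refine ⟨_, σ₅, .seq r₁ (.seq r₂ (.seq r₃ (.seq r₄ r₅))), ⟨?_, ?_, hcur', ?_, ?_, ?_, ?_, ?_, ?_,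
    ?_, ?_⟩, ⟨?_, ?_, ?_, ?_, ?_⟩, by omega, ?_⟩
  · exact ⟨⟨idle₄.ready.inv, idle₄.ready.slot, idle₄.ready.maxr⟩, idle₄.slot⟩
  · show ∀ i, Linked (σ₄.natArr 4) (σ₄.natArr 5) (σ₄.ratArr 1) (σ₄.natArr 3 i) (adj i)
    rw [f3, f4, f5, f1']
    exact g₁.linked
  · intro i hi
    exact (hcur i).2 (Or.inr (g₁.cur_ge i hi))
  · intro u
    rw [h13, h10, Function.update_apply]
    have := g₁.size_le
    split_ifs
    · right; omega
    · have := g₁.removed u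
      omega
  · intro u hu
    have hu0 : σ₅.heap.cur (ι u) ≠ 0 := fun h0 => (hcur' u).1 h0 hu
    rw [h13, h10, lev₂] at hu ⊢
    rw [hdeg _ hu0, g₁.deg u (Finset.mem_of_mem_erase hu), weightedDegree_erase hvs, hadj]
  · have : σ₅.rat 0 = σ₁.rat 0 - σ₁.ratArr 2 (ι v) := f0
    rw [this, h13, h10, lev₂, g₁.weight, g₁.deg v hvs, inducedWeight_erase hvs]
  · have := g₁.size_le; omega
  · intro i hi hin
    rw [h10] at hi
    rw [h13]
    rcases Nat.lt_or_ge i (σ₁.nat 10) with hi' | hi'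
    · have : i = (σ₁.nat 10) - 1 := by omega
      rw [this, lev₂, Finset.card_erase_of_mem hvs, hcard]
    · rw [lev₁ i hi']; exact g₁.card i hi' hin
  · intro i hi hin
    rw [h10] at hi
    rw [h13]
    rcases Nat.lt_or_ge (σ₁.nat 10) i with hi' | hi'
    · rw [lev₁ i hi'.le, lev₁ (i - 1) (by omega)]
      exact g₁.peel i hi' hin
    · have : i = (σ₁.nat 10) := by omega
      rw [this, lev₁ (σ₁.nat 10) le_rfl, lev₂]
      refine ⟨v, hvs, fun u hu => ?_, rfl⟩
      have := min₂ (ι u) (fun h0 => (g₁.cur u).1 h0 hu)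
      rwa [g₁.deg u hu, g₁.deg v hvs] at this
  · rw [h13, h10]
    have h1 : σ₅.size L = σ₄.size L := rfl
    have h2 : σ₁.size L + pending ι adj (σ₁.natArr 13) (σ₁.nat 10) ≤ N := g₁.count
    omega
  · rw [h11]; exact b₁.two_le
  · rw [h11, h10]; exact (Nat.sub_le _ _).trans b₁.ge
  · rw [h11]; exact b₁.le
  · have : σ₅.rat 1 = σ₁.rat 1 := f1
    rw [this, h11, h13, lev₁ _ b₁.ge]
    exact b₁.weight
  · intro i hi hin
    rw [h10] at hi
    rw [h11, h13, lev₁ i (by omega), lev₁ _ b₁.ge]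
    exact b₁.max i hi hin
  · rw [h13, h10]
    have h1 : σ₅.potential L = σ₄.potential L := rfl
    have h2 : recordProg.maxCost ≤ 20 := by decide
    simp only [NExp.cost]
    omega

/-- Greedy peeling, after the initialization of the heap. -/
def peelProg : Prog := .loop (.natLe (.lit 2) (.var 10)) peelBody

theorem run_peelProg (hf : ∀ k, 2 ≤ k → 0 < f k)
    (hadj : ∀ v u, weightAt (adj (ι v)) (ι u) = if G.Adj v u then w s(v, u) else 0)
    (hpos : ∀ i, ∀ a ∈ adj i, 0 ≤ a.2) (hL : 2 * Nat.log 2 N + 1 ≤ L) {σ : Store}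
    (h : PeelGraph G w ι adj L N σ) (hb : PeelBest G w f ι (σ.nat 10) σ) (hs : 1 ≤ σ.nat 10) :
    ∃ t τ, Run f peelProg σ t τ ∧ PeelGraph G w ι adj L N τ ∧ PeelBest G w f ι 1 τ ∧
      τ.nat 10 = 1 ∧ t ≤ 200 * σ.potential L + 1200 * pending ι adj (σ.natArr 13) (σ.nat 10) +
        2010 * (L + 1) * σ.nat 10 + 10 := by
  set B := 200 * σ.potential L + 1200 * pending ι adj (σ.natArr 13) (σ.nat 10) +
        2010 * (L + 1) * σ.nat 10 with hB
  obtain ⟨t, τ, hrun, ⟨i1, i2, i3, i4⟩, hb⟩ := Run.of_invariant (f := f)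
    (b := .natLe (.lit 2) (.var 10)) (p := peelBody)
    (I := fun t τ => PeelGraph G w ι adj L N τ ∧ PeelBest G w f ι (τ.nat 10) τ ∧ 1 ≤ τ.nat 10 ∧
      t + 200 * τ.potential L + 1200 * pending ι adj (τ.natArr 13) (τ.nat 10) +
        2010 * (L + 1) * τ.nat 10 ≤ B) B
    (fun t τ ⟨_, _, _, i4⟩ => by omega)
    (fun t ρ ⟨i1, i2, i3, i4⟩ hb => by
      have hb' : 2 ≤ ρ.nat 10 := hb
      obtain ⟨s, τ, hs, g1, g2, g3, g4⟩ := peel_step hf hadj hpos hL i1 i2 hb'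
      refine ⟨s, τ, hs, g1, g2, by omega, ?_⟩
      rw [← g3, Nat.mul_add] at i4
      simp only [Test.cost, NExp.cost]
      rw [← g3] at g4
      omega)
      (t₀ := 0) (σ := σ) ⟨h, hb, hs, by omega⟩
  have hb' : ¬ (2 ≤ τ.nat 10) := hb
  have h1 : τ.nat 10 = 1 := by omega
  refine ⟨_, τ, hrun, i1, h1 ▸ i2, h1, ?_⟩
  simp only [Test.cost, NExp.cost]
  omega

end
-- Initial memory, output, and the complete program
theorem idle_of_zero {σ : Store} {L : ℕ} (h3 : σ.nat 3 = 0) (h4 : σ.nat 4 = 0) (h5 : σ.nat 5 = 0)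
    (h6 : ∀ i, σ.natArr 6 i = 0) (h8 : σ.natArr 8 0 = 0) (h9 : σ.natArr 9 0 = 0)
    (h10 : σ.natArr 10 0 = 0) (h11 : ∀ i, σ.natArr 11 i = 0) :
    σ.Idle L ∧ σ.size L = 0 ∧ σ.potential L = 0 := by
  have hroots : σ.roots L = Multiset.replicate (L + 1) 0 := by
    rw [Store.roots, Store.stack, h4, Store.slots_of_zero h11]; simp
  have htot : σ.heap.total (σ.roots L) = 0 := by
    rw [hroots, Heap.total, Multiset.map_replicate]; simp
  have hsize : σ.size L = 0 := by rw [Store.size, htot]; rfl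
  refine ⟨⟨⟨⟨?_, ?_, ?_, ?_⟩, fun r hr => absurd (h11 r) hr, by omega⟩, h11⟩, hsize, ?_⟩
  · intro x hx
    have hx' : x ≤ σ.nat 3 := hx
    have : x = 0 := by omega
    subst this
    exact Or.inl ⟨h8, h9, h10⟩
  · intro x hx
    rw [hroots] at hx
    rw [Multiset.eq_of_mem_replicate hx]
    exact Nat.zero_le _
  · rw [htot]; exact Multiset.nodup_zero
  · intro i hi; exact absurd (h6 i) hi
  · rw [Store.potential, hsize, h4, Store.slots_of_zero h11, Multiset.countP_eq_zero.2]
    intro a ha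
    simp [Multiset.eq_of_mem_replicate ha]

/-- Marks one vertex of the best set of greedy peeling. -/
def markBody : Prog := .seq
  (.cond (.natLe (.get 13 (.var 2)) (.var 11)) (.putNat 2 (.var 2) (.lit 1)) .skip)
  (.setNat 2 (.add (.var 2) (.lit 1)))

/-- Marks the best set of greedy peeling. -/
def markProg : Prog := .seq (.setNat 2 (.lit 0)) (.loop (.not (.natLe (.var 0) (.var 2))) markBody)

theorem run_markProg (f : ℕ → ℝ) {σ : Store} (h : ∀ i, σ.natArr 2 i = 0) :
    ∃ t τ, Run f markProg σ t τ ∧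
      (∀ i < σ.nat 0, τ.natArr 2 i = 1 ↔ σ.natArr 13 i ≤ σ.nat 11) ∧ t ≤ 40 * σ.nat 0 + 10 := by
  have lf : markBody.LoopFree := by simp [markBody, Prog.LoopFree]
  have cost : markBody.maxCost ≤ 30 := by decide
  obtain ⟨t, τ, hrun, ⟨i1, i2, i3, i4⟩, hb⟩ := Run.of_invariant (f := f)
    (b := .not (.natLe (.var 0) (.var 2))) (p := markBody)
    (I := fun t τ => Store.AgreeOff markBody.writes (σ.setNat 2 0) τ ∧ τ.nat 2 ≤ σ.nat 0 ∧
      (∀ i, τ.natArr 2 i = 1 ↔ i < τ.nat 2 ∧ σ.natArr 13 i ≤ σ.nat 11) ∧ t ≤ 40 * τ.nat 2)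
    (40 * σ.nat 0)
    (fun t τ ⟨_, i2, _, i4⟩ => by omega)
    (fun t ρ ⟨i1, i2, i3, i4⟩ hb => by
      have hb' : ¬ (ρ.nat 0 ≤ ρ.nat 2) := hb
      obtain ⟨s, hs, hs'⟩ := Prog.run_exec f lf ρ
      have n0 : ρ.nat 0 = σ.nat 0 := i1.nat 0 (by decide)
      have n11 : ρ.nat 11 = σ.nat 11 := i1.nat 11 (by decide)
      have a13 : ρ.natArr 13 = σ.natArr 13 := i1.natArr 13 (by decide)
      have e2 : (markBody.exec f ρ).nat 2 = ρ.nat 2 + 1 := by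
        by_cases hc : σ.natArr 13 (ρ.nat 2) ≤ σ.nat 11 <;>
          simp [markBody, Prog.exec, NExp.eval, Test.Holds, n11, a13, hc]
      refine ⟨s, _, hs, i1.trans hs.agreeOff, by omega, fun i => ?_, ?_⟩
      · rw [e2]
        have hi3 := i3 i
        by_cases hc : σ.natArr 13 (ρ.nat 2) ≤ σ.nat 11
        · have e : (markBody.exec f ρ).natArr 2 = Function.update (ρ.natArr 2) (ρ.nat 2) 1 := by
            simp [markBody, Prog.exec, NExp.eval, Test.Holds, n11, a13, hc]
          rw [e, Function.update_apply]
          split_ifs with hi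
          · subst hi; simp [hc]
          · rw [hi3]
            have : i < ρ.nat 2 ↔ i < ρ.nat 2 + 1 := by omega
            rw [this]
        · have e : (markBody.exec f ρ).natArr 2 = ρ.natArr 2 := by
            simp [markBody, Prog.exec, NExp.eval, Test.Holds, n11, a13, hc]
          rw [e, hi3]
          constructor
          · exact fun h => ⟨by omega, h.2⟩
          · refine fun h => ⟨?_, h.2⟩
            rcases Nat.lt_succ_iff_lt_or_eq.1 h.1 with h' | rfl
            exacts [h', absurd h.2 hc]
      · rw [e2]
        simp only [Test.cost, NExp.cost]
        omega)
      (t₀ := 0) (σ := σ.setNat 2 0)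
      ⟨.refl _ _, by simp, fun i => by simp [h], by omega⟩
  have hb' : ¬ ¬ (τ.nat 0 ≤ τ.nat 2) := hb
  have n0 : τ.nat 0 = σ.nat 0 := i1.nat 0 (by decide)
  refine ⟨_, τ, .seq (.setNat _ _ _) hrun, fun i hi => ?_, ?_⟩
  · rw [i3]
    exact ⟨fun h => h.2, fun h => ⟨by omega, h⟩⟩
  · simp only [Test.cost, NExp.cost]
    omega

/-- Marks the endpoints of a heaviest edge. -/
def markEdgeProg : Prog := .seq (.putNat 2 (.get 0 (.var 13)) (.lit 1))
  (.putNat 2 (.get 1 (.var 13)) (.lit 1))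

/-- Marks the better one of the two sets. -/
def outputProg : Prog :=
  .cond (.sizeLe (.get 0 (.var 13)) (.var 11) (.var 1) (.lit 2)) markProg markEdgeProg

/-- Starts greedy peeling with the whole vertex set. -/
def startProg : Prog := .seq (.setNat 10 (.var 0)) (.seq (.setNat 11 (.var 0)) (.setRat 1 (.var 0)))

/-- The algorithm. -/
def algorithm : Prog := .seq edgesProg (.seq insertProg (.seq startProg (.seq peelProg outputProg)))

section
variable {V : Type*} [Fintype V] [DecidableEq V] {G : SimpleGraph V} [DecidableRel G.Adj]
  {w : Sym2 V → ℚ} {f : ℕ → ℝ}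

theorem inducedWeight_pair {a b : V} (hab : a ≠ b) :
    inducedWeight G w {a, b} = if G.Adj a b then w s(a, b) else 0 := by
  have h := sum_weightedDegree (G := G) (w := w) {a, b}
  rw [Finset.sum_pair hab, weightedDegree, weightedDegree, Finset.sum_filter, Finset.sum_filter,
    Finset.sum_pair hab, Finset.sum_pair hab] at h
  simp only [SimpleGraph.irrefl, if_false, zero_add, add_zero, G.adj_comm b a,
    Sym2.eq_swap (a := b) (b := a)] at h
  linarith

theorem isMaxWeightOfSize_pair (hw : ∀ e ∈ G.edgeSet, 0 < w e) {a b : V} (hab : G.Adj a b)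
    (hmax : ∀ e ∈ G.edgeSet, w e ≤ w s(a, b)) : IsMaxWeightOfSize G w 2 {a, b} := by
  refine ⟨Finset.card_pair hab.ne, fun T hT => ?_⟩
  obtain ⟨x, y, hxy, rfl⟩ := Finset.card_eq_two.1 hT
  rw [inducedWeight_pair hxy, inducedWeight_pair hab.ne, if_pos hab]
  split_ifs with h
  · exact hmax _ h
  · exact (hw _ hab).le

theorem isBruteForceOutput_two {S : Finset V} :
    IsBruteForceOutput G w f 2 S ↔ IsMaxWeightOfSize G w 2 S := by
  constructor
  · rintro ⟨A, hA, i, hi, rfl, -⟩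
    have := Finset.mem_Icc.1 hi
    have h2 : i = 2 := by omega
    subst h2
    exact hA 2 hi
  · intro h
    refine ⟨fun _ => S, fun i hi => ?_, 2, by simp, rfl, fun _ _ => le_rfl⟩
    have := Finset.mem_Icc.1 hi
    have h2 : i = 2 := by omega
    subst h2
    exact h

theorem inducedWeight_nonneg (hw : ∀ e ∈ G.edgeSet, 0 < w e) (S : Finset V) :
    0 ≤ inducedWeight G w S :=
  Finset.sum_nonneg fun e he => (hw e (by
    simpa using (Finset.mem_filter.1 he).1)).le

theorem fDensity_nonneg (hw : ∀ e ∈ G.edgeSet, 0 < w e) (hf : IsSizeFunction f) (S : Finset V) :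
    0 ≤ fDensity G w f S :=
  div_nonneg (by exact_mod_cast inducedWeight_nonneg hw S) (hf.nonneg _)

/-- Makes the density of a single vertex 0 even if f 1 = 0, so such sets can be ignored by the
program and in the optimum. -/
theorem inducedWeight_of_card_le_one {S : Finset V} (hS : S.card ≤ 1) :
    inducedWeight G w S = 0 := by
  rw [inducedWeight, Finset.filter_eq_empty_iff.2, Finset.sum_empty]
  intro e he h
  rw [SimpleGraph.mem_edgeFinset] at he
  induction e with
  | _ a b =>
    rw [SimpleGraph.mem_edgeSet] at he
    exact he.ne (Finset.card_le_one.1 hS a (h a (by simp)) b (h b (by simp)))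

theorem PeelGraph.isPeelingOutput {ι : V ≃ Fin (Fintype.card V)} {adj : ℕ → List (ℕ × ℚ)}
    {L N : ℕ} {σ : Store} (hw : ∀ e ∈ G.edgeSet, 0 < w e) (hf : IsSizeFunction f)
    (h : PeelGraph G w ι adj L N σ) (hb : PeelBest G w f ι 1 σ) (hs : σ.nat 10 = 1) :
    IsPeelingOutput G w f (level ι (σ.natArr 13) (σ.nat 11)) := by
  refine ⟨level ι (σ.natArr 13), ⟨?_, fun i hi => ?_⟩, σ.nat 11, ?_, rfl, fun j hj => ?_⟩
  · ext v
    have := h.removed v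
    simp only [mem_level, Finset.mem_univ, iff_true]
    omega
  · have := Finset.mem_Icc.1 hi
    exact h.peel i (by omega) this.2
  · have := hb.two_le
    exact Finset.mem_Icc.2 ⟨by omega, hb.le⟩
  · have hj' := Finset.mem_Icc.1 hj
    rcases Nat.lt_or_ge 1 j with h1 | h1
    · exact hb.max j h1 hj'.2
    -- The program stops before it evaluates the single remaining vertex; that set has density 0 and
    -- cannot be better.
    · have hc := h.card j (by omega) hj'.2
      have : fDensity G w f (level ι (σ.natArr 13) j) = 0 := by
        rw [fDensity, inducedWeight_of_card_le_one (by omega)]; simp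
      rw [this]
      exact fDensity_nonneg hw hf _

end
theorem inputStore_natArr {V : Type*} {n m : ℕ} {w : Sym2 V → ℚ} (ι : V ≃ Fin n)
    (edge : Fin m → V × V) {a : ℕ} (ha : 2 ≤ a)
    (i : ℕ) : (inputStore ι w edge).natArr a i = 0 := by
  have h0 : a ≠ 0 := by omega
  have h1 : a ≠ 1 := by omega
  simp [inputStore, h0, h1]

theorem inputStore_adjacency {V : Type*} {n m : ℕ} {w : Sym2 V → ℚ} (ι : V ≃ Fin n)
    (edge : Fin m → V × V) :
    (inputStore ι w edge).Adjacency fun _ => [] := by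
  refine ⟨fun i => ?_, fun i => ?_, fun i => ?_⟩
  · rw [inputStore_natArr ι edge (by omega)]; rfl
  · rw [inputStore_natArr ι edge (by omega)]; exact Nat.zero_le _
  · simp [inputStore]

section
variable {V : Type*} [Fintype V] [DecidableEq V] {G : SimpleGraph V} [DecidableRel G.Adj]
  {w : Sym2 V → ℚ} {f : ℕ → ℝ}

/-- The term in m pays for reading the edges and for 2m half-edges at 1200 each. The term in (L +
1)·n pays for the minimum deletions and absorbs everything linear in n, including insertions and
output. -/
theorem run_algorithm (hw : ∀ e ∈ G.edgeSet, 0 < w e) (hne : G.edgeSet.Nonempty)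
    (hf : IsSizeFunction f) (hpos : ∀ k, 2 ≤ k → 0 < f k) (ι : V ≃ Fin (Fintype.card V))
    {m : ℕ} (hm : G.edgeFinset.card = m) {edge : Fin m → V × V} (he : IsEdgeList G edge) {L : ℕ}
    (hL : 2 * Nat.log 2 (Fintype.card V + 2 * m) + 1 ≤ L) :
    ∃ t τ, Run f algorithm (inputStore ι w edge) t τ ∧
      IsAlgorithmOutput G w f (outputSet ι τ) ∧
      t ≤ 3000 * m + 4000 * ((L + 1) * Fintype.card V) := by
  set σ₀ := inputStore ι w edge with hσ₀
  have hm1 : 1 ≤ m := by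
    obtain ⟨e, he⟩ := hne
    rw [← hm]
    exact Finset.card_pos.2 ⟨e, by simpa using he⟩
  have hn2 : 2 ≤ (Fintype.card V) := by
    have := he.adj ⟨0, hm1⟩
    exact Fintype.one_lt_card_iff.2 ⟨_, _, this.ne⟩
  have s0 : σ₀.nat 0 = (Fintype.card V) := rfl
  have s1 : σ₀.nat 1 = m := rfl
  obtain ⟨t₁, σ₁, r₁, adj₁, w₁, e₁, max₁, time₁⟩ := run_edgesProg f
    (inputStore_adjacency (w := w) ι edge) rfl rfl rfl hm1
  have g₁ := r₁.agreeOff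
  have sum₁ : σ₁.rat 0 = inducedWeight G w Finset.univ := w₁.trans (sum_input_weights he)
  have zero₁ : ∀ a, 2 ≤ a → (2, a) ∉ edgesProg.writes → ∀ i, σ₁.natArr a i = 0 := by
    intro a ha hwr i
    rw [g₁.natArr a hwr]; exact inputStore_natArr ι edge ha i
  obtain ⟨idle₁, size₁, pot₁⟩ := idle_of_zero (L := L) (g₁.nat 3 (by decide))
    (g₁.nat 4 (by decide)) (g₁.nat 5 (by decide)) (zero₁ 6 (by omega) (by decide))
    (zero₁ 8 (by omega) (by decide) 0) (zero₁ 9 (by omega) (by decide) 0)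
    (zero₁ 10 (by omega) (by decide) 0) (zero₁ 11 (by omega) (by decide))
  obtain ⟨t₂, σ₂, r₂, idle₂, cur₂, size₂, pot₂, time₂⟩ := run_insertProg f idle₁
    (zero₁ 6 (by omega) (by decide))
  have g₂ := r₂.agreeOff
  have g₁₂ := (g₁.mono (l' := edgesProg.writes ++ insertProg.writes)
    (fun _ h => List.mem_append_left _ h)).trans (g₂.mono fun _ h => List.mem_append_right _ h)
  have n0 : σ₁.nat 0 = (Fintype.card V) := g₁.nat 0 (by decide)
  rw [n0] at cur₂ size₂ pot₂ time₂
  have n0' : σ₂.nat 0 = (Fintype.card V) := g₁₂.nat 0 (by decide)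
  obtain ⟨t₃, r₃, time₃⟩ := Prog.run_exec f (p := startProg)
    (by simp [startProg, Prog.LoopFree]) σ₂
  set σ₃ := startProg.exec f σ₂ with hσ₃
  have h10 : σ₃.nat 10 = (Fintype.card V) := by simp [hσ₃, startProg, Prog.exec, NExp.eval, n0']
  have h11 : σ₃.nat 11 = (Fintype.card V) := by simp [hσ₃, startProg, Prog.exec, NExp.eval, n0']
  have hr0 : σ₃.rat 0 = inducedWeight G w Finset.univ := by
    have : σ₃.rat 0 = σ₂.rat 0 := by simp [hσ₃, startProg, Prog.exec]
    rw [this, g₂.rat 0 (by decide), sum₁]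
  have hr1 : σ₃.rat 1 = inducedWeight G w Finset.univ := by
    have : σ₃.rat 1 = σ₂.rat 0 := by simp [hσ₃, startProg, Prog.exec, QExp.eval]
    rw [this, g₂.rat 0 (by decide), sum₁]
  have a13 : ∀ i, σ₃.natArr 13 i = 0 := by
    intro i
    show σ₂.natArr 13 i = 0
    rw [g₂.natArr 13 (by decide)]; exact zero₁ 13 (by omega) (by decide) i
  have hlev : ∀ i, level ι (σ₃.natArr 13) i = Finset.univ := by
    intro i; ext v; simp [mem_level, a13]
  have hpend : pending ι (inputAdj ι w edge) (σ₃.natArr 13) (Fintype.card V) = 2 * m := by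
    rw [pending, hlev, Finset.sum_congr rfl fun v _ => length_inputAdj he v,
      G.sum_degrees_eq_twice_card_edges, hm]
  have pot₃ : σ₃.potential L = σ₂.potential L := rfl
  have size₃ : σ₃.size L = σ₂.size L := rfl
  -- Initially the heap has one cell per vertex and all 2m half-edges are pending, whence the bound
  -- n + 2m on the number of live cells.
  have hgraph : PeelGraph G w ι (inputAdj ι w edge) L ((Fintype.card V) + 2 * m) σ₃ := by
    refine ⟨⟨⟨idle₂.ready.inv, idle₂.ready.slot, idle₂.ready.maxr⟩, idle₂.slot⟩, ?_, ?_, ?_, ?_, ?_,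
      ?_, ?_, ?_, ?_, ?_⟩
    · show ∀ i, Linked (σ₂.natArr 4) (σ₂.natArr 5) (σ₂.ratArr 1) (σ₂.natArr 3 i)
        (inputAdj ι w edge i)
      rw [g₂.natArr 4 (by decide), g₂.natArr 5 (by decide), g₂.ratArr 1 (by decide),
        g₂.natArr 3 (by decide)]
      exact adj₁.linked
    · intro v
      rw [hlev]
      have : σ₃.heap.cur (ι v) ≠ 0 := by
        intro h0
        have := (cur₂ (ι v)).1 h0
        have := (ι v).isLt
        omega
      simp [this]
    · intro i hi; exact (cur₂ i).2 hi
    · intro v; exact Or.inl (a13 _)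
    · intro v _
      rw [hlev, ← deg_inputAdj (ι := ι) he v]
      have : σ₃.ratArr 2 = σ₁.ratArr 2 := by
        rw [← g₂.ratArr 2 (by decide)]; rfl
      rw [this, adj₁.deg]; rfl
    · rw [hlev, hr0]
    · rw [h10]
    · intro i hi hin
      rw [h10] at hi
      rw [hlev, Finset.card_univ]; omega
    · intro i hi hin; rw [h10] at hi; omega
    · rw [h10, hpend]; omega
  have hbest : PeelBest G w f ι (σ₃.nat 10) σ₃ :=
    ⟨by omega, by omega, by omega, by rw [hlev, hr1], fun i hi hin => by omega⟩
  obtain ⟨t₄, σ₄, r₄, graph₄, best₄, s₄, time₄⟩ := run_peelProg hpos (weightAt_inputAdj he)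
    (fun i => inputAdj_pos he hw i) hL hgraph hbest (by omega)
  rw [h10, hpend, pot₃, pot₂, pot₁] at time₄
  have g₄ := ((g₁₂.mono (l' := edgesProg.writes ++ insertProg.writes ++ startProg.writes ++
    peelProg.writes) (fun _ h => List.mem_append_left _ (List.mem_append_left _ h))).trans
    (r₃.agreeOff.mono fun _ h => List.mem_append_left _ (List.mem_append_right _ h))).trans
    (r₄.agreeOff.mono fun _ h => List.mem_append_right _ h)
  have hout := graph₄.isPeelingOutput hw hf best₄ s₄
  have q0 : σ₄.ratArr 0 = σ₀.ratArr 0 := g₄.ratArr 0 (by decide)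
  have q0' : σ₄.natArr 0 = σ₀.natArr 0 := g₄.natArr 0 (by decide)
  have q1' : σ₄.natArr 1 = σ₀.natArr 1 := g₄.natArr 1 (by decide)
  have q2' : ∀ i, σ₄.natArr 2 i = 0 := by
    intro i
    rw [g₄.natArr 2 (by decide)]; exact inputStore_natArr ι edge le_rfl i
  have k13 : σ₄.nat 13 = σ₁.nat 13 := by
    rw [r₄.agreeOff.nat 13 (by decide), r₃.agreeOff.nat 13 (by decide), g₂.nat 13 (by decide)]
  have e₁' : σ₄.nat 13 < m := by rw [k13]; exact e₁
  set k : Fin m := ⟨σ₄.nat 13, e₁'⟩ with hk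
  have hadj := he.adj k
  have hwk : ∀ j : Fin m, σ₀.ratArr 0 j = w s((edge j).1, (edge j).2) := by
    intro j; simp [hσ₀, inputStore]
  have hmax : ∀ e ∈ G.edgeSet, w e ≤ w s((edge k).1, (edge k).2) := by
    intro e hee
    rw [← he.2] at hee
    obtain ⟨j, rfl⟩ := hee
    have := max₁ j j.isLt
    rw [← k13] at this
    have h1 := hwk k
    rw [← hwk j, ← h1]
    exact this
  have hbrute := isBruteForceOutput_two (f := f).2 (isMaxWeightOfSize_pair hw hadj hmax)
  set S := level ι (σ₄.natArr 13) (σ₄.nat 11) with hS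
  have hScard : S.card = σ₄.nat 11 := graph₄.card _ best₄.ge best₄.le
  have hiff := fDensity_le_iff (G := G) (w := w) hpos
    (S := {(edge k).1, (edge k).2}) (T := S) (by rw [Finset.card_pair hadj.ne])
    (by rw [hScard]; exact best₄.two_le)
  rw [Finset.card_pair hadj.ne, inducedWeight_pair hadj.ne, if_pos hadj, ← hwk k, hScard, ← q0,
    ← best₄.weight] at hiff
  have htime : ∀ t₅, t₅ ≤ 40 * (Fintype.card V) + 40 → t₁ + (t₂ + (t₃ + (t₄ + t₅))) ≤
      3000 * m + 4000 * ((L + 1) * (Fintype.card V)) := by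
    intro t₅ h₅
    have hc : startProg.maxCost ≤ 20 := by decide
    -- Since L is at least 1, terms linear in n, and constants because n is at least 2, are absorbed
    -- by (L + 1)·n.
    have hn4 : 2 * (Fintype.card V) ≤ (L + 1) * (Fintype.card V) :=
      Nat.mul_le_mul_right _ (by omega)
    have : 2010 * (L + 1) * (Fintype.card V) = 2010 * ((L + 1) * (Fintype.card V)) := by ring
    rw [this] at time₄
    have h1 : t₁ ≤ 110 * m + 10 := time₁
    omega
  -- The final comparison of a heaviest edge, a set of two vertices, with the best peeled set.
  by_cases hc : (σ₄.ratArr 0 (σ₄.nat 13) : ℝ) * f (σ₄.nat 11) ≤ (σ₄.rat 1 : ℝ) * f 2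
  · obtain ⟨t₅, τ, r₅, mark, time₅⟩ := run_markProg f q2'
    have n4 : σ₄.nat 0 = (Fintype.card V) := g₄.nat 0 (by decide)
    rw [n4] at mark time₅
    have hset : outputSet ι τ = S := by
      ext v
      rw [hS, mem_level, outputSet, Finset.mem_filter]
      simp only [Finset.mem_univ, true_and]
      exact mark (ι v) (ι v).isLt
    refine ⟨_, τ, .seq r₁ (.seq r₂ (.seq r₃ (.seq r₄ (.condTrue hc r₅)))), ?_, htime _ ?_⟩
    · rw [hset]
      exact ⟨_, _, hbrute, hout, Or.inr ⟨rfl, hiff.2 hc⟩⟩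
    · simp only [Test.cost, NExp.cost, QExp.cost]; omega
  · obtain ⟨t₅, r₅, time₅⟩ := Prog.run_exec f (p := markEdgeProg)
      (by simp [markEdgeProg, Prog.LoopFree]) σ₄
    have hset : outputSet ι (markEdgeProg.exec f σ₄) = {(edge k).1, (edge k).2} := by
      have h0 : σ₀.natArr 0 (σ₄.nat 13) = ι (edge k).1 := by
        simp [hσ₀, inputStore, hk, e₁']
      have h1 : σ₀.natArr 1 (σ₄.nat 13) = ι (edge k).2 := by
        simp [hσ₀, inputStore, hk, e₁']
      have e : (markEdgeProg.exec f σ₄).natArr 2 = Function.update (Function.update (σ₄.natArr 2)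
          (ι (edge k).1 : ℕ) 1) (ι (edge k).2 : ℕ) 1 := by
        simp [markEdgeProg, Prog.exec, NExp.eval, q0', q1', h0, h1]
      ext v
      rw [outputSet, Finset.mem_filter, Finset.mem_insert, Finset.mem_singleton, e,
        Function.update_apply, Function.update_apply, q2']
      simp only [Finset.mem_univ, true_and, Fin.val_inj, EmbeddingLike.apply_eq_iff_eq]
      by_cases ha : v = (edge k).1 <;> by_cases hb : v = (edge k).2 <;> simp [ha, hb]
    refine ⟨_, _, .seq r₁ (.seq r₂ (.seq r₃ (.seq r₄ (.condFalse hc r₅)))), ?_, htime _ ?_⟩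
    · rw [hset]
      exact ⟨_, _, hbrute, hout, Or.inl ⟨rfl, (not_le.1 fun h => hc (hiff.1 h)).le⟩⟩
    · have : markEdgeProg.maxCost ≤ 20 := by decide
      simp only [Test.cost, NExp.cost, QExp.cost]; omega

end

-- The approximation guarantee

section
variable {f : ℕ → ℝ}

theorem IsConvex.monotone_sub (h : IsConvex f) : Monotone fun k => f (k + 1) - f k := by
  refine monotone_nat_of_le_succ fun k => ?_
  have := h k
  simp only [add_assoc, one_add_one_eq_two]
  linarith

/-- The increments of a convex size function with `0 < f 2` are positive from the second one on. -/
theorem IsSizeFunction.sub_pos (hf : IsSizeFunction f) (hc : IsConvex f) (h2 : 0 < f 2) {k : ℕ}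
    (hk : 2 ≤ k) : 0 < f k - f (k - 1) := by
  obtain ⟨k, rfl⟩ : ∃ j, k = j + 1 := ⟨k - 1, by omega⟩
  -- Every increment from the second one on is at least f 2 − f 1. Convexity at 0 gives f 1 ≤ f 2 /
  -- 2, so this is positive.
  have h1 := hc.monotone_sub (show 1 ≤ k by omega)
  have h0 := hc 0
  have := hf.zero
  simp only [Nat.add_sub_cancel, zero_add] at *
  norm_num at h1
  linarith

theorem IsSizeFunction.pos (hf : IsSizeFunction f) (h2 : 0 < f 2) (k : ℕ) (hk : 2 ≤ k) :
    0 < f k :=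
  h2.trans_le (hf.mono hk)

/-- The ratio f(x)/x is non-decreasing, written without division. By `key`, f k is a sum of k
increments, none of which exceeds the next increment f(k + 1) − f k. -/
theorem IsSizeFunction.mul_le_mul (hf : IsSizeFunction f) (hc : IsConvex f) {i n : ℕ}
    (h : i ≤ n) : f i * n ≤ f n * i := by
  have key : ∀ k : ℕ, f k ≤ k * (f (k + 1) - f k) := by
    intro k
    induction k with
    | zero => simp [hf.zero]
    | succ k ih =>
      have := hc k
      push_cast
      have hk : (0 : ℝ) ≤ k := Nat.cast_nonneg k
      have e : f (k + 1 + 1) = f (k + 2) := rfl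
      rw [e]
      nlinarith
  induction n, h using Nat.le_induction with
  | base => exact le_rfl
  | succ n hn ih =>
    rcases Nat.eq_zero_or_pos n with rfl | hpos
    · have : i = 0 := by omega
      subst this; simp [hf.zero]
    have hpos' : (0 : ℝ) < n := by exact_mod_cast hpos
    have h1 := key n
    push_cast
    have h2 : f n * (n + 1) ≤ f (n + 1) * n := by linarith
    have hi : (0 : ℝ) ≤ i := Nat.cast_nonneg i
    have h3 : f i * n * (n + 1) ≤ f (n + 1) * i * n := by
      calc f i * n * (n + 1) ≤ f n * i * (n + 1) := by gcongr
        _ = f n * (n + 1) * i := by ring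
        _ ≤ f (n + 1) * n * i := by gcongr
        _ = _ := by ring
    refine le_of_mul_le_mul_right ?_ hpos'
    linarith

variable {V : Type*} {G : SimpleGraph V} [DecidableRel G.Adj] {w : Sym2 V → ℚ}

theorem weightedDegree_mono (hw : ∀ e ∈ G.edgeSet, 0 < w e) {S T : Finset V} (h : S ⊆ T) (v : V) :
    weightedDegree G w S v ≤ weightedDegree G w T v := by
  refine Finset.sum_le_sum_of_subset_of_nonneg (Finset.filter_subset_filter _ h) fun u hu _ => ?_
  exact (hw _ (by simpa using (Finset.mem_filter.1 hu).2)).le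

variable [Fintype V] [DecidableEq V]

/-- An optimal solution has at least two vertices and positive density. -/
theorem IsOptimal.two_le_card (hw : ∀ e ∈ G.edgeSet, 0 < w e) (hne : G.edgeSet.Nonempty)
    (h2 : 0 < f 2) {S : Finset V} (hS : IsOptimal G w f S) :
    2 ≤ S.card ∧ 0 < fDensity G w f S := by
  obtain ⟨e, he⟩ := hne
  induction e with
  | _ a b =>
    rw [SimpleGraph.mem_edgeSet] at he
    have h1 := hS {a, b}
    have h3 : 0 < fDensity G w f {a, b} := by
      rw [fDensity, inducedWeight_pair he.ne, if_pos he, Finset.card_pair he.ne]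
      have : 0 < w s(a, b) := hw _ (G.mem_edgeSet.2 he)
      exact div_pos (by exact_mod_cast this) h2
    refine ⟨?_, h3.trans_le h1⟩
    by_contra hlt
    rw [fDensity, fDensity, inducedWeight_of_card_le_one (S := S) (by omega)] at h1
    simp only [Rat.cast_zero, zero_div] at h1
    rw [fDensity] at h3
    linarith

/-- The degrees in an optimal solution. -/
theorem IsOptimal.le_weightedDegree (hf : IsSizeFunction f) (h2 : 0 < f 2) {S : Finset V}
    (hS : IsOptimal G w f S) (hS2 : 2 ≤ S.card) {v : V} (hv : v ∈ S) :
    fDensity G w f S * (f S.card - f (S.card - 1)) ≤ weightedDegree G w S v := by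
  have hpos := hf.pos h2 _ hS2
  have e1 : (inducedWeight G w S : ℝ) = fDensity G w f S * f S.card := by
    rw [fDensity, div_mul_cancel₀ _ hpos.ne']
  -- Optimality of S against S without v; the weight lost is the degree of v.
  have e2 : (inducedWeight G w (S.erase v) : ℝ) ≤ fDensity G w f S * f (S.card - 1) := by
    have hc := Finset.card_erase_of_mem hv
    -- If one vertex remains, f 1 may vanish and the density carries no information, but the
    -- remaining weight is 0.
    rcases Nat.lt_or_ge S.card 3 with h3 | h3
    · have h1 : S.card - 1 = 1 := by omega
      rw [inducedWeight_of_card_le_one (by omega)]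
      have h0 : 0 ≤ fDensity G w f S := by
        refine le_trans ?_ (hS ∅)
        rw [fDensity, inducedWeight_of_card_le_one (S := ∅) (by simp)]; simp
      have := mul_nonneg h0 (hf.nonneg (S.card - 1))
      simpa using this
    · have hp := hf.pos h2 (S.card - 1) (by omega)
      have := hS (S.erase v)
      rwa [fDensity, hc, div_le_iff₀ hp] at this
  rw [inducedWeight_erase hv] at e2
  push_cast at e2
  linarith

/-- The guarantee of the brute-force search. -/
theorem IsOptimal.le_of_bruteForce (hw : ∀ e ∈ G.edgeSet, 0 < w e) (hf : IsSizeFunction f)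
    (h2 : 0 < f 2) {S B : Finset V} (hS2 : 2 ≤ S.card)
    (hB : IsMaxWeightOfSize G w 2 B) :
    fDensity G w f S ≤
      (f 2 / 2) / (f S.card / (S.card : ℝ) ^ 2) * fDensity G w f B := by
  have hpos := hf.pos h2 _ hS2
  set W := inducedWeight G w B with hW
  have hW0 : 0 ≤ W := inducedWeight_nonneg hw B
  -- The endpoints of each edge compete in the brute-force search, so no edge weighs more than W,
  -- and v has at most |S| neighbors in S. Summing over v bounds twice the weight of S.
  have hdeg : ∀ v ∈ S, weightedDegree G w S v ≤ S.card * W := by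
    intro v _
    rw [weightedDegree]
    refine (Finset.sum_le_card_nsmul _ _ W fun u hu => ?_).trans ?_
    · have hadj : G.Adj v u := (Finset.mem_filter.1 hu).2
      have := hB.2 {v, u} (Finset.card_pair hadj.ne)
      rwa [inducedWeight_pair hadj.ne, if_pos hadj] at this
    · rw [nsmul_eq_mul]
      gcongr
      exact Finset.filter_subset _ _
  have h1 : 2 * inducedWeight G w S ≤ S.card * (S.card * W) := by
    rw [← sum_weightedDegree, ← nsmul_eq_mul]
    exact Finset.sum_le_card_nsmul _ _ _ hdeg
  have h1' : (2 * inducedWeight G w S : ℝ) ≤ S.card * (S.card * W) := by exact_mod_cast h1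
  have e : (f 2 / 2) / (f S.card / (S.card : ℝ) ^ 2) * fDensity G w f B =
      ((S.card : ℝ) ^ 2 * W / 2) / f S.card := by
    rw [fDensity, hB.1, ← hW]
    field_simp
  rw [e, fDensity]
  gcongr
  linarith

/-- The guarantee of greedy peeling. -/
theorem IsOptimal.le_of_peeling (hw : ∀ e ∈ G.edgeSet, 0 < w e) (hf : IsSizeFunction f)
    (hc : IsConvex f) (h2 : 0 < f 2) {S P : Finset V} (hS : IsOptimal G w f S)
    (hS2 : 2 ≤ S.card) (hP : IsPeelingOutput G w f P) :
    fDensity G w f S ≤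
      (2 * f (Fintype.card V) / (Fintype.card V : ℝ)) / (f S.card - f (S.card - 1)) *
        fDensity G w f P := by
  obtain ⟨A, ⟨hA, hpeel⟩, -, -, -, hmax⟩ := hP
  set n := Fintype.card V with hn
  have hSn : S.card ≤ n := Finset.card_le_univ S
  -- Peeling descends from n, so the induction runs over the number j of removed vertices.
  have hcard : ∀ j ≤ n - 1, (A (n - j)).card = n - j := by
    intro j
    induction j with
    | zero => intro _; rw [Nat.sub_zero, hA, Finset.card_univ]
    | succ j ih =>
      intro hj
      obtain ⟨v, hv, -, he⟩ := hpeel (n - j) (Finset.mem_Icc.2 ⟨by omega, by omega⟩)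
      rw [show n - (j + 1) = n - j - 1 by omega, he, Finset.card_erase_of_mem hv, ih (by omega)]
  have hcard' : ∀ i, 1 ≤ i → i ≤ n → (A i).card = i := by
    intro i hi hin
    have := hcard (n - i) (by omega)
    rwa [show n - (n - i) = i by omega] at this
  obtain ⟨i, hi2, hin, hSi, v, hv, hvS, hmin⟩ : ∃ i, 2 ≤ i ∧ i ≤ n ∧ S ⊆ A i ∧
      ∃ v ∈ A i, v ∈ S ∧ ∀ u ∈ A i, weightedDegree G w (A i) v ≤ weightedDegree G w (A i) u := by
    classical
    have hex : ∃ i, 1 ≤ i ∧ i ≤ n ∧ S ⊆ A i :=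
      ⟨n, by omega, le_rfl, by rw [hA]; exact Finset.subset_univ S⟩
    obtain ⟨h1, h3, h4⟩ := Nat.find_spec hex
    set i := Nat.find hex
    have hi2 : 2 ≤ i := by
      have := Finset.card_le_card h4
      rw [hcard' i h1 h3] at this
      omega
    obtain ⟨v, hv, hmin, he⟩ := hpeel i (Finset.mem_Icc.2 ⟨hi2, h3⟩)
    refine ⟨i, hi2, h3, h4, v, hv, ?_, hmin⟩
    by_contra hvS
    refine Nat.find_min hex (m := i - 1) (by omega) ⟨by omega, by omega, ?_⟩
    rw [he]
    exact fun u hu => Finset.mem_erase.2 ⟨fun h => hvS (h ▸ hu), h4 hu⟩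
  have hAi : (A i).card = i := hcard' i (by omega) hin
  have hΔ := hf.sub_pos hc h2 hS2
  have hfi := hf.pos h2 i hi2
  have hfn := hf.pos h2 n (by omega)
  have hn0 : (0 : ℝ) < n := by exact_mod_cast (show 0 < n by omega)
  have hi0 : (0 : ℝ) < i := by exact_mod_cast (show 0 < i by omega)
  set ρ := fDensity G w f S
  set Δ := f S.card - f (S.card - 1)
  have hρ : 0 ≤ ρ := fDensity_nonneg hw hf S
  -- Degrees only grow on passing from S to the larger set.
  have hd : ρ * Δ ≤ weightedDegree G w (A i) v :=
    (hS.le_weightedDegree hf h2 hS2 hvS).trans (by exact_mod_cast weightedDegree_mono hw hSi v)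
  have hsum : (i : ℝ) * weightedDegree G w (A i) v ≤ 2 * inducedWeight G w (A i) := by
    have := Finset.card_nsmul_le_sum (A i) (weightedDegree G w (A i)) _ hmin
    rw [sum_weightedDegree, hAi, nsmul_eq_mul] at this
    exact_mod_cast this
  have hconv := hf.mul_le_mul hc hin
  have hP := hmax i (Finset.mem_Icc.2 ⟨by omega, hin⟩)
  rw [fDensity, hAi, div_le_iff₀ hfi] at hP
  set δ := fDensity G w f P
  have hδ : 0 ≤ δ := fDensity_nonneg hw hf P
  -- Minimum degree at least ρΔ bounds the weight of the i-set from below, its density is at most δ,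
  -- and f(i)/i ≤ f(n)/n replaces i by n. All factors stay multiplied out.
  have hmain : i * (ρ * Δ * n) ≤ i * (2 * f n * δ) := by
    calc (i : ℝ) * (ρ * Δ * n) = i * (ρ * Δ) * n := by ring
      _ ≤ i * weightedDegree G w (A i) v * n := by gcongr
      _ ≤ 2 * inducedWeight G w (A i) * n := by gcongr
      _ ≤ 2 * (δ * f i) * n := by gcongr
      _ = 2 * δ * (f i * n) := by ring
      _ ≤ 2 * δ * (f n * i) := by gcongr
      _ = _ := by ring
  have hfin := le_of_mul_le_mul_left hmain hi0
  have e : (2 * f n / n) / Δ * δ = (2 * f n * δ) / (Δ * n) := by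
    field_simp
  rw [e, le_div_iff₀ (by positivity)]
  linarith

theorem IsAlgorithmOutput.approx (hw : ∀ e ∈ G.edgeSet, 0 < w e) (hne : G.edgeSet.Nonempty)
    (hf : IsSizeFunction f) (hc : IsConvex f) (h2 : 0 < f 2) {S Sopt : Finset V}
    (hS : IsAlgorithmOutput G w f S) (hopt : IsOptimal G w f Sopt) :
    fDensity G w f Sopt ≤
      min ((f 2 / 2) / (f Sopt.card / (Sopt.card : ℝ) ^ 2))
          ((2 * f (Fintype.card V) / (Fintype.card V : ℝ)) /
            (f Sopt.card - f (Sopt.card - 1))) *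
        fDensity G w f S := by
  obtain ⟨B, P, hB, hP, hS⟩ := hS
  obtain ⟨hS2, -⟩ := hopt.two_le_card hw hne h2
  have hBS : fDensity G w f B ≤ fDensity G w f S := by
    rcases hS with ⟨rfl, -⟩ | ⟨rfl, h⟩
    exacts [le_rfl, h]
  have hPS : fDensity G w f P ≤ fDensity G w f S := by
    rcases hS with ⟨rfl, h⟩ | ⟨rfl, -⟩
    exacts [h, le_rfl]
  rcases min_cases ((f 2 / 2) / (f Sopt.card / (Sopt.card : ℝ) ^ 2))
      ((2 * f (Fintype.card V) / (Fintype.card V : ℝ)) /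
        (f Sopt.card - f (Sopt.card - 1))) with ⟨h, -⟩ | ⟨h, -⟩
  · rw [h]
    refine (IsOptimal.le_of_bruteForce hw hf h2 hS2 (isBruteForceOutput_two.1 hB)).trans ?_
    have := hf.nonneg Sopt.card
    gcongr
  · rw [h]
    refine (hopt.le_of_peeling hw hf hc h2 hS2 hP).trans ?_
    have := hf.nonneg (Fintype.card V)
    have := hf.sub_pos hc h2 hS2
    gcongr

end

-- From operation counts to m + n log n

/-- The number of slots is logarithmic. -/
theorem log_card_add_le {n m : ℕ} (hn : 2 ≤ n) (hm : m ≤ n.choose 2) :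
    ((2 * Nat.log 2 (n + 2 * m) + 1 + 1 : ℕ) : ℝ) ≤ 10 * Real.log n := by
  -- A simple graph has at most n(n − 1)/2 edges, so the logarithm of the number of cells is at most
  -- twice that of n.
  have h1 : n + 2 * m ≤ n ^ 2 := by
    rw [Nat.choose_two_right] at hm
    have h3 : 2 * (n * (n - 1) / 2) ≤ n * (n - 1) := Nat.mul_div_le _ _
    obtain ⟨k, rfl⟩ : ∃ k, n = k + 1 := ⟨n - 1, by omega⟩
    simp only [Nat.add_sub_cancel] at h3 hm
    nlinarith
  have hlog2 := Real.log_two_gt_d9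
  have hn' : (2 : ℝ) ≤ n := by exact_mod_cast hn
  have hlogn : Real.log 2 ≤ Real.log n := Real.log_le_log (by norm_num) hn'
  have h2 : (Nat.log 2 (n + 2 * m) : ℝ) * Real.log 2 ≤ 2 * Real.log n := by
    have h3 : (2 : ℝ) ^ Nat.log 2 (n + 2 * m) ≤ (n : ℝ) ^ 2 := by
      exact_mod_cast (Nat.pow_log_le_self 2 (by omega)).trans h1
    have := Real.log_le_log (by positivity) h3
    rwa [Real.log_pow, Real.log_pow] at this
  have h4 : (0 : ℝ) ≤ Nat.log 2 (n + 2 * m) := Nat.cast_nonneg _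
  push_cast
  -- The left side is at most (4/log 2)·log n + 2, and 2 ≤ (2/log 2)·log n because n ≥ 2; altogether
  -- 6/log 2 < 10.
  nlinarith

end FDS

theorem mainTheorem1 :
    ∃ (P : FDS.Prog) (C : ℝ),
      ∀ (V : Type*) [Fintype V] [DecidableEq V] (G : SimpleGraph V) [DecidableRel G.Adj]
        (w : Sym2 V → ℚ) (f : ℕ → ℝ),
        (∀ e ∈ G.edgeSet, 0 < w e) → G.edgeSet.Nonempty →
        FDS.IsSizeFunction f → FDS.IsConvex f → 0 < f 2 →
        -- running time: `P` implements the algorithm within `C * (m + n log n)` operations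
        (∀ (ι : V ≃ Fin (Fintype.card V)) (edge : Fin G.edgeFinset.card → V × V),
          FDS.IsEdgeList G edge →
          ∃ (t : ℕ) (σ : FDS.Store),
            FDS.Run f P (FDS.inputStore ι w edge) t σ ∧
            (t : ℝ) ≤ C * ((G.edgeFinset.card : ℝ) +
              (Fintype.card V : ℝ) * Real.log (Fintype.card V : ℝ)) ∧
            FDS.IsAlgorithmOutput G w f (FDS.outputSet ι σ)) ∧
        -- approximation ratio, for every result that the algorithm can return
        (∀ S Sopt : Finset V, FDS.IsAlgorithmOutput G w f S → FDS.IsOptimal G w f Sopt →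
          FDS.fDensity G w f Sopt ≤
            min ((f 2 / 2) / (f Sopt.card / (Sopt.card : ℝ) ^ 2))
                ((2 * f (Fintype.card V) / (Fintype.card V : ℝ)) /
                  (f Sopt.card - f (Sopt.card - 1))) *
              FDS.fDensity G w f S) := by
  -- The constant is 4000 from the operation count times 10 from the logarithmic bound on L + 1; it
  -- exceeds the coefficient 3000 of m.
  refine ⟨FDS.algorithm, 40000, fun V _ _ G _ w f hw hne hf hc h2 =>
    ⟨fun ι edge he => ?_, fun S Sopt hS hopt => hS.approx hw hne hf hc h2 hopt⟩⟩
  obtain ⟨t, σ, hrun, hout, ht⟩ := FDS.run_algorithm hw hne hf (hf.pos h2) ι rfl he le_rfl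
  refine ⟨t, σ, hrun, ?_, hout⟩
  have hn : 2 ≤ Fintype.card V := by
    obtain ⟨e, he⟩ := hne
    induction e with
    | _ a b =>
      rw [SimpleGraph.mem_edgeSet] at he
      exact Fintype.one_lt_card_iff.2 ⟨a, b, he.ne⟩
  have hL := FDS.log_card_add_le hn G.card_edgeFinset_le_card_choose_two
  have ht' : (t : ℝ) ≤ 3000 * (G.edgeFinset.card : ℝ) + 4000 *
      (((2 * Nat.log 2 (Fintype.card V + 2 * G.edgeFinset.card) + 1 + 1 : ℕ) : ℝ) *
        (Fintype.card V : ℝ)) := by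
    exact_mod_cast ht
  have hmul := mul_le_mul_of_nonneg_right hL (Nat.cast_nonneg (α := ℝ) (Fintype.card V))
  have hm : (0 : ℝ) ≤ G.edgeFinset.card := Nat.cast_nonneg _
  linarith
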